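/- **Theorem.** Let $\mathfrak g$ be a finite-dimensional complex simple Lie algebra with a Cartan subalgebra $\mathfrak h$, root space decomposition $\mathfrak g=\mathfrak h\oplus\bigoplus_{\alpha\in\Delta}\mathfrak g_\alpha$, and a set $\Pi$ of simple roots with corresponding positive roots $\Delta_+$. For $\pi_1,\pi_2\subseteq\Pi$ let $\mathfrak p_{\pi_1}$ be the subalgebra generated by $\mathfrak h$, the $\mathfrak g_\beta$ with $\beta\in\Delta_+$ and the $\mathfrak g_{-\alpha}$ with $\alpha\in\pi_1$; let $\mathfrak p^-_{\pi_2}$ be the subalgebra generated by $\mathfrak h$, the $\mathfrak g_{-\beta}$ with $\beta\in\Delta_+$ and the $\mathfrak g_{\alpha}$ with $\alpha\in\pi_2$; and let $\mathfrak s=\mathfrak p_{\pi_1}\cap\mathfrak p^-_{\pi_2}$ be the corresponding seaweed. It is called indecomposable if $\pi_1\cup\pi_2=\Pi$. Let $\mathfrak r$ be the subalgebra of $\mathfrak s$ generated by $\mathfrak h$ and all root spaces $\mathfrak g_\alpha$ such that $\mathfrak g_\alpha,\mathfrak g_{-\alpha}\subseteq\mathfrak s$ (the reductive part), and let $\mathfrak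 n$ be the ideal of $\mathfrak s$ generated by all root spaces $\mathfrak g_\alpha\subseteq\mathfrak s$ such that $\mathfrak g_{-\alpha}\not\subseteq\mathfrak s$. Then: 1. $\mathfrak s=\mathfrak r\oplus\mathfrak n$ as vector spaces. 2. If $\mathfrak s$ is indecomposable, then $\mathfrak n$ is the nilradical of $\mathfrak s$, that is, its largest nilpotent ideal. 3. $H^q(\mathfrak n,\mathfrak s)^{\mathfrak r}=0$ for all $q\ge 1$, where $H^q(\mathfrak n,\mathfrak s)$ is the Chevalley–Eilenberg cohomology of $\mathfrak n$ with coefficients in $\mathfrak s$ (with the adjoint action), and $\mathfrak r$ acts on it through the adjoint actions on $\mathfrak n$ and $\mathfrak s$. In particular, if $\mathfrak s=\mathfrak r\oplus\mathfrak n$ is an indecomposable seaweed with reductive part $\mathfrak r$ and nilradical $\mathfrak n$, then $H^q(\mathfrak n,\mathfrak s)^{\mathfrak r}=0$ for all $q\ge 1$. -/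

import Mathlib

/-!
Chevalley-Eilenberg cochains on an ideal `n` of a Lie algebra `L`, with coefficients in an
`L`-module `M`: a `q`-cochain is an alternating `q`-linear map `f : n × ⋯ × n → M`.
-/

noncomputable section

namespace Seaweed

section Cohomology

variable {K L : Type*} [Field K] [LieRing L] [LieAlgebra K L] (n : LieIdeal K L)
  (M : Type*) [AddCommGroup M] [Module K M] [LieRingModule L M] [LieModule K L M]

/-- The space `C^q(n, M)` of cochains. -/
abbrev Cochain (q : ℕ) : Type _ := n [⋀^Fin q]→ₗ[K] M

/-- The Chevalley-Eilenberg differential, as a linear map from `C^q(n, M)` to the functions of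
`q + 1` variables in `n`:
`(δf)(x₀, …, x_q) = ∑ᵢ (-1)ⁱ [xᵢ, f(x₀, …, x̂ᵢ, …, x_q)]
  + ∑_{i<j} (-1)ʲ f(x₀, …, [xᵢ, xⱼ], …, x̂ⱼ, …, x_q)`,
where `[xᵢ, xⱼ]` stands in the place of `xᵢ`. Moving it to the front costs the sign `(-1)ⁱ` and
gives the usual term `(-1)^(i+j) f([xᵢ, xⱼ], x₀, …, x̂ᵢ, …, x̂ⱼ, …, x_q)`. -/
def differential (q : ℕ) : Cochain n M q →ₗ[K] ((Fin (q + 1) → n) → M) where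
  toFun f v :=
    (∑ i : Fin (q + 1), (-1 : ℤ) ^ (i : ℕ) • ⁅(v i : L), f (i.removeNth v)⁆) +
      ∑ i : Fin (q + 1), ∑ j ∈ Finset.Ioi i,
        (-1 : ℤ) ^ (j : ℕ) • f (j.removeNth (Function.update v i ⁅v i, v j⁆))
  map_add' f g := by
    funext v
    simp only [AlternatingMap.add_apply, lie_add, smul_add, Finset.sum_add_distrib, Pi.add_apply]
    abel
  map_smul' c f := by
    funext v
    simp only [AlternatingMap.smul_apply, lie_smul, Pi.smul_apply, RingHom.id_apply,
      smul_add, Finset.smul_sum, smul_comm c]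

/-- The action of `x ∈ L` on cochains, `(x · f)(v₁, …, v_q) =
[x, f(v₁, …, v_q)] - ∑ᵢ f(v₁, …, [x, vᵢ], …, v_q)`, as a linear map into the functions of
`q` variables in `n`. -/
def action (q : ℕ) (x : L) : Cochain n M q →ₗ[K] ((Fin q → n) → M) where
  toFun f v := ⁅x, f v⁆ - ∑ i : Fin q, f (Function.update v i ⁅x, v i⁆)
  map_add' f g := by
    funext v
    simp only [AlternatingMap.add_apply, lie_add, Finset.sum_add_distrib, Pi.add_apply]
    abel
  map_smul' c f := by
    funext v
    simp only [AlternatingMap.smul_apply, lie_smul, Pi.smul_apply, RingHom.id_apply,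
      smul_sub, Finset.smul_sum]

/-- The functions of `q` variables that are of the form `δg` with `g ∈ C^(q-1)(n, M)`. -/
def coboundaryFunctions : (q : ℕ) → Submodule K ((Fin q → n) → M)
  | 0 => ⊥
  | q + 1 => LinearMap.range (differential n M q)

/-- The space of cocycles `Z^q(n, M)`. -/
def cocycles (q : ℕ) : Submodule K (Cochain n M q) := LinearMap.ker (differential n M q)

/-- The space of coboundaries, as a subspace of `Z^q(n, M)`. -/
def coboundaries (q : ℕ) : Submodule K (cocycles n M q) where
  carrier := {f | ⇑(f : Cochain n M q) ∈ coboundaryFunctions n M q}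
  zero_mem' := (coboundaryFunctions n M q).zero_mem
  add_mem' hf hg := (coboundaryFunctions n M q).add_mem hf hg
  smul_mem' c _ hf := (coboundaryFunctions n M q).smul_mem c hf

/-- The cohomology `H^q(n, M) = Z^q(n, M) / B^q(n, M)`. -/
abbrev Cohomology (q : ℕ) : Type _ := cocycles n M q ⧸ coboundaries n M q

/-- The subspace `H^q(n, M)^r` of `H^q(n, M)`, for a subalgebra `r` of `L`: the class of a
cocycle `f` is `r`-invariant when, for every `x ∈ r`, the class of `x · f` is zero. -/
def invariantCohomology (r : LieSubalgebra K L) (q : ℕ) : Submodule K (Cohomology n M q) :=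
  Submodule.map (coboundaries n M q).mkQ
    (⨅ x : r, (coboundaryFunctions n M q).comap
      ((action n M q (x : L)).comp (cocycles n M q).subtype))

end Cohomology

section Seaweed

open LieAlgebra LieAlgebra.IsKilling LieModule

variable {𝔤 : Type*} [LieRing 𝔤] [LieAlgebra ℂ 𝔤] [FiniteDimensional ℂ 𝔤] [IsKilling ℂ 𝔤]
  {H : LieSubalgebra ℂ 𝔤} [H.IsCartanSubalgebra]

/-- The standard parabolic subalgebra `𝔭_π`, generated by `𝔥`, by `𝔤_β` for the positive
roots `β`, and by `𝔤_{-α}` for `α ∈ π`. -/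
def parabolic (b : (rootSystem H).Base) (π : Set H.root) : LieSubalgebra ℂ 𝔤 :=
  LieSubalgebra.lieSpan ℂ 𝔤
    ({x | x ∈ H} ∪ {x | ∃ β : H.root, b.IsPos β ∧ x ∈ rootSpace H (β : Weight ℂ H 𝔤)} ∪
      {x | ∃ α ∈ π, x ∈ rootSpace H (-(α : Weight ℂ H 𝔤))})

/-- The opposite parabolic subalgebra `𝔭⁻_π`, generated by `𝔥`, by `𝔤_{-β}` for the positive
roots `β`, and by `𝔤_α` for `α ∈ π`. -/
def oppositeParabolic (b : (rootSystem H).Base) (π : Set H.root) : LieSubalgebra ℂ 𝔤 :=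
  LieSubalgebra.lieSpan ℂ 𝔤
    ({x | x ∈ H} ∪ {x | ∃ β : H.root, b.IsPos β ∧ x ∈ rootSpace H (-(β : Weight ℂ H 𝔤))} ∪
      {x | ∃ α ∈ π, x ∈ rootSpace H (α : Weight ℂ H 𝔤)})

/-- The seaweed subalgebra `𝔭(π₁ | π₂)`. -/
def seaweed (b : (rootSystem H).Base) (π₁ π₂ : Set H.root) : LieSubalgebra ℂ 𝔤 :=
  parabolic b π₁ ⊓ oppositeParabolic b π₂

/-- The seaweed `𝔭(π₁ | π₂)` is indecomposable when `π₁ ∪ π₂` is the set of all simple roots. -/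
def IsIndecomposable (b : (rootSystem H).Base) (π₁ π₂ : Set H.root) : Prop :=
  π₁ ∪ π₂ = (b.support : Set H.root)

variable (H) in
/-- For a subalgebra `𝔰` of `𝔤`, the subalgebra of `𝔰` generated by the elements of `𝔥` and by
the root spaces `𝔤_α` for which both `𝔤_α` and `𝔤_{-α}` lie in `𝔰`. -/
def reductivePart (𝔰 : LieSubalgebra ℂ 𝔤) : LieSubalgebra ℂ 𝔰 :=
  LieSubalgebra.lieSpan ℂ 𝔰
    ({x | (x : 𝔤) ∈ H} ∪
      {x | ∃ α : H.root, (∀ y ∈ rootSpace H (α : Weight ℂ H 𝔤), y ∈ 𝔰) ∧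
        (∀ y ∈ rootSpace H (-(α : Weight ℂ H 𝔤)), y ∈ 𝔰) ∧
        (x : 𝔤) ∈ rootSpace H (α : Weight ℂ H 𝔤)})

variable (H) in
/-- For a subalgebra `𝔰` of `𝔤`, the ideal of `𝔰` generated by the root spaces `𝔤_α` that lie
in `𝔰` and for which `𝔤_{-α}` does not lie in `𝔰`. -/
def nilpotentPart (𝔰 : LieSubalgebra ℂ 𝔤) : LieIdeal ℂ 𝔰 :=
  LieSubmodule.lieSpan ℂ 𝔰
    {x | ∃ α : H.root, (∀ y ∈ rootSpace H (α : Weight ℂ H 𝔤), y ∈ 𝔰) ∧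
      (¬ ∀ y ∈ rootSpace H (-(α : Weight ℂ H 𝔤)), y ∈ 𝔰) ∧
      (x : 𝔤) ∈ rootSpace H (α : Weight ℂ H 𝔤)}

end Seaweed

end Seaweed

end

/-! Everything is read off from sets of roots. With normalized root vectors `e α`, the seaweed is
the sum of `H` and of the lines through `e α` for `α` in a closed set `S`, cut out by sign
conditions on the coefficients at the simple roots (`mem_seaweed`). The reductive part keeps `H` and
the `α` with `±α ∈ S`, the nilpotent part is spanned by the remaining set `R`, and this gives the
direct sum (`isCompl_parts`).

Nilradical: the sum of the coefficients over `π₂ ∖ π₁` minus the sum over `π₁ ∖ π₂` is additive and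
at least one on `R`, so `𝔫` is nilpotent. A nilpotent ideal is stable under `H`, hence contains the
components of its elements. An element of `H` in it must be annihilated by every root of `S`, for
otherwise some `e α` would be an eigenvector with nonzero eigenvalue inside the ideal.
Indecomposability puts every simple root in `S` up to sign, so such an element is zero. A vector `e
α` with `±α ∈ S` is excluded because `⁅e α, e (-α)⁆` would be an element of `H` in the ideal on
which `α` does not vanish (`le_nilpotentPart`).

Cohomology: `H` acts diagonalizably on cochains, so an invariant class has a representative `f`
annihilated by `H`. The ideal is a product of two commuting factors `𝔫₊` and `𝔫₋`, the nilradicals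
of parabolic subalgebras of the Levi subalgebras of `π₂` and `π₁`. The degree defining `𝔫₊` is
nonnegative on `S` and positive exactly on the roots of `𝔫₊`. Hence `f` takes values in `𝔫₊` as soon
as one argument lies there, and likewise for `𝔫₋`; mixed arguments give values in the zero
intersection. So, in degree at least two, `f` is a sum of two cochains, each pulled back from one
factor and with values in it (`mem_coboundarySpace_of_isSide`).

Each of them is treated with Kostant's Laplacian (`diff_codiff_add_codiff_diff`). For a parabolic of
a reductive algebra `M`, twice `dδ + δd` is the Casimir operator of `M` on the coefficients minus
Levi operators on cochains. On a cocycle that is Levi-invariant modulo coboundaries, the Levi terms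
are coboundaries, so `f` composed with the Casimir operator is some `dg`. That operator commutes
with `M` and acts on the root vectors of the nilradical by nonzero scalars (`exists_casimir_e`).
After `g` has been normalized to weight zero and projected, it takes values in the nilradical, where
the Casimir operator can be inverted (`exists_diff_eq`).

This needs `g` to have at least one argument, so degree one is separate. There `f (e α) = c α • e
α`; the cocycle condition and the invariance make `c` additive and compatible with the reductive
roots, so `c` is evaluation at some `G` in `H` (`exists_apply_eq_of_additive`), and `f = d(-G)`. -/

noncomputable section

namespace Seaweed

/-! ### Contractions and derivations on alternating maps. -/

section Calculus

open AlternatingMap (curryLeftLinearMap alternatizeUncurryFin alternatizeUncurryFinLM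
  alternatizeUncurryFin_apply alternatizeUncurryFin_add alternatizeUncurryFin_smul
  alternatizeUncurryFinLM_apply curryLeft_add curryLeft_smul curryLeft_same
  curryLeft_apply_apply neg_one_pow_smul_map_insertNth)

variable {K N V : Type*} [Field K] [AddCommGroup N] [Module K N] [AddCommGroup V] [Module K V]
  {q : ℕ}

/-- Contraction of an alternating map with a vector. -/
def contract : N →ₗ[K] (N [⋀^Fin (q + 1)]→ₗ[K] V) →ₗ[K] N [⋀^Fin q]→ₗ[K] V :=
  (curryLeftLinearMap (R := K) (M := N) (N := V) (n := q)).flip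

/-- Composition of an alternating map with an endomorphism of the space of values. -/
def post : Module.End K V →ₗ[K] (N [⋀^Fin q]→ₗ[K] V) →ₗ[K] N [⋀^Fin q]→ₗ[K] V :=
  LinearMap.mk₂ K (fun T f ↦ T.compAlternatingMap f)
    (fun _ _ _ ↦ rfl) (fun _ _ _ ↦ rfl)
    (fun T f g ↦ by ext; simp) (fun c T f ↦ by ext; simp)

/-- The derivation of the space of alternating maps given by an endomorphism of the space of
arguments. -/
def der : {q : ℕ} → Module.End K N →ₗ[K] (N [⋀^Fin q]→ₗ[K] V) →ₗ[K] N [⋀^Fin q]→ₗ[K] V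
  | 0 => 0
  | _ + 1 => LinearMap.mk₂ K (fun A f ↦ alternatizeUncurryFin (f.curryLeft ∘ₗ A))
    (fun A B f ↦ by rw [LinearMap.comp_add, alternatizeUncurryFin_add])
    (fun c A f ↦ by rw [LinearMap.comp_smul, alternatizeUncurryFin_smul])
    (fun A f g ↦ by rw [curryLeft_add, LinearMap.add_comp, alternatizeUncurryFin_add])
    (fun c A f ↦ by rw [curryLeft_smul, LinearMap.smul_comp, alternatizeUncurryFin_smul])

@[simp] lemma contract_apply (x : N) (f : N [⋀^Fin (q + 1)]→ₗ[K] V) (v : Fin q → N) :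
    contract x f v = f (Matrix.vecCons x v) := rfl

@[simp] lemma post_apply (T : Module.End K V) (f : N [⋀^Fin q]→ₗ[K] V) (v : Fin q → N) :
    post T f v = T (f v) := rfl

/-- Moving the `j`-th argument to the front costs `(-1)^j`, which cancels the sign of the
alternating sum. -/
lemma der_apply (A : Module.End K N) (f : N [⋀^Fin q]→ₗ[K] V) (v : Fin q → N) :
    der A f v = ∑ j, f (Function.update v j (A (v j))) := by
  cases q with
  | zero => simp [der]
  | succ q =>
    change alternatizeUncurryFin (f.curryLeft ∘ₗ A) v = _
    rw [alternatizeUncurryFin_apply]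
    refine Finset.sum_congr rfl fun j _ ↦ ?_
    rw [← Fin.insertNth_removeNth, LinearMap.comp_apply, curryLeft_apply_apply,
      ← neg_one_pow_smul_map_insertNth f j, smul_smul, ← mul_pow]
    simp

/-- This drives the inductions on the degree: an identity of operators is tested after one
contraction, which leaves commutators with contractions and the same identity one degree lower. -/
lemma ext_contract {f g : N [⋀^Fin (q + 1)]→ₗ[K] V} (h : ∀ x, contract x f = contract x g) :
    f = g := by
  ext v
  have := congrArg (fun F ↦ F (Matrix.vecTail v)) (h (Matrix.vecHead v))
  simpa using this

lemma contract_post (x : N) (T : Module.End K V) (f : N [⋀^Fin (q + 1)]→ₗ[K] V) :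
    contract x (post T f) = post T (contract x f) := rfl

lemma contract_der (x : N) (A : Module.End K N) (f : N [⋀^Fin (q + 1)]→ₗ[K] V) :
    contract x (der A f) = der A (contract x f) + contract (A x) f := by
  ext v
  have h0 : Function.update (Matrix.vecCons x v) 0 (A x) = Matrix.vecCons (A x) v :=
    Fin.update_cons_zero (α := fun _ ↦ N) x v (A x)
  have hs : ∀ j, Function.update (Matrix.vecCons x v) j.succ (A (v j)) =
      Matrix.vecCons x (Function.update v j (A (v j))) := fun j ↦ (Fin.cons_update ..).symm
  simp only [contract_apply, der_apply, AlternatingMap.add_apply, Fin.sum_univ_succ,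
    Matrix.cons_val_zero, Matrix.cons_val_succ, h0, hs, add_comm]

/-- Polarization of the vanishing of a double contraction with the same vector. -/
lemma contract_contract (x y : N) (f : N [⋀^Fin (q + 2)]→ₗ[K] V) :
    contract x (contract y f) = - contract y (contract x f) := by
  have h2 : ∀ z : N, contract z (contract z f) = 0 := fun z ↦ curryLeft_same f z
  have h3 := h2 (x + y)
  simp only [map_add, LinearMap.add_apply, h2] at h3
  rw [eq_neg_iff_add_eq_zero, ← h3]
  abel

lemma post_post (S T : Module.End K V) (f : N [⋀^Fin q]→ₗ[K] V) :
    post S (post T f) = post (S * T) f := rfl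

lemma post_der (T : Module.End K V) (A : Module.End K N) (f : N [⋀^Fin q]→ₗ[K] V) :
    post T (der A f) = der A (post T f) := by
  ext v; simp [der_apply]

lemma der_zero_eq (A : Module.End K N) (f : N [⋀^Fin 0]→ₗ[K] V) : der A f = 0 := rfl

/-- Derivations act through the arguments, which reverses the order of composition. Since `lieDer`
subtracts `der`, the reversal becomes the right sign in `lieDer_lieDer_comm`. -/
lemma der_der_comm (A B : Module.End K N) (f : N [⋀^Fin q]→ₗ[K] V) :
    der A (der B f) - der B (der A f) = der (B * A - A * B) f := by
  induction q with
  | zero => simp [der_zero_eq]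
  | succ q ih =>
    refine ext_contract fun x ↦ ?_
    simp only [map_sub, contract_der, map_add, LinearMap.sub_apply, Module.End.mul_apply]
    have := ih (contract x f)
    simp only [map_sub, LinearMap.sub_apply] at this
    rw [← sub_eq_zero] at this ⊢
    rw [← this]
    abel

lemma contract_alternatize (x : N) (φ : N →ₗ[K] N [⋀^Fin (q + 1)]→ₗ[K] V) :
    contract x (alternatizeUncurryFin φ) = φ x - alternatizeUncurryFin (contract x ∘ₗ φ) := by
  ext v
  simp only [contract_apply, alternatizeUncurryFin_apply, Fin.sum_univ_succ (n := q + 1),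
    AlternatingMap.sub_apply, LinearMap.comp_apply]
  rw [sub_eq_add_neg, ← Finset.sum_neg_distrib]
  congr 1
  · simp
  · refine Finset.sum_congr rfl fun j _ ↦ ?_
    rw [Fin.val_succ, pow_succ, mul_neg_one, neg_smul]
    congr 3
    ext i
    refine Fin.cases ?_ (fun i ↦ ?_) i
    · simp [Fin.removeNth]
    · simp [Fin.removeNth]

lemma contract_alternatize_zero (x : N) (φ : N →ₗ[K] N [⋀^Fin 0]→ₗ[K] V) :
    contract x (alternatizeUncurryFin φ) = φ x := by
  ext v
  simp [contract_apply, alternatizeUncurryFin_apply]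

lemma der_eq_alternatize (A : Module.End K N) (f : N [⋀^Fin (q + 1)]→ₗ[K] V) :
    der A f = alternatizeUncurryFin (contract.flip f ∘ₗ A) := rfl

end Calculus

/-! ### The Chevalley-Eilenberg differential and Cartan's formulas. -/

section Differential

open AlternatingMap (curryLeftLinearMap alternatizeUncurryFin alternatizeUncurryFinLM
  alternatizeUncurryFin_apply alternatizeUncurryFin_add alternatizeUncurryFin_smul
  alternatizeUncurryFinLM_apply curryLeft_add curryLeft_smul curryLeft_same
  curryLeft_apply_apply neg_one_pow_smul_map_insertNth)

variable {K N V : Type*} [Field K] [LieRing N] [LieAlgebra K N]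
  [AddCommGroup V] [Module K V] {q : ℕ}

/-- The endomorphism of the space of cochains given by an endomorphism `T` of the space of values
and an endomorphism `A` of the space of arguments. -/
def lieDer (T : Module.End K V) (A : Module.End K N) :
    (N [⋀^Fin q]→ₗ[K] V) →ₗ[K] N [⋀^Fin q]→ₗ[K] V := post T - der A

lemma lieDer_apply (T : Module.End K V) (A : Module.End K N) (f : N [⋀^Fin q]→ₗ[K] V) :
    lieDer T A f = post T f - der A f := rfl

lemma contract_lieDer (x : N) (T : Module.End K V) (A : Module.End K N)
    (f : N [⋀^Fin (q + 1)]→ₗ[K] V) :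
    contract x (lieDer T A f) = lieDer T A (contract x f) - contract (A x) f := by
  simp only [lieDer_apply, map_sub, contract_post, contract_der]
  abel

lemma lieDer_lieDer_comm (S T : Module.End K V) (A B : Module.End K N)
    (f : N [⋀^Fin q]→ₗ[K] V) :
    lieDer S A (lieDer T B f) - lieDer T B (lieDer S A f) =
      lieDer (S * T - T * S) (A * B - B * A) f := by
  have h := der_der_comm A B f
  simp only [lieDer_apply, map_sub, LinearMap.sub_apply, post_der, post_post] at h ⊢
  rw [← sub_eq_zero] at h ⊢
  rw [← h]
  abel

/-- The Chevalley-Eilenberg differential attached to a linear map `a : N → End V`. -/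
def diff (a : N →ₗ[K] Module.End K V) :
    (N [⋀^Fin q]→ₗ[K] V) →ₗ[K] N [⋀^Fin (q + 1)]→ₗ[K] V :=
  alternatizeUncurryFinLM ∘ₗ
    -- Alternating the derivations `ad x` produces the bracket of each pair of arguments twice, once
    -- from either member; hence the factor one half.
    (post ∘ₗ a - (2⁻¹ : K) • (der ∘ₗ (LieAlgebra.ad K N : N →ₗ[K] Module.End K N))).flip

/-- The Lie derivative of a cochain along an element of `N`. -/
abbrev lieAlong (a : N →ₗ[K] Module.End K V) (x : N) :
    (N [⋀^Fin q]→ₗ[K] V) →ₗ[K] N [⋀^Fin q]→ₗ[K] V := lieDer (a x) (LieAlgebra.ad K N x)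

lemma contract_diff_zero (a : N →ₗ[K] Module.End K V) (x : N) (f : N [⋀^Fin 0]→ₗ[K] V) :
    contract x (diff a f) = lieAlong a x f := by
  simp only [diff, LinearMap.comp_apply, alternatizeUncurryFinLM_apply, contract_alternatize_zero]
  simp [lieAlong, lieDer_apply, der_zero_eq]

variable [CharZero K]

/-- Cartan's formula. Half of the bracket term of the Lie derivative comes from `x` filling the slot
of the alternation, the other half from the derivations `ad y` hitting the contracted `x`. -/
lemma contract_diff (a : N →ₗ[K] Module.End K V) (x : N) (f : N [⋀^Fin (q + 1)]→ₗ[K] V) :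
    contract x (diff a f) = lieAlong a x f - diff a (contract x f) := by
  have key : contract x ∘ₗ ((post ∘ₗ a -
        (2⁻¹ : K) • (der ∘ₗ (LieAlgebra.ad K N : N →ₗ[K] Module.End K N))).flip f) =
      (post ∘ₗ a - (2⁻¹ : K) • (der ∘ₗ (LieAlgebra.ad K N : N →ₗ[K] Module.End K N))).flip
        (contract x f) + (2⁻¹ : K) • (contract.flip f ∘ₗ LieAlgebra.ad K N x) := by
    ext1 y
    simp only [LinearMap.comp_apply, LinearMap.flip_apply, LinearMap.sub_apply, map_sub,
      LinearMap.smul_apply, map_smul, contract_post, contract_der, LinearMap.add_apply,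
      LieHom.coe_toLinearMap, LieAlgebra.ad_apply]
    rw [← lie_skew x y, map_neg, LinearMap.neg_apply]
    module
  simp only [diff, LinearMap.comp_apply, alternatizeUncurryFinLM_apply, contract_alternatize]
  rw [key, alternatizeUncurryFin_add, alternatizeUncurryFin_smul, ← der_eq_alternatize]
  simp only [LinearMap.flip_apply, LinearMap.sub_apply, LinearMap.comp_apply,
    LinearMap.smul_apply, LieHom.coe_toLinearMap, lieAlong, lieDer_apply]
  module

/-- Contraction with `x` turns the claim, through Cartan's formula, into the commutator of two Lie
derivatives and the same claim one degree lower. The hypotheses express that `A` is a derivation and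
that `T` is compatible with the action. -/
lemma lieDer_diff_comm (a : N →ₗ[K] Module.End K V) (T : Module.End K V) (A : Module.End K N)
    (hT : ∀ x, T * a x - a x * T = a (A x)) (hA : ∀ x y, A ⁅x, y⁆ = ⁅A x, y⁆ + ⁅x, A y⁆)
    (f : N [⋀^Fin q]→ₗ[K] V) :
    lieDer T A (diff a f) = diff a (lieDer T A f) := by
  have hAd : ∀ x, A * LieAlgebra.ad K N x - LieAlgebra.ad K N x * A =
      LieAlgebra.ad K N (A x) := fun x ↦ by
    ext y; simp [hA]
  induction q with
  | zero =>
    refine ext_contract fun x ↦ ?_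
    rw [contract_lieDer, contract_diff_zero, contract_diff_zero, contract_diff_zero, sub_eq_iff_eq_add,
      ← sub_eq_iff_eq_add', lieDer_lieDer_comm, hT, hAd]
  | succ q ih =>
    refine ext_contract fun x ↦ ?_
    have h := lieDer_lieDer_comm T (a x) A (LieAlgebra.ad K N x) f
    rw [hT, hAd] at h
    rw [contract_lieDer, contract_diff, contract_diff, contract_diff, contract_lieDer, map_sub,
      map_sub, ih, lieAlong, lieAlong, ← h]
    abel

/-- By Cartan's formula, contracting `d²` leaves the commutator of `d` with a Lie derivative, which
vanishes, and `d²` in lower degree. -/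
lemma diff_diff (a : N →ₗ[K] Module.End K V)
    (ha : ∀ x y, a ⁅x, y⁆ = a x * a y - a y * a x) (f : N [⋀^Fin q]→ₗ[K] V) :
    diff a (diff a f) = 0 := by
  have hL : ∀ (x : N) (k : ℕ) (g : N [⋀^Fin k]→ₗ[K] V),
      lieAlong a x (diff a g) = diff a (lieAlong a x g) := fun x k g ↦
    lieDer_diff_comm a _ _ (fun y ↦ by simp [ha]) (fun y z ↦ by simp) g
  induction q with
  | zero =>
    refine ext_contract fun x ↦ ?_
    rw [contract_diff, contract_diff_zero, hL, sub_self, map_zero]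
  | succ q ih =>
    refine ext_contract fun x ↦ ?_
    rw [contract_diff, contract_diff, map_sub, ih, hL, sub_zero, sub_self, map_zero]

end Differential

/-! ### Parabolic decompositions, Casimir tensors and Kostant's codifferential. -/

section Kostant

open scoped TensorProduct

/-- A parabolic decomposition of a Lie subalgebra `M` of `L` with respect to an invariant form:
`M` is the sum of the image of `N`, the span of the `f i`, and the span of the `x k`, with `f`
dual to the basis `e` of `N` and `x'` dual to `x`. -/
structure ParabolicData {K L N : Type*} [Field K] [LieRing L] [LieAlgebra K L] [LieRing N]
    [LieAlgebra K N] (κ : LinearMap.BilinForm K L) (M : LieSubalgebra K L) (φ : N →ₗ⁅K⁆ L)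
    (I J : Type*) [Fintype I] [Fintype J] where
  /-- basis of the nilradical -/
  e : I → N
  /-- dual basis of the opposite nilradical -/
  f : I → L
  /-- basis of the Levi factor -/
  x : J → L
  /-- dual basis of the Levi factor -/
  x' : J → L
  symm : ∀ u w, κ u w = κ w u
  inv : ∀ u v w, κ ⁅u, v⁆ w = κ u ⁅v, w⁆
  mem_φ : ∀ n, φ n ∈ M
  mem_f : ∀ i, f i ∈ M
  mem_x : ∀ k, x k ∈ M
  expand : ∀ u ∈ M, u = ∑ j, κ (f j) u • φ (e j) + ∑ j, κ (φ (e j)) u • f j +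
    ∑ k, κ (x' k) u • x k
  expand_φ : ∀ n, ∑ j, κ (f j) (φ n) • e j = n
  swap : ∑ k, x k ⊗ₜ[K] x' k = ∑ k, x' k ⊗ₜ[K] x k
  lie_e_f : ∀ i j, κ (f j) ⁅f i, φ (e i)⁆ = 0

namespace ParabolicData

variable {K L N V I J : Type*} [Field K] [LieRing L] [LieAlgebra K L] [LieRing N]
  [LieAlgebra K N] [AddCommGroup V] [Module K V] [LieRingModule L V] [LieModule K L V]
  [Fintype I] [Fintype J]
  {κ : LinearMap.BilinForm K L} {M : LieSubalgebra K L} {φ : N →ₗ⁅K⁆ L}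
  (D : ParabolicData κ M φ I J) {q : ℕ}

/-- The projection to the nilradical. -/
def proj : L →ₗ[K] N := ∑ j, (κ (D.f j)).smulRight (D.e j)

/-- The endomorphism of `N` induced by `ad u`. -/
def pad : L →ₗ[K] Module.End K N where
  toFun u := D.proj ∘ₗ (LieAlgebra.ad K L u : Module.End K L) ∘ₗ (φ : N →ₗ[K] L)
  map_add' u v := by ext; simp
  map_smul' c u := by ext; simp

lemma proj_apply (u : L) : D.proj u = ∑ j, κ (D.f j) u • D.e j := by
  simp [proj]

lemma pad_apply (u : L) (n : N) : D.pad u n = D.proj ⁅u, φ n⁆ := rfl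

@[simp] lemma proj_φ (n : N) : D.proj (φ n) = n := by rw [proj_apply, D.expand_φ]

lemma φ_proj (u : L) : φ (D.proj u) = ∑ j, κ (D.f j) u • φ (D.e j) := by
  rw [proj_apply, map_sum]; simp

lemma sub_φ_proj {u : L} (hu : u ∈ M) :
    u - φ (D.proj u) = ∑ j, κ (φ (D.e j)) u • D.f j + ∑ k, κ (D.x' k) u • D.x k := by
  have := D.expand u hu
  rw [← D.φ_proj, add_assoc] at this
  exact sub_eq_of_eq_add' this

lemma pad_φ (n : N) : D.pad (φ n) = LieAlgebra.ad K N n := by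
  ext m; rw [pad_apply, ← LieHom.map_lie, proj_φ, LieAlgebra.ad_apply]

lemma pad_f_e (i : I) : D.pad (D.f i) (D.e i) = 0 := by
  simp [pad_apply, proj_apply, D.lie_e_f]

lemma swap_apply {W : Type*} [AddCommGroup W] [Module K W] (B : L →ₗ[K] L →ₗ[K] W) :
    ∑ k, B (D.x k) (D.x' k) = ∑ k, B (D.x' k) (D.x k) := by
  have := congrArg (TensorProduct.lift B) D.swap
  simpa using this

/-- Invariance of the Casimir tensor. -/
lemma casimir_invariance {W : Type*} [AddCommGroup W] [Module K W] (B : N →ₗ[K] L →ₗ[K] W)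
    (n : N) :
    ∑ i, B ⁅n, D.e i⁆ (D.f i) + ∑ i, B (D.e i) ⁅φ n, D.f i⁆ =
      ∑ k, B (D.pad (D.x' k) n) (D.x k) + ∑ i, B (D.pad (D.f i) n) (φ (D.e i)) := by
  have h : ∀ i, B (D.e i) ⁅φ n, D.f i⁆ = ∑ j, κ (D.f j) ⁅φ n, D.f i⁆ • B (D.e i) (φ (D.e j)) +
      ∑ j, κ (φ (D.e j)) ⁅φ n, D.f i⁆ • B (D.e i) (D.f j) +
      ∑ k, κ (D.x' k) ⁅φ n, D.f i⁆ • B (D.e i) (D.x k) := fun i ↦ by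
    conv_lhs => rw [D.expand _ (M.lie_mem (D.mem_φ n) (D.mem_f i))]
    simp only [map_add, map_sum, map_smul]
  -- Invariance of the form moves the bracket from `f i` to `u`, after which the sum over `i` is the
  -- projection.
  have h1 : ∀ u, ∑ i, κ u ⁅φ n, D.f i⁆ • D.e i = D.proj ⁅u, φ n⁆ := fun u ↦ by
    rw [proj_apply]
    exact Finset.sum_congr rfl fun i _ ↦ by rw [← D.inv, D.symm]
  have h2 : ∀ (u w : L), ∑ i, κ u ⁅φ n, D.f i⁆ • B (D.e i) w = B (D.proj ⁅u, φ n⁆) w :=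
    fun u w ↦ by
      rw [← h1]
      simp only [map_sum, map_smul, LinearMap.sum_apply, LinearMap.smul_apply]
  simp only [h, Finset.sum_add_distrib]
  rw [Finset.sum_comm, Finset.sum_comm (f := fun i j ↦ κ (φ (D.e j)) ⁅φ n, D.f i⁆ • _),
    Finset.sum_comm (f := fun i j ↦ κ (D.x' j) ⁅φ n, D.f i⁆ • _)]
  simp only [h2, pad_apply]
  -- The part of the expansion along the `f j` cancels the first sum on the left.
  have h3 : ∀ j, B (D.proj ⁅φ (D.e j), φ n⁆) (D.f j) = - B ⁅n, D.e j⁆ (D.f j) := fun j ↦ by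
    rw [← LieHom.map_lie, proj_φ, ← lie_skew, map_neg, LinearMap.neg_apply]
  simp only [h3, Finset.sum_neg_distrib]
  abel

/-- The coefficients `κ (f j) ⁅f i, φ n⁆ = κ ⁅f j, f i⁆ (φ n)` are antisymmetric in `i` and `j`. -/
lemma sum_e_pad_antisymm {W : Type*} [AddCommGroup W] [Module K W] (B : N →ₗ[K] N →ₗ[K] W)
    (n : N) :
    ∑ i, B (D.e i) (D.pad (D.f i) n) = - ∑ i, B (D.pad (D.f i) n) (D.e i) := by
  simp only [pad_apply, proj_apply, map_sum, map_smul, LinearMap.sum_apply, LinearMap.smul_apply]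
  rw [Finset.sum_comm, ← Finset.sum_neg_distrib]
  refine Finset.sum_congr rfl fun i _ ↦ ?_
  rw [← Finset.sum_neg_distrib]
  refine Finset.sum_congr rfl fun j _ ↦ ?_
  rw [← D.inv, ← D.inv, ← lie_skew, map_neg, LinearMap.neg_apply, neg_smul]

/-- The endomorphism `v ↦ π [n, (1 - π) [u, v]]` of `N`. -/
def cross (n : N) (u : L) : Module.End K N :=
  D.proj ∘ₗ (LieAlgebra.ad K L (φ n) : Module.End K L) ∘ₗ
    (LinearMap.id - (φ : N →ₗ[K] L) ∘ₗ D.proj) ∘ₗ (LieAlgebra.ad K L u : Module.End K L) ∘ₗ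
    (φ : N →ₗ[K] L)

lemma cross_apply (n v : N) (u : L) :
    D.cross n u v = D.proj ⁅φ n, ⁅u, φ v⁆ - φ (D.proj ⁅u, φ v⁆)⁆ := rfl

variable [CharZero K]

lemma sum_alternating_eq_zero {W : Type*} [AddCommGroup W] [Module K W] (c : I → I → K)
    (hc : ∀ a b, c a b = c b a) (B : N →ₗ[K] N →ₗ[K] W) (hB : ∀ u, B u u = 0) :
    ∑ a, ∑ b, c a b • B (D.e a) (D.e b) = 0 := by
  have hanti : ∀ u w, B u w = - B w u := fun u w ↦ by
    have := hB (u + w)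
    simp only [map_add, LinearMap.add_apply, hB, zero_add, add_zero] at this
    exact eq_neg_of_add_eq_zero_right this
  have h : ∑ a, ∑ b, c a b • B (D.e a) (D.e b) = - ∑ a, ∑ b, c a b • B (D.e a) (D.e b) := by
    conv_lhs => rw [Finset.sum_comm]
    rw [← Finset.sum_neg_distrib]
    refine Finset.sum_congr rfl fun a _ ↦ ?_
    rw [← Finset.sum_neg_distrib]
    refine Finset.sum_congr rfl fun b _ ↦ ?_
    rw [hc b a, hanti, smul_neg]
  have : (2 : K) • ∑ a, ∑ b, c a b • B (D.e a) (D.e b) = 0 := by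
    rw [two_smul]; nth_rewrite 1 [h]; simp
  simpa using this

/-- In the basis `e` the whole expression is `∑ c a b • B (e a) (e b)` with `c` symmetric, and an
alternating `B` annihilates it. The part of the first sum along the `f j` is exchanged with the last
sum when `a` and `b` are swapped; its Levi part is exchanged with the middle sum, by the symmetry
`swap` of the Levi tensor. -/
lemma cross_sum {W : Type*} [AddCommGroup W] [Module K W] (B : N →ₗ[K] N →ₗ[K] W)
    (hB : ∀ u, B u u = 0) (n v : N) :
    ∑ i, B (D.e i) (D.cross n (D.f i) v) + ∑ k, B (D.pad (D.x' k) n) (D.pad (D.x k) v) +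
      ∑ i, B (D.pad (D.f i) n) ⁅D.e i, v⁆ = 0 := by
  set u : I → L := fun a ↦ ⁅D.f a, φ v⁆ with hu
  set w : I → L := fun a ↦ ⁅D.f a, φ n⁆ with hw
  have hu' : ∀ a y, κ (D.f a) ⁅y, φ v⁆ = - κ (u a) y := fun a y ↦ by
    rw [← lie_skew, map_neg, ← D.inv]
  have hw' : ∀ a y, κ (D.f a) ⁅y, φ n⁆ = - κ (w a) y := fun a y ↦ by
    rw [← lie_skew, map_neg, ← D.inv]
  have hw'' : ∀ a y, κ (D.f a) ⁅φ n, y⁆ = κ (w a) y := fun a y ↦ by rw [← D.inv]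
  have t1 : ∀ a, B (D.e a) (D.cross n (D.f a) v) =
      ∑ b, (∑ j, κ (u a) (φ (D.e j)) * κ (w b) (D.f j) +
        ∑ k, κ (u a) (D.x' k) * κ (w b) (D.x k)) • B (D.e a) (D.e b) := fun a ↦ by
    rw [cross_apply, D.sub_φ_proj (M.lie_mem (D.mem_f a) (D.mem_φ v)), proj_apply, map_sum]
    refine Finset.sum_congr rfl fun b _ ↦ ?_
    rw [map_smul, hw'']
    simp only [map_add, map_sum, map_smul, smul_eq_mul]
    simp only [D.symm _ ⁅D.f a, φ v⁆]
    rfl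
  have t2 : ∀ k, B (D.pad (D.x' k) n) (D.pad (D.x k) v) =
      ∑ a, ∑ b, (κ (w a) (D.x' k) * κ (u b) (D.x k)) • B (D.e a) (D.e b) := fun k ↦ by
    simp only [pad_apply, proj_apply, hu', hw', map_sum, map_smul, LinearMap.sum_apply,
      LinearMap.smul_apply, Finset.smul_sum, smul_smul, neg_mul_neg]
    rw [Finset.sum_comm]
    exact Finset.sum_congr rfl fun a _ ↦ Finset.sum_congr rfl fun b _ ↦ by rw [mul_comm]
  have t3 : ∀ i, B (D.pad (D.f i) n) ⁅D.e i, v⁆ =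
      ∑ a, ∑ b, (κ (w a) (D.f i) * κ (u b) (φ (D.e i))) • B (D.e a) (D.e b) := fun i ↦ by
    rw [← D.proj_φ ⁅D.e i, v⁆, LieHom.map_lie]
    simp only [pad_apply, proj_apply, hu', hw', map_sum, map_smul, LinearMap.sum_apply,
      LinearMap.smul_apply, Finset.smul_sum, smul_smul, neg_mul_neg]
    rw [Finset.sum_comm]
    exact Finset.sum_congr rfl fun a _ ↦ Finset.sum_congr rfl fun b _ ↦ by rw [mul_comm]
  have t2' : ∑ k, B (D.pad (D.x' k) n) (D.pad (D.x k) v) =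
      ∑ a, ∑ b, (∑ k, κ (w a) (D.x' k) * κ (u b) (D.x k)) • B (D.e a) (D.e b) := by
    simp only [t2, Finset.sum_smul]
    rw [Finset.sum_comm]
    exact Finset.sum_congr rfl fun a _ ↦ Finset.sum_comm
  have t3' : ∑ i, B (D.pad (D.f i) n) ⁅D.e i, v⁆ =
      ∑ a, ∑ b, (∑ i, κ (w a) (D.f i) * κ (u b) (φ (D.e i))) • B (D.e a) (D.e b) := by
    simp only [t3, Finset.sum_smul]
    rw [Finset.sum_comm]
    exact Finset.sum_congr rfl fun a _ ↦ Finset.sum_comm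
  rw [t2', t3']
  simp only [t1, ← Finset.sum_add_distrib, ← add_smul]
  refine D.sum_alternating_eq_zero _ (fun a b ↦ ?_) B hB
  have hs : ∀ a b, ∑ k, κ (u a) (D.x' k) * κ (w b) (D.x k) =
      ∑ k, κ (w b) (D.x' k) * κ (u a) (D.x k) := fun a b ↦ by
    have := D.swap_apply (LinearMap.mk₂ K (fun y z ↦ κ (u a) z * κ (w b) y)
      (by intros; simp; ring) (by intros; simp; ring) (by intros; simp; ring)
      (by intros; simp; ring))
    simp only [LinearMap.mk₂_apply] at this
    rw [this]
    exact Finset.sum_congr rfl fun k _ ↦ mul_comm _ _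
  rw [hs, ← hs b a]
  have hm : ∀ a b, ∑ j, κ (u a) (φ (D.e j)) * κ (w b) (D.f j) =
      ∑ j, κ (w b) (D.f j) * κ (u a) (φ (D.e j)) := fun a b ↦
    Finset.sum_congr rfl fun k _ ↦ mul_comm _ _
  rw [hm a b, hm b a]
  ring

/-- The Lie derivative of cochains along an element `u` of `L`. -/
abbrev lieD (u : L) : (N [⋀^Fin q]→ₗ[K] V) →ₗ[K] N [⋀^Fin q]→ₗ[K] V :=
  lieDer (LieModule.toEnd K L V u) (D.pad u)

/-- The operator `u - ½ π ad u` on cochains. -/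
def half : L →ₗ[K] (N [⋀^Fin q]→ₗ[K] V) →ₗ[K] N [⋀^Fin q]→ₗ[K] V :=
  post ∘ₗ (LieModule.toEnd K L V : L →ₗ[K] Module.End K V) - (2⁻¹ : K) • (der ∘ₗ D.pad)

/-- Kostant's codifferential. -/
def codiff : (N [⋀^Fin (q + 1)]→ₗ[K] V) →ₗ[K] N [⋀^Fin q]→ₗ[K] V :=
  ∑ i, contract (D.e i) ∘ₗ D.half (D.f i)

variable (φ V) in
/-- The action of `N` on `V`. -/
abbrev act : N →ₗ[K] Module.End K V :=
  (LieModule.toEnd K L V : L →ₗ[K] Module.End K V) ∘ₗ (φ : N →ₗ[K] L)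

/-- The sum of the brackets of the elements of the basis of the nilradical and of its dual. -/
def tr : L := ∑ i, ⁅φ (D.e i), D.f i⁆

variable (V) in
/-- The Casimir operator. -/
def casimir : Module.End K V :=
  ∑ k, LieModule.toEnd K L V (D.x k) * LieModule.toEnd K L V (D.x' k) +
    -- The symmetric expression `ef + fe` is rewritten as `2fe + ⁅e, f⁆`, and the brackets add up to
    -- `tr`.
    (2 : K) • ∑ i, LieModule.toEnd K L V (D.f i) * LieModule.toEnd K L V (φ (D.e i)) +
    LieModule.toEnd K L V D.tr

/-- The difference of the Casimir operators of `M` and of its Levi factor on cochains. -/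
def laplace : (N [⋀^Fin q]→ₗ[K] V) →ₗ[K] N [⋀^Fin q]→ₗ[K] V :=
  post (D.casimir V) - ∑ k, D.lieD (D.x k) ∘ₗ D.lieD (D.x' k) - D.lieD D.tr

end ParabolicData

end Kostant

/-! ### Kostant's formula for the Laplacian. -/

section Kostant

lemma alternatingMap_sum_apply {K N V ι : Type*} [Field K] [AddCommGroup N] [Module K N]
    [AddCommGroup V] [Module K V] {q : ℕ} (s : Finset ι) (g : ι → N [⋀^Fin q]→ₗ[K] V)
    (v : Fin q → N) : (∑ i ∈ s, g i) v = ∑ i ∈ s, g i v := by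
  classical
  induction s using Finset.induction_on with
  | empty => simp
  | insert a s ha ih => simp [Finset.sum_insert ha, ih]

namespace ParabolicData

variable {K L N V I J : Type*} [Field K] [LieRing L] [LieAlgebra K L] [LieRing N]
  [LieAlgebra K N] [AddCommGroup V] [Module K V] [LieRingModule L V] [LieModule K L V]
  [Fintype I] [Fintype J]
  {κ : LinearMap.BilinForm K L} {M : LieSubalgebra K L} {φ : N →ₗ⁅K⁆ L}
  (D : ParabolicData κ M φ I J) {q : ℕ}

lemma half_apply (u : L) (g : N [⋀^Fin q]→ₗ[K] V) :
    D.half u g = post (LieModule.toEnd K L V u) g - (2⁻¹ : K) • der (D.pad u) g := rfl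

lemma codiff_apply (g : N [⋀^Fin (q + 1)]→ₗ[K] V) :
    D.codiff g = ∑ i, contract (D.e i) (D.half (D.f i) g) := by
  simp [codiff]

lemma laplace_apply (g : N [⋀^Fin q]→ₗ[K] V) :
    D.laplace g = post (D.casimir V) g - ∑ k, D.lieD (D.x k) (D.lieD (D.x' k) g) -
      D.lieD D.tr g := by
  simp [laplace]


lemma lieAlong_eq (n : N) : (lieAlong (act V φ) n : (N [⋀^Fin q]→ₗ[K] V) →ₗ[K] _) =
    D.lieD (φ n) := by
  rw [lieD, D.pad_φ]; rfl

lemma lieD_eq_half [CharZero K] (u : L) (g : N [⋀^Fin q]→ₗ[K] V) :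
    D.lieD u g = D.half u g - (2⁻¹ : K) • der (D.pad u) g := by
  rw [half_apply, lieDer_apply]
  module

lemma contract_half (n : N) (u : L) (g : N [⋀^Fin (q + 1)]→ₗ[K] V) :
    contract n (D.half u g) = D.half u (contract n g) - (2⁻¹ : K) • contract (D.pad u n) g := by
  simp only [half_apply, map_sub, map_smul, contract_post, contract_der]
  module

lemma lieD_contract (u : L) (n : N) (g : N [⋀^Fin (q + 1)]→ₗ[K] V) :
    D.lieD u (contract n g) = contract n (D.lieD u g) + contract (D.pad u n) g := by
  rw [contract_lieDer]; abel

variable [CharZero K]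

/-- The contraction with a bivector that measures the failure of the codifferential to
anticommute with contractions. -/
def bivector (n : N) (g : N [⋀^Fin (q + 2)]→ₗ[K] V) : N [⋀^Fin q]→ₗ[K] V :=
  (2⁻¹ : K) • ∑ i, contract (D.e i) (contract (D.pad (D.f i) n) g)

/-- Contractions anticommute with each other; the bivector term arises when the derivation inside
`half` hits the vector `n`. -/
lemma contract_codiff (n : N) (g : N [⋀^Fin (q + 2)]→ₗ[K] V) :
    contract n (D.codiff g) = D.bivector n g - D.codiff (contract n g) := by
  simp only [codiff_apply, bivector, map_sum, Finset.smul_sum, ← Finset.sum_sub_distrib]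
  refine Finset.sum_congr rfl fun i _ ↦ ?_
  rw [contract_contract, contract_half, map_sub, map_smul]
  abel

/-- The operator `[bivector, diff]`. -/
def bivectorLie (n : N) (g : N [⋀^Fin (q + 1)]→ₗ[K] V) : N [⋀^Fin q]→ₗ[K] V :=
  (2⁻¹ : K) • ∑ i, (contract (D.e i) (D.lieD (φ (D.pad (D.f i) n)) g) -
    D.lieD (φ (D.e i)) (contract (D.pad (D.f i) n) g))

lemma bivector_diff_zero (n : N) (g : N [⋀^Fin 1]→ₗ[K] V) :
    D.bivector n (diff (act V φ) g) = D.bivectorLie n g := by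
  simp only [bivector, bivectorLie]
  congr 1
  refine Finset.sum_congr rfl fun i _ ↦ ?_
  rw [contract_diff, map_sub, contract_diff_zero, D.lieAlong_eq, D.lieAlong_eq]

lemma bivector_diff (n : N) (g : N [⋀^Fin (q + 2)]→ₗ[K] V) :
    D.bivector n (diff (act V φ) g) = D.bivectorLie n g + diff (act V φ) (D.bivector n g) := by
  simp only [bivector, bivectorLie, map_smul, map_sum]
  rw [← smul_add, ← Finset.sum_add_distrib]
  congr 1
  refine Finset.sum_congr rfl fun i _ ↦ ?_
  rw [contract_diff, map_sub, contract_diff, D.lieAlong_eq, D.lieAlong_eq]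
  abel

/-- Compressing `ad u` to `N` loses the component `(1 - π) ⁅u, v⁆`, so the compression does not
respect brackets; `cross` is exactly the resulting defect in the Jacobi identity. -/
lemma ad_mul_pad_sub (n : N) {u : L} :
    D.pad u * LieAlgebra.ad K N n - LieAlgebra.ad K N n * D.pad u =
      D.cross n u - D.pad ⁅φ n, u⁆ := by
  ext v
  simp only [LinearMap.sub_apply, Module.End.mul_apply, LieAlgebra.ad_apply, pad_apply,
    cross_apply]
  rw [← D.proj_φ ⁅n, D.proj ⁅u, φ v⁆⁆, ← map_sub, ← map_sub, LieHom.map_lie, LieHom.map_lie,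
    leibniz_lie u, lie_sub, ← lie_skew u (φ n), neg_lie]
  congr 1
  abel

lemma lieD_half_comm (n : N) (u : L) (g : N [⋀^Fin q]→ₗ[K] V) :
    D.lieD (φ n) (D.half u g) - D.half u (D.lieD (φ n) g) =
      D.half ⁅φ n, u⁆ g + (2⁻¹ : K) • der (D.cross n u) g := by
  have h := der_der_comm (LieAlgebra.ad K N n) (D.pad u) g
  rw [ad_mul_pad_sub, map_sub, LinearMap.sub_apply, sub_eq_iff_eq_add] at h
  simp only [half_apply, lieDer_apply, map_sub, map_smul, post_der, post_post, D.pad_φ, h,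
    LieHom.map_lie, LieRing.of_associative_ring_bracket, LinearMap.sub_apply]
  module

/-- There are two obstructions to commuting: the partial Casimir tensor `∑ e i ⊗ f i` is not
invariant under `N`, which gives the first two sums by `casimir_invariance`, and the compression has
the defect `cross`, which gives the third. -/
lemma lieD_codiff_comm (n : N) (g : N [⋀^Fin (q + 1)]→ₗ[K] V) :
    D.lieD (φ n) (D.codiff g) - D.codiff (D.lieD (φ n) g) =
      ∑ k, contract (D.pad (D.x' k) n) (D.half (D.x k) g) +
      ∑ i, contract (D.pad (D.f i) n) (D.half (φ (D.e i)) g) +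
      (2⁻¹ : K) • ∑ i, contract (D.e i) (der (D.cross n (D.f i)) g) := by
  have hT := D.casimir_invariance (LinearMap.mk₂ K (fun u w ↦ contract u (D.half w g))
      (by intros; simp) (by intros; simp) (by intros; simp) (by intros; simp)) n
  simp only [LinearMap.mk₂_apply] at hT
  rw [← hT]
  simp only [codiff_apply, map_sum, Finset.smul_sum, ← Finset.sum_add_distrib,
    ← Finset.sum_sub_distrib]
  refine Finset.sum_congr rfl fun i _ ↦ ?_
  have h := lieD_half_comm (V := V) D n (D.f i) g
  rw [sub_eq_iff_eq_add] at h
  rw [lieD_contract, h, map_add, map_add, map_smul, pad_φ, LieAlgebra.ad_apply]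
  abel

lemma bivectorLie_eq (n : N) (g : N [⋀^Fin (q + 1)]→ₗ[K] V) :
    D.bivectorLie n g = - ∑ i, contract (D.pad (D.f i) n) (D.lieD (φ (D.e i)) g) -
      (2⁻¹ : K) • ∑ i, contract ⁅D.e i, D.pad (D.f i) n⁆ g := by
  have hT := D.sum_e_pad_antisymm (LinearMap.mk₂ K (fun u w ↦ contract u (D.lieD (φ w) g))
      (by intros; simp) (by intros; simp) (by intros; simp [lieDer_apply]; abel)
      (by intros; simp [lieDer_apply, smul_sub])) n
  simp only [LinearMap.mk₂_apply] at hT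
  simp only [bivectorLie, lieD_contract, Finset.sum_sub_distrib, Finset.sum_add_distrib, hT,
    pad_φ, LieAlgebra.ad_apply]
  module

lemma contract_laplace (n : N) (g : N [⋀^Fin (q + 1)]→ₗ[K] V) :
    contract n (D.laplace g) - D.laplace (contract n g) =
      (2 : K) • ∑ k, contract (D.pad (D.x' k) n) (D.lieD (D.x k) g) +
      ∑ k, contract (D.pad (D.x k) (D.pad (D.x' k) n)) g + contract (D.pad D.tr n) g := by
  have hS := D.swap_apply (LinearMap.mk₂ K (fun u w ↦ contract (D.pad u n) (D.lieD w g))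
      (by intros; simp) (by intros; simp) (by intros; simp [lieDer_apply]; abel)
      (by intros; simp [lieDer_apply, smul_sub]))
  simp only [LinearMap.mk₂_apply] at hS
  have hk : ∀ k, contract n (D.lieD (D.x k) (D.lieD (D.x' k) g)) =
      D.lieD (D.x k) (D.lieD (D.x' k) (contract n g)) -
      contract (D.pad (D.x' k) n) (D.lieD (D.x k) g) -
      contract (D.pad (D.x k) (D.pad (D.x' k) n)) g -
      contract (D.pad (D.x k) n) (D.lieD (D.x' k) g) := fun k ↦ by
    rw [contract_lieDer, contract_lieDer n, map_sub, D.lieD_contract _ (D.pad (D.x' k) n)]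
    abel
  have ht := contract_lieDer n (LieModule.toEnd K L V D.tr) (D.pad D.tr) g
  simp only [laplace_apply, map_sub, map_sum, contract_post, hk, Finset.sum_sub_distrib, ht, hS]
  module

/-- Slot by slot this is `cross_sum`, for the alternating form that inserts one vector in front and
the other in slot `j`. -/
lemma der_contract_sum (n : N) (g : N [⋀^Fin (q + 1)]→ₗ[K] V) :
    ∑ i, der (D.cross n (D.f i)) (contract (D.e i) g) +
      ∑ k, der (D.pad (D.x k)) (contract (D.pad (D.x' k) n) g) +
      ∑ i, der (D.pad (φ (D.e i))) (contract (D.pad (D.f i) n) g) = 0 := by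
  ext v
  have h : ∀ j, ∑ i, g (Matrix.vecCons (D.e i) (Function.update v j (D.cross n (D.f i) (v j)))) +
      ∑ k, g (Matrix.vecCons (D.pad (D.x' k) n) (Function.update v j (D.pad (D.x k) (v j)))) +
      ∑ i, g (Matrix.vecCons (D.pad (D.f i) n) (Function.update v j ⁅D.e i, v j⁆)) = 0 :=
    fun j ↦ by
    have := D.cross_sum (LinearMap.mk₂ K
      (fun u w ↦ contract u g (Function.update v j w))
      (by intros; simp) (by intros; simp) (by intros; rw [AlternatingMap.map_update_add])
      (by intros; rw [AlternatingMap.map_update_smul])) (fun u ↦ ?_) n (v j)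
    · simpa only [LinearMap.mk₂_apply, contract_apply] using this
    · simp only [LinearMap.mk₂_apply, contract_apply]
      exact g.map_eq_zero_of_eq _ (i := 0) (j := j.succ) (by simp) (Fin.succ_ne_zero j).symm
  simp only [AlternatingMap.add_apply, alternatingMap_sum_apply, der_apply, contract_apply,
    AlternatingMap.zero_apply, D.pad_φ, LieAlgebra.ad_apply]
  rw [Finset.sum_comm, Finset.sum_comm (s := Finset.univ (α := J)),
    Finset.sum_comm (f := fun i j ↦ g (Matrix.vecCons (D.pad (D.f i) n) _)),
    ← Finset.sum_add_distrib, ← Finset.sum_add_distrib]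
  exact Finset.sum_eq_zero fun j _ ↦ h j

/-- By `der_contract_sum`, only the terms in which a derivation hits the contracted vector survive.
-/
lemma contract_der_sum (n : N) (g : N [⋀^Fin (q + 1)]→ₗ[K] V) :
    ∑ i, contract (D.e i) (der (D.cross n (D.f i)) g) +
      ∑ k, contract (D.pad (D.x' k) n) (der (D.pad (D.x k)) g) +
      ∑ i, contract (D.pad (D.f i) n) (der (D.pad (φ (D.e i))) g) =
    contract (D.pad D.tr n) g + ∑ k, contract (D.pad (D.x k) (D.pad (D.x' k) n)) g +
      ∑ i, contract ⁅D.e i, D.pad (D.f i) n⁆ g := by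
  -- The inner projection in `cross` vanishes here by `lie_e_f`, so the double brackets add up to
  -- the action of `tr`.
  have htr : ∑ i, contract (D.cross n (D.f i) (D.e i)) g = contract (D.pad D.tr n) g := by
    rw [← LinearMap.sum_apply, ← map_sum]
    congr 2
    rw [tr, map_sum, LinearMap.sum_apply]
    refine Finset.sum_congr rfl fun i _ ↦ ?_
    have : D.proj ⁅D.f i, φ (D.e i)⁆ = 0 := D.pad_f_e i
    rw [cross_apply, this, pad_apply, map_zero, sub_zero, ← lie_skew,
      ← lie_skew (D.f i), neg_lie, neg_neg]
  have h := D.der_contract_sum n g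
  simp only [contract_der, Finset.sum_add_distrib, htr]
  rw [← sub_eq_zero] at h ⊢
  rw [← h]
  simp only [D.pad_φ, LieAlgebra.ad_apply]
  abel

/-- This is the difference between Kostant's formula contracted with `n` and Kostant's formula for
the contracted cochain, hence the inductive step of that formula. -/
lemma codiff_commutator (n : N) (g : N [⋀^Fin (q + 1)]→ₗ[K] V) :
    (2 : K) • (D.lieD (φ n) (D.codiff g) - D.codiff (D.lieD (φ n) g) + D.bivectorLie n g) =
      contract n (D.laplace g) - D.laplace (contract n g) := by
  have h := D.contract_der_sum n g
  have h1 : ∀ u w, contract u (D.half w g) =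
    contract u (D.lieD w g) + (2⁻¹ : K) • contract u (der (D.pad w) g) := fun u w ↦ by
    rw [lieD_eq_half, map_sub, map_smul]; abel
  rw [lieD_codiff_comm, bivectorLie_eq, contract_laplace]
  simp only [h1, Finset.sum_add_distrib, ← Finset.smul_sum]
  rw [← sub_eq_zero] at h ⊢
  rw [← h]
  module

/-- Derivations vanish in degree zero, so the Levi and `tr` terms of the Casimir operator cancel in
`laplace` and only `2 ∑ f e` remains. The correction in `half` drops out on the other side by
`pad_f_e`. -/
lemma codiff_diff_zero (g : N [⋀^Fin 0]→ₗ[K] V) :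
    (2 : K) • D.codiff (diff (act V φ) g) = D.laplace g := by
  have h : ∀ i, contract (D.e i) (D.half (D.f i) (diff (act V φ) g)) =
      post (LieModule.toEnd K L V (D.f i) * LieModule.toEnd K L V (φ (D.e i))) g := fun i ↦ by
    rw [contract_half, pad_f_e, map_zero, LinearMap.zero_apply, smul_zero, sub_zero,
      contract_diff_zero, half_apply, lieDer_apply]
    simp only [der_zero_eq, smul_zero, sub_zero, post_post]
    rfl
  simp only [codiff_apply, h, laplace_apply, lieDer_apply, der_zero_eq, sub_zero, post_post,
    casimir, map_add, map_sum, map_smul, LinearMap.add_apply, LinearMap.smul_apply,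
    LinearMap.sum_apply]
  abel

/-- Kostant's formula: the Laplacian of the differential and the codifferential is half of the
difference of two Casimir operators. -/
theorem diff_codiff_add_codiff_diff (g : N [⋀^Fin (q + 1)]→ₗ[K] V) :
    (2 : K) • (diff (act V φ) (D.codiff g) + D.codiff (diff (act V φ) g)) = D.laplace g := by
  induction q with
  | zero =>
    refine ext_contract fun n ↦ ?_
    have h := D.codiff_commutator n g
    have h0 := D.codiff_diff_zero (contract n g)
    rw [map_smul, map_add, contract_diff_zero, contract_codiff, bivector_diff_zero,
      contract_diff, map_sub, D.lieAlong_eq, D.lieAlong_eq]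
    rw [← h0] at h
    rw [← sub_eq_zero] at h ⊢
    rw [← h]
    module
  | succ q ih =>
    refine ext_contract fun n ↦ ?_
    have h := D.codiff_commutator n g
    rw [← ih (contract n g)] at h
    rw [map_smul, map_add, contract_diff, contract_codiff, contract_codiff, bivector_diff,
      contract_diff, map_sub, map_sub, D.lieAlong_eq, D.lieAlong_eq]
    rw [← sub_eq_zero] at h ⊢
    rw [← h]
    module

end ParabolicData

end Kostant

/-! ### The explicit differential and the invariant cohomology in terms of `diff`. -/

section Comparison

variable {K L : Type*} [Field K] [CharZero K] [LieRing L] [LieAlgebra K L] (n : LieIdeal K L)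
  (M : Type*) [AddCommGroup M] [Module K M] [LieRingModule L M] [LieModule K L M] {q : ℕ}

/-- The action of the ideal `n` of `L` on an `L`-module. -/
def idealAct : n →ₗ[K] Module.End K M :=
  (LieModule.toEnd K L M : L →ₗ[K] Module.End K M) ∘ₗ n.toSubmodule.subtype

/-- The endomorphism of an ideal induced by `ad x`. -/
def idealAd (x : L) : Module.End K n := LieModule.toEnd K L n x

variable {M}

@[simp] lemma idealAct_apply (x : n) (m : M) : idealAct n M x m = ⁅(x : L), m⁆ := rfl

@[simp] lemma coe_idealAd_apply (x : L) (y : n) : (idealAd n x y : L) = ⁅x, (y : L)⁆ := rfl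

lemma action_eq (x : L) (f : Cochain n M q) :
    action n M q x f = lieDer (LieModule.toEnd K L M x) (idealAd n x) f := by
  funext v
  simp [action, lieDer_apply, der_apply, idealAd]

/-- The summands with `i = 0` form the Lie derivative along `x`; the others, shifted by one, form
minus the differential of the contraction. This is the recursion of `contract_diff`, so both
differentials agree by induction. -/
lemma differential_cons (f : Cochain n M (q + 1)) (x : n) (v : Fin (q + 1) → n) :
    differential n M (q + 1) f (Matrix.vecCons x v) =
      lieAlong (idealAct n M) x f v - differential n M q (contract x f) v := by
  have hIoi : ∀ (i : Fin (q + 1)) (F : Fin (q + 2) → M),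
      ∑ j ∈ Finset.Ioi i.succ, F j = ∑ j ∈ Finset.Ioi i, F j.succ := fun i F ↦ by
    rw [← Fin.map_succEmb_Ioi, Finset.sum_map]; rfl
  have hIoi0 : ∀ (F : Fin (q + 2) → M), ∑ j ∈ Finset.Ioi 0, F j = ∑ j, F (Fin.succ j) :=
    fun F ↦ by
    rw [Fin.Ioi_zero_eq_map, Finset.sum_map]; rfl
  have hr : ∀ (j : Fin (q + 1)) (y : n) (w : Fin (q + 1) → n),
      j.succ.removeNth (Matrix.vecCons y w) = Matrix.vecCons y (j.removeNth w) :=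
    fun j y w ↦ by
    ext i
    refine Fin.cases ?_ (fun i ↦ ?_) i
    · simp [Fin.removeNth]
    · simp [Fin.removeNth]
  have hr0 : ∀ (y : n) (w : Fin (q + 1) → n),
      Fin.removeNth (α := fun _ ↦ n) 0 (Matrix.vecCons y w) = w := fun y w ↦ by
    ext i; simp [Fin.removeNth]
  have h0 : ∀ y : n, Function.update (Matrix.vecCons x v) 0 y = Matrix.vecCons y v := fun y ↦
    Fin.update_cons_zero (α := fun _ ↦ n) x v y
  have hs : ∀ (j : Fin (q + 1)) (y : n), Function.update (Matrix.vecCons x v) j.succ y =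
      Matrix.vecCons x (Function.update v j y) := fun j y ↦ (Fin.cons_update ..).symm
  have hi : ∀ j : Fin (q + 1), (-1 : ℤ) ^ (j : ℕ) • f (Matrix.vecCons ⁅x, v j⁆ (j.removeNth v)) =
      f (Function.update v j ⁅x, v j⁆) := fun j ↦ by
    rw [← Fin.insertNth_removeNth, ← AlternatingMap.neg_one_pow_smul_map_insertNth f j,
      smul_smul, ← mul_pow]
    simp
  simp only [differential, LinearMap.coe_mk, AddHom.coe_mk, Fin.sum_univ_succ (n := q + 1), hIoi,
    hIoi0, hr, hr0, h0, hs, lieDer_apply, AlternatingMap.sub_apply, post_apply, der_apply,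
    Matrix.cons_val_zero, Matrix.cons_val_succ, Fin.val_succ, pow_succ, mul_neg_one, neg_smul,
    Finset.sum_neg_distrib, hi, contract_apply, LieAlgebra.ad_apply, Fin.val_zero, pow_zero,
    one_smul]
  rw [idealAct_apply]
  abel

lemma differential_zero (f : Cochain n M 0) (x : n) (v : Fin 0 → n) :
    differential n M 0 f (Matrix.vecCons x v) = lieAlong (idealAct n M) x f v := by
  simp [differential, lieDer_apply, der_zero_eq, idealAct_apply]

lemma differential_eq (f : Cochain n M q) :
    differential n M q f = diff (idealAct n M) f := by
  funext v
  rw [← Matrix.cons_head_tail v]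
  induction q with
  | zero => rw [differential_zero, ← contract_apply, contract_diff_zero]
  | succ q ih =>
    rw [differential_cons, ← contract_apply, contract_diff, AlternatingMap.sub_apply,
      ← Matrix.cons_head_tail (Matrix.vecTail v), ih]

lemma idealAct_lie (x y : n) :
    idealAct n M ⁅x, y⁆ = idealAct n M x * idealAct n M y - idealAct n M y * idealAct n M x := by
  ext m
  simp only [idealAct_apply, LinearMap.sub_apply, Module.End.mul_apply]
  exact lie_lie (x : L) (y : L) m

/-- The coboundaries as cochains. -/
def coboundarySpace : (q : ℕ) → Submodule K (Cochain n M q)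
  | 0 => ⊥
  | _ + 1 => LinearMap.range (diff (idealAct n M))

lemma coe_mem_coboundaryFunctions {f : Cochain n M q} :
    ⇑f ∈ coboundaryFunctions n M q ↔ f ∈ coboundarySpace n q := by
  cases q with
  | zero =>
    simp only [coboundaryFunctions, coboundarySpace, Submodule.mem_bot]
    exact ⟨fun h ↦ AlternatingMap.ext fun v ↦ congrFun h v, fun h ↦ by simp [h]; rfl⟩
  | succ q =>
    simp only [coboundaryFunctions, coboundarySpace, LinearMap.mem_range, differential_eq]
    exact exists_congr fun g ↦ ⟨fun h ↦ AlternatingMap.ext fun v ↦ congrFun h v, fun h ↦ by rw [h]⟩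

lemma invariantCohomology_eq_bot_iff (r : LieSubalgebra K L) (q : ℕ) :
    invariantCohomology n M r (q + 1) = ⊥ ↔ ∀ f : Cochain n M (q + 1), diff (idealAct n M) f = 0 →
      (∀ x : r, lieDer (LieModule.toEnd K L M x) (idealAd n (x : L)) f ∈
        coboundarySpace n (q + 1)) → f ∈ coboundarySpace n (q + 1) := by
  have hz : ∀ f : Cochain n M (q + 1), f ∈ cocycles n M (q + 1) ↔ diff (idealAct n M) f = 0 :=
    fun f ↦ by
      rw [cocycles, LinearMap.mem_ker, differential_eq]
      exact ⟨fun h ↦ AlternatingMap.ext fun v ↦ congrFun h v, fun h ↦ by rw [h]; rfl⟩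
  rw [invariantCohomology, ← le_bot_iff, Submodule.map_le_iff_le_comap, Submodule.comap_bot,
    Submodule.ker_mkQ]
  constructor
  · intro h f hf hr
    have := @h ⟨f, (hz f).2 hf⟩ (by
      simp only [Submodule.mem_iInf, Submodule.mem_comap, LinearMap.comp_apply,
        Submodule.subtype_apply, action_eq, coe_mem_coboundaryFunctions]
      exact hr)
    exact (coe_mem_coboundaryFunctions n).1 this
  · intro h f hf
    simp only [Submodule.mem_iInf, Submodule.mem_comap, LinearMap.comp_apply,
        Submodule.subtype_apply, action_eq, coe_mem_coboundaryFunctions] at hf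
    exact (coe_mem_coboundaryFunctions n).2 (h f.1 ((hz _).1 f.2) hf)

lemma lieDer_diff (x : L) (f : Cochain n M q) :
    lieDer (LieModule.toEnd K L M x) (idealAd n x) (diff (idealAct n M) f) =
      diff (idealAct n M) (lieDer (LieModule.toEnd K L M x) (idealAd n x) f) := by
  refine lieDer_diff_comm _ _ _ (fun y ↦ ?_) (fun y z ↦ ?_) f
  · ext m
    simp only [idealAct_apply, LinearMap.sub_apply, Module.End.mul_apply,
      LieModule.toEnd_apply_apply, coe_idealAd_apply, lie_lie]
  · ext; simp [idealAd]

end Comparison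

/-! ### Lifting annihilated classes along commuting semisimple operators. -/

section Semisimple

variable {K W ι : Type*} [Field K] [AddCommGroup W] [Module K W] [FiniteDimensional K W]

/-- Given commuting endomorphisms that are semisimple at zero, an element whose images lie in a
stable subspace is congruent, modulo that subspace, to an element that they annihilate. -/
lemma exists_sub_mem_and_forall_eq_zero (s : Finset ι) (T : ι → Module.End K W)
    (hT : ∀ i w, T i (T i w) = 0 → T i w = 0) (hc : ∀ i j w, T i (T j w) = T j (T i w))
    (B : Submodule K W) (hB : ∀ i, ∀ w ∈ B, T i w ∈ B) (f : W) (hf : ∀ i ∈ s, T i f ∈ B) :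
    ∃ g, f - g ∈ B ∧ ∀ i ∈ s, T i g = 0 := by
  classical
  have hcompl : ∀ (U : Type _) [AddCommGroup U] [Module K U] [FiniteDimensional K U]
      (S : Module.End K U), (∀ u, S (S u) = 0 → S u = 0) → ∀ u, ∃ v w, u = v + S w ∧ S v = 0 := by
    intro U _ _ _ S hS u
    have hd : Disjoint (LinearMap.ker S) (LinearMap.range S) := by
      rw [Submodule.disjoint_def]
      rintro _ hx ⟨y, rfl⟩
      exact hS y hx
    have hcm := (Submodule.isCompl_iff_disjoint _ _ (by
      rw [add_comm, LinearMap.finrank_range_add_finrank_ker])).2 hd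
    obtain ⟨v, hv, _, ⟨w, rfl⟩, h⟩ := Submodule.mem_sup.1 (hcm.sup_eq_top ▸ Submodule.mem_top :
      u ∈ LinearMap.ker S ⊔ LinearMap.range S)
    exact ⟨v, w, h.symm, hv⟩
  induction s using Finset.induction_on with
  | empty => exact ⟨f, by simp, by simp⟩
  | insert a s ha ih =>
    obtain ⟨g, hg, hg0⟩ := ih fun i hi ↦ hf i (Finset.mem_insert_of_mem hi)
    obtain ⟨v, w, rfl, hv⟩ := hcompl W (T a) (hT a) g
    -- The aim is `T a w ∈ B`, so that `g` may be replaced by `v`. Splitting twice inside `B` gives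
    -- `T a (T a w) = b + T a (T a c')` with `c' ∈ B` and `b` both in the kernel and in the range of
    -- `T a`. Hence `b = 0`, and semisimplicity gives `T a w = T a c'`.
    have hTg : T a (T a w) ∈ B := by
      have := B.sub_mem (hf a (Finset.mem_insert_self _ _)) (hB a _ hg)
      simpa [hv] using this
    obtain ⟨b, c, hbc, hb⟩ := hcompl B ((T a).restrict (hB a))
      (fun u hu ↦ Subtype.ext (hT a _ (congrArg Subtype.val hu))) ⟨_, hTg⟩
    obtain ⟨b', c', rfl, hb'⟩ := hcompl B ((T a).restrict (hB a))
      (fun u hu ↦ Subtype.ext (hT a _ (congrArg Subtype.val hu))) c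
    have hbc' : T a (T a w) = b + (T a b' + T a (T a c')) := by simpa using congrArg Subtype.val hbc
    have hbT : T a b = 0 := by simpa using congrArg Subtype.val hb
    have hb'T : T a b' = 0 := by simpa using congrArg Subtype.val hb'
    have hb0 : (b : W) = 0 := by
      have h1 : (b : W) = T a (T a w - T a c') := by
        rw [map_sub, hbc', hb'T]; abel
      rw [h1]; exact hT a _ (by rw [← h1, hbT])
    have hw : T a w ∈ B := by
      have h2 : T a (w - c') = 0 := hT a _ (by
        rw [map_sub, map_sub, hbc', hb0, hb'T]; abel)
      rw [map_sub, sub_eq_zero] at h2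
      rw [h2]; exact hB a _ c'.2
    refine ⟨v, ?_, fun i hi ↦ ?_⟩
    · have : f - v = (f - (v + T a w)) + T a w := by abel
      rw [this]; exact B.add_mem hg hw
    · rcases Finset.mem_insert.1 hi with rfl | hi
      · exact hv
      · have h3 := hg0 i hi
        rw [map_add, hc i a] at h3
        -- `T i v` lies in the range of `T a` and, because the operators commute, in its kernel.
        have h4 : T i v = T a (- T i w) := by rw [map_neg]; exact eq_neg_of_add_eq_zero_left h3
        rw [h4]
        exact hT a _ (by rw [← h4, hc a i, hv, map_zero])

end Semisimple

/-! ### Normalized root vectors and their brackets. -/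

section Roots

open LieAlgebra LieAlgebra.IsKilling LieModule

variable {𝔤 : Type*} [LieRing 𝔤] [LieAlgebra ℂ 𝔤] [FiniteDimensional ℂ 𝔤] [IsKilling ℂ 𝔤]
  {H : LieSubalgebra ℂ 𝔤} [H.IsCartanSubalgebra]

/-- The negative of a root. -/
def negRoot (α : H.root) : H.root :=
  ⟨-α.1, by simpa using (LieSubalgebra.isNonZero_coe_root α)⟩

@[simp] lemma negRoot_negRoot (α : H.root) : negRoot (negRoot α) = α :=
  Subtype.ext (neg_neg α.1)

@[simp] lemma negRoot_apply (α : H.root) (h : H) : (negRoot α).1 h = - α.1 h := rfl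

lemma root_ext {α β : H.root} (h : ∀ x : H, α.1 x = β.1 x) : α = β :=
  Subtype.ext (Weight.ext h)

variable (H) in
/-- A choice of root vectors, normalized with respect to the Killing form. -/
structure RootVectors where
  /-- the root vectors -/
  e : H.root → 𝔤
  mem : ∀ α : H.root, e α ∈ rootSpace H (α : Weight ℂ H 𝔤)
  killing : ∀ α : H.root, killingForm ℂ 𝔤 (e α) (e (negRoot α)) = 1

/-- Nondegeneracy of the Killing form supplies dual pairs. The normalization couples `α` and `-α`,
so one pair is chosen for each positive root; this is the only role of the base. -/
lemma RootVectors.nonempty (b : (rootSystem H).Base) : Nonempty (RootVectors H) := by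
  classical
  have key : ∀ α : H.root, ∃ e f : 𝔤, e ∈ rootSpace H (α : Weight ℂ H 𝔤) ∧
      f ∈ rootSpace H (negRoot α : Weight ℂ H 𝔤) ∧ killingForm ℂ 𝔤 e f = 1 := fun α ↦ by
    obtain ⟨e, heα, he₀⟩ := α.1.exists_ne_zero
    obtain ⟨f', hfα, hf⟩ : ∃ f ∈ rootSpace H (-α.1), killingForm ℂ 𝔤 e f ≠ 0 := by
      contrapose! he₀
      simpa using mem_ker_killingForm_of_mem_rootSpace_of_forall_rootSpace_neg ℂ 𝔤 H heα he₀
    exact ⟨e, (killingForm ℂ 𝔤 e f')⁻¹ • f', heα, Submodule.smul_mem _ _ hfα, by simp [hf]⟩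
  choose e f he hf hk using key
  have hpos : ∀ α : H.root, b.IsPos (negRoot α) ↔ ¬ b.IsPos α := fun α ↦ by
    have := RootPairing.Base.IsPos.neg_iff_not b α
    rw [← this]
    have h2 : negRoot α = (rootSystem H).reflectionPerm α α := by
      apply (rootSystem H).root.injective
      rw [RootPairing.root_reflectionPerm, RootPairing.reflection_apply_self]
      rfl
    rw [h2]
    rfl
  refine ⟨⟨fun α : H.root ↦ if b.IsPos α then e α else f (negRoot α), fun α : H.root ↦ ?_,
    fun α : H.root ↦ ?_⟩⟩
  · by_cases h : b.IsPos α
    · simpa only [h, if_true] using he α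
    · have := hf (negRoot α)
      rw [negRoot_negRoot] at this
      simpa only [h, if_false] using this
  · by_cases h : b.IsPos α
    · have h' : ¬ b.IsPos (negRoot α) := by rw [hpos]; exact not_not.2 h
      simp only [h, h', if_true, if_false, negRoot_negRoot, hk]
    · have h' : b.IsPos (negRoot α) := (hpos α).2 h
      simp only [h, h', if_true, if_false]
      rw [LieModule.traceForm_comm]
      exact hk _

/-- Representation theory of `sl₂` on the `α`-string through `β`. Since `α + β` is a root, `β` lies
`p + 1` steps below the top; lowering a top vector `p + 1` times reaches the root space of `β`, and
raising the result gives a nonzero multiple of the vector one step higher. -/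
lemma exists_lie_ne_zero {α β γ : H.root} (h : ∀ x : H, γ.1 x = α.1 x + β.1 x) :
    ∃ e ∈ rootSpace H α.1, ∃ y ∈ rootSpace H β.1, ⁅e, y⁆ ≠ 0 := by
  have hα := LieSubalgebra.isNonZero_coe_root α
  obtain ⟨x, hx, x_ne0⟩ := (chainTop α.1 β.1).exists_ne_zero
  obtain ⟨hh, e, f, isSl2, he, hf⟩ := exists_isSl2Triple_of_weight_isNonZero hα
  obtain rfl := isSl2.h_eq_coroot hα he hf
  have prim : isSl2.HasPrimitiveVectorWith x (chainLength α.1 β.1 : ℂ) :=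
    have := lie_mem_genWeightSpace_of_mem_genWeightSpace he hx
    ⟨x_ne0, (chainLength_smul _ _ hx).symm, by rwa [genWeightSpace_add_chainTop _ _ hα] at this⟩
  have hp : 1 ≤ chainTopCoeff α.1 β.1 := by
    have h1 := (rootSpace_zsmul_add_ne_bot_iff α.1 β.1 hα 1).1 (by
      have : ((1 : ℤ) • (α.1 : H → ℂ) + β.1) = γ.1 := by
        ext y; simp [h]
      rw [this]; exact γ.1.genWeightSpace_ne_bot)
    exact_mod_cast h1.1
  obtain ⟨p, hp'⟩ : ∃ p, chainTopCoeff α.1 β.1 = p + 1 := ⟨_, (Nat.sub_add_cancel hp).symm⟩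
  have hle := chainTopCoeff_le_chainLength α.1 β.1
  refine ⟨e, he, ((toEnd ℂ 𝔤 𝔤 f) ^ (p + 1)) x, ?_, ?_⟩
  · have := toEnd_pow_apply_mem hf hx (p + 1)
    convert this using 2
    ext y
    have hc := congrFun (coe_chainTop α.1 β.1) y
    simp only [Pi.add_apply, Pi.smul_apply, Pi.neg_apply] at hc ⊢
    rw [hc, hp']
    simp
  · rw [prim.lie_e_pow_succ_toEnd_f p]
    refine smul_ne_zero (mul_ne_zero (by exact_mod_cast Nat.succ_ne_zero p) ?_)
      (prim.pow_toEnd_f_ne_zero_of_eq_nat rfl (by omega))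
    rw [sub_ne_zero]
    have : p < chainLength α.1 β.1 := by omega
    exact_mod_cast this.ne'

lemma cartan_lie_eq_zero {h h' : 𝔤} (hh : h ∈ H) (hh' : h' ∈ H) : ⁅h, h'⁆ = 0 := by
  have := LieModule.IsTrivial.trivial (⟨h, hh⟩ : H) (⟨h', hh'⟩ : H)
  exact congrArg Subtype.val this

namespace RootVectors

variable (E : RootVectors H)

/-- The coordinate of an element of the Lie algebra along a root vector. -/
def coef (α : H.root) : 𝔤 →ₗ[ℂ] ℂ := killingForm ℂ 𝔤 (E.e (negRoot α))

lemma e_ne_zero (α : H.root) : E.e α ≠ 0 := fun h ↦ by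
  have := E.killing α
  simp [h] at this

lemma exists_eq_smul {α : H.root} {x : 𝔤} (hx : x ∈ rootSpace H (α : Weight ℂ H 𝔤)) :
    ∃ c : ℂ, x = c • E.e α := by
  obtain ⟨c, hc⟩ := (finrank_eq_one_iff_of_nonzero' (⟨E.e α, E.mem α⟩ : rootSpace H α.1)
    (fun h ↦ E.e_ne_zero α (congrArg Subtype.val h))).1
    (finrank_rootSpace_eq_one α.1 (LieSubalgebra.isNonZero_coe_root α)) ⟨x, hx⟩
  exact ⟨c, (congrArg Subtype.val hc).symm⟩

lemma coef_eq_zero_of_mem {α : H.root} {χ : H → ℂ} {x : 𝔤} (hx : x ∈ rootSpace H χ)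
    (hχ : χ ≠ α.1) : E.coef α x = 0 := by
  refine killingForm_apply_eq_zero_of_mem_rootSpace_of_add_ne_zero ℂ 𝔤 H (E.mem (negRoot α)) hx ?_
  intro h
  refine hχ ?_
  ext y
  have := congrFun h y
  simp only [Pi.add_apply, Pi.zero_apply, negRoot_apply] at this
  linear_combination this

lemma coef_e_self (α : H.root) : E.coef α (E.e α) = 1 := by
  have := E.killing α
  rwa [LieModule.traceForm_comm] at this

lemma coef_e_of_ne {α β : H.root} (h : β ≠ α) : E.coef α (E.e β) = 0 :=
  E.coef_eq_zero_of_mem (E.mem β) fun h' ↦ h (root_ext (congrFun h'))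

open Classical in
lemma coef_e (α β : H.root) : E.coef α (E.e β) = if β = α then 1 else 0 := by
  split_ifs with h
  · rw [h, coef_e_self]
  · exact E.coef_e_of_ne h

lemma coef_of_mem (α : H.root) {h : 𝔤} (hh : h ∈ H) : E.coef α h = 0 := by
  refine E.coef_eq_zero_of_mem (χ := 0) ?_ ?_
  · have := LieAlgebra.rootSpace_zero_eq ℂ 𝔤 H
    rw [this]; exact hh
  · intro h0
    exact LieSubalgebra.isNonZero_coe_root α h0.symm

/-- The component in the Cartan subalgebra of an element of the Lie algebra. -/
def hpart : 𝔤 →ₗ[ℂ] 𝔤 := LinearMap.id - ∑ α, (E.coef α).smulRight (E.e α)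

lemma hpart_add_sum (x : 𝔤) : E.hpart x + ∑ α, E.coef α x • E.e α = x := by
  simp [hpart]

lemma hpart_of_mem {h : 𝔤} (hh : h ∈ H) : E.hpart h = h := by
  simp [hpart, E.coef_of_mem _ hh]

lemma hpart_e (α : H.root) : E.hpart (E.e α) = 0 := by
  classical
  simp [hpart, coef_e]

lemma induction {p : 𝔤 → Prop} (hH : ∀ h ∈ H, p h) (he : ∀ α, ∀ c : ℂ, p (c • E.e α))
    (hadd : ∀ x y, p x → p y → p (x + y)) (x : 𝔤) : p x := by
  have hx : x ∈ ⨆ χ : Weight ℂ H 𝔤, rootSpace H χ := by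
    rw [LieModule.iSup_genWeightSpace_eq_top' ℂ H 𝔤]; trivial
  refine LieSubmodule.iSup_induction _ (motive := p) hx (fun χ y hy ↦ ?_) (hH 0 H.zero_mem) hadd
  by_cases hχ : χ.IsZero
  · refine hH y ?_
    rw [hχ.eq] at hy
    have := LieAlgebra.rootSpace_zero_eq ℂ 𝔤 H
    rw [this] at hy
    exact hy
  · obtain ⟨c, rfl⟩ := E.exists_eq_smul (α := ⟨χ, by simpa using hχ⟩) hy
    exact he _ c

lemma hpart_mem (x : 𝔤) : E.hpart x ∈ H := by
  refine E.induction (p := fun x ↦ E.hpart x ∈ H) (fun h hh ↦ ?_) (fun α c ↦ ?_)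
    (fun x y hx hy ↦ ?_) x
  · rwa [E.hpart_of_mem hh]
  · rw [map_smul, hpart_e, smul_zero]; exact H.zero_mem
  · rw [map_add]; exact H.add_mem hx hy

lemma ext {x y : 𝔤} (hh : E.hpart x = E.hpart y) (hc : ∀ α, E.coef α x = E.coef α y) : x = y := by
  rw [← E.hpart_add_sum x, ← E.hpart_add_sum y, hh]
  simp [hc]

lemma lie_e {h : 𝔤} (hh : h ∈ H) (α : H.root) : ⁅h, E.e α⁆ = α.1 ⟨h, hh⟩ • E.e α :=
  lie_eq_smul_of_mem_rootSpace (E.mem α) ⟨h, hh⟩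

lemma coef_lie {h : 𝔤} (hh : h ∈ H) (α : H.root) (x : 𝔤) :
    E.coef α ⁅h, x⁆ = α.1 ⟨h, hh⟩ * E.coef α x := by
  refine E.induction (p := fun x ↦ E.coef α ⁅h, x⁆ = α.1 ⟨h, hh⟩ * E.coef α x)
    (fun h' hh' ↦ ?_) (fun β c ↦ ?_) (fun x y hx hy ↦ ?_) x
  · rw [cartan_lie_eq_zero hh hh', E.coef_of_mem _ hh', map_zero, mul_zero]
  · rw [lie_smul, E.lie_e hh]
    by_cases h' : β = α
    · simp [h']; ring
    · simp [E.coef_e_of_ne h']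
  · rw [lie_add, map_add, hx, hy, map_add, mul_add]

lemma hpart_lie {h : 𝔤} (hh : h ∈ H) (x : 𝔤) : E.hpart ⁅h, x⁆ = 0 := by
  refine E.induction (p := fun x ↦ E.hpart ⁅h, x⁆ = 0)
    (fun h' hh' ↦ ?_) (fun β c ↦ ?_) (fun x y hx hy ↦ ?_) x
  · rw [cartan_lie_eq_zero hh hh', map_zero]
  · rw [lie_smul, E.lie_e hh]; simp [hpart_e]
  · rw [lie_add, map_add, hx, hy, add_zero]

lemma lie_e_e_mem (α β : H.root) : ⁅E.e α, E.e β⁆ ∈ rootSpace H (α.1 + β.1 : H → ℂ) :=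
  lie_mem_genWeightSpace_of_mem_genWeightSpace (E.mem α) (E.mem β)

lemma exists_lie_e_e {α β γ : H.root} (h : ∀ x : H, γ.1 x = α.1 x + β.1 x) :
    ∃ c : ℂ, c ≠ 0 ∧ ⁅E.e α, E.e β⁆ = c • E.e γ := by
  have hm := E.lie_e_e_mem α β
  rw [show (α.1 + β.1 : H → ℂ) = γ.1 from funext fun x ↦ (h x).symm] at hm
  obtain ⟨c, hc⟩ := E.exists_eq_smul hm
  refine ⟨c, ?_, hc⟩
  rintro rfl
  obtain ⟨x, hx, y, hy, hxy⟩ := exists_lie_ne_zero h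
  obtain ⟨c, rfl⟩ := E.exists_eq_smul hx
  obtain ⟨d, rfl⟩ := E.exists_eq_smul hy
  simp [hc] at hxy

lemma lie_e_e_negRoot_mem (α : H.root) : ⁅E.e α, E.e (negRoot α)⁆ ∈ H := by
  have hm := E.lie_e_e_mem α (negRoot α)
  rw [show (α.1 + (negRoot α).1 : H → ℂ) = 0 from funext fun x ↦ by simp] at hm
  have := LieAlgebra.rootSpace_zero_eq ℂ 𝔤 H
  rw [this] at hm
  exact hm

lemma lie_e_e_eq_zero {α β : H.root} (h₀ : β ≠ negRoot α)
    (h : ∀ γ : H.root, ¬ ∀ x : H, γ.1 x = α.1 x + β.1 x) : ⁅E.e α, E.e β⁆ = 0 := by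
  have hm := E.lie_e_e_mem α β
  by_contra hne
  let χ : Weight ℂ H 𝔤 := ⟨α.1 + β.1, fun h0 ↦ by
    have h1 : rootSpace H (α.1 + β.1 : H → ℂ) = ⊥ := h0
    rw [h1] at hm
    exact hne ((LieSubmodule.mem_bot _).1 hm)⟩
  by_cases hχ : χ.IsZero
  · refine h₀ (root_ext fun x ↦ ?_)
    have := congrFun hχ.eq x
    have h2 : χ x = α.1 x + β.1 x := rfl
    rw [h2] at this
    simp only [Pi.zero_apply] at this
    rw [negRoot_apply]
    linear_combination this
  · exact h ⟨χ, by simpa using hχ⟩ fun x ↦ rfl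

lemma rootSpace_subset_iff (α : H.root) (W : Submodule ℂ 𝔤) :
    (∀ y ∈ rootSpace H (α : Weight ℂ H 𝔤), y ∈ W) ↔ E.e α ∈ W :=
  ⟨fun h ↦ h _ (E.mem α), fun h y hy ↦ by
    obtain ⟨c, rfl⟩ := E.exists_eq_smul hy
    exact W.smul_mem c h⟩

/-- A subspace that is stable under the Cartan subalgebra contains the components of its
elements. -/
lemma coef_smul_e_mem (W : Submodule ℂ 𝔤) (hW : ∀ h ∈ H, ∀ x ∈ W, ⁅h, x⁆ ∈ W) {x : 𝔤}
    (hx : x ∈ W) (α : H.root) : E.coef α x • E.e α ∈ W := by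
  let W' : LieSubmodule ℂ H 𝔤 := { W with lie_mem := fun {h y} hy ↦ hW h h.2 y hy }
  have hx' : (⟨x, hx⟩ : W') ∈ ⨆ χ : Weight ℂ H W', genWeightSpace W' χ := by
    rw [LieModule.iSup_genWeightSpace_eq_top' ℂ H W']; trivial
  refine LieSubmodule.iSup_induction _ (motive := fun y : W' ↦ E.coef α (y : 𝔤) • E.e α ∈ W) hx'
    (fun χ y hy ↦ ?_) (by simp) (fun y z hy hz ↦ ?_)
  · have hy' : (y : 𝔤) ∈ rootSpace H χ := LieModule.map_genWeightSpace_le (f := W'.incl)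
      (by exact ⟨y, hy, rfl⟩)
    by_cases h : (χ : H → ℂ) = α.1
    · rw [h] at hy'
      obtain ⟨c, hc⟩ := E.exists_eq_smul hy'
      rw [hc, map_smul, coef_e_self, smul_eq_mul, mul_one, ← hc]
      exact y.2
    · rw [E.coef_eq_zero_of_mem hy' h, zero_smul]; exact W.zero_mem
  · rw [LieSubmodule.coe_add, map_add, add_smul]
    exact W.add_mem hy hz

end RootVectors

end Roots

/-! ### Coefficients at simple roots and degree functions. -/

section Coefficients

open LieAlgebra LieAlgebra.IsKilling LieModule

variable {𝔤 : Type*} [LieRing 𝔤] [LieAlgebra ℂ 𝔤] [FiniteDimensional ℂ 𝔤] [IsKilling ℂ 𝔤]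
  {H : LieSubalgebra ℂ 𝔤} [H.IsCartanSubalgebra] (b : (rootSystem H).Base)

/-- The coefficients of a root with respect to a base. -/
def rootCoeff (α : H.root) : H.root → ℤ := (b.exists_root_eq_sum_int α).choose

lemma rootCoeff_spec (α : H.root) :
    (0 < rootCoeff b α ∨ rootCoeff b α < 0) ∧
      (rootSystem H).root α = ∑ j ∈ b.support, rootCoeff b α j • (rootSystem H).root j :=
  (b.exists_root_eq_sum_int α).choose_spec.2

lemma exists_root_apply_eq (c : H.root → ℂ) : ∃ h : H, ∀ j ∈ b.support, j.1 h = c j := by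
  let B := b.toWeightBasis
  let φ : Module.Dual ℂ (Module.Dual ℂ H) := B.constr ℂ fun j ↦ c j
  obtain ⟨h, hh⟩ := (Module.evalEquiv ℂ H).surjective φ
  refine ⟨h, fun j hj ↦ ?_⟩
  have h1 := B.constr_basis ℂ (fun j ↦ c j) ⟨j, hj⟩
  have h2 : φ (B ⟨j, hj⟩) = (B ⟨j, hj⟩) h := by rw [← hh]; rfl
  have h3 : B ⟨j, hj⟩ = (rootSystem H).root j := b.toWeightBasis_apply ⟨j, hj⟩
  rw [h3] at h2
  rw [← h3] at h2
  rw [← show φ (B ⟨j, hj⟩) = c j from h1, h2, h3]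
  rfl

lemma root_apply_eq_sum (α : H.root) (h : H) :
    α.1 h = ∑ j ∈ b.support, (rootCoeff b α j : ℂ) * j.1 h := by
  have := congrArg (fun φ ↦ φ h) (rootCoeff_spec b α).2
  simp only [LinearMap.sum_apply, LinearMap.smul_apply, zsmul_eq_mul] at this
  exact this

open Classical in
/-- The fundamental coweights. -/
def coweight (i : H.root) : H :=
  (exists_root_apply_eq b fun j ↦ if j = i then 1 else 0).choose

open Classical in
lemma apply_coweight (i : H.root) {j : H.root} (hj : j ∈ b.support) :
    j.1 (coweight b i) = if j = i then 1 else 0 :=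
  (exists_root_apply_eq b fun j ↦ if j = i then 1 else 0).choose_spec j hj

lemma root_apply_coweight (α : H.root) {i : H.root} (hi : i ∈ b.support) :
    α.1 (coweight b i) = rootCoeff b α i := by
  classical
  rw [root_apply_eq_sum b, Finset.sum_congr rfl fun j hj ↦ by rw [apply_coweight b i hj]]
  simp [hi]

lemma rootCoeff_add {α β γ : H.root} (h : ∀ x : H, γ.1 x = α.1 x + β.1 x) {i : H.root}
    (hi : i ∈ b.support) : rootCoeff b γ i = rootCoeff b α i + rootCoeff b β i := by
  have := h (coweight b i)
  simp only [root_apply_coweight b _ hi] at this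
  exact_mod_cast this

lemma rootCoeff_negRoot (α : H.root) {i : H.root} (hi : i ∈ b.support) :
    rootCoeff b (negRoot α) i = - rootCoeff b α i := by
  have := negRoot_apply α (coweight b i)
  simp only [root_apply_coweight b _ hi] at this
  exact_mod_cast this

open Classical in
lemma rootCoeff_support {i j : H.root} (hi : i ∈ b.support) (hj : j ∈ b.support) :
    rootCoeff b j i = if j = i then 1 else 0 := by
  have := root_apply_coweight b j hi
  rw [apply_coweight b i hj] at this
  split_ifs at this ⊢ with h
  · exact_mod_cast this.symm
  · exact_mod_cast this.symm

lemma rootCoeff_nonneg_or_nonpos (α : H.root) :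
    (∀ i, 0 ≤ rootCoeff b α i) ∨ ∀ i, rootCoeff b α i ≤ 0 :=
  (rootCoeff_spec b α).1.imp (fun h ↦ h.le) (fun h ↦ h.le)

lemma isPos_iff_rootCoeff (α : H.root) : b.IsPos α ↔ ∀ i, 0 ≤ rootCoeff b α i := by
  rw [RootPairing.Base.isPos_iff']
  have hh : b.height α = ∑ j ∈ b.support, rootCoeff b α j := rfl
  rw [hh]
  refine ⟨fun h ↦ ?_, fun h ↦ Finset.sum_nonneg fun i _ ↦ h i⟩
  rcases (rootCoeff_spec b α).1 with h' | h'
  · exact h'.le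
  · exfalso
    have h0 := b.height_ne_zero α
    rw [hh] at h0
    exact h0 (le_antisymm (Finset.sum_nonpos fun i _ ↦ h'.le i) h)

/-- The linear functional on the root lattice that takes the value `c i` at the simple root `i`. -/
def degree (c : H.root → ℤ) (α : H.root) : ℤ := ∑ i ∈ b.support, rootCoeff b α i * c i

lemma degree_add (c : H.root → ℤ) {α β γ : H.root} (h : ∀ x : H, γ.1 x = α.1 x + β.1 x) :
    degree b c γ = degree b c α + degree b c β := by
  simp only [degree, ← Finset.sum_add_distrib]
  exact Finset.sum_congr rfl fun i hi ↦ by rw [rootCoeff_add b h hi, add_mul]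

lemma degree_negRoot (c : H.root → ℤ) (α : H.root) :
    degree b c (negRoot α) = - degree b c α := by
  simp only [degree, ← Finset.sum_neg_distrib]
  exact Finset.sum_congr rfl fun i hi ↦ by rw [rootCoeff_negRoot b α hi, neg_mul]

lemma exists_root_apply_eq_degree (c : H.root → ℤ) :
    ∃ h : H, ∀ α : H.root, α.1 h = degree b c α := by
  obtain ⟨h, hh⟩ := exists_root_apply_eq b fun j ↦ (c j : ℂ)
  refine ⟨h, fun α ↦ ?_⟩
  rw [root_apply_eq_sum b, degree]
  push_cast
  exact Finset.sum_congr rfl fun j hj ↦ by rw [hh j hj]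

end Coefficients

/-! ### Subspaces attached to sets of roots. -/

section RootSubspace

open LieAlgebra LieAlgebra.IsKilling LieModule

variable {𝔤 : Type*} [LieRing 𝔤] [LieAlgebra ℂ 𝔤] [FiniteDimensional ℂ 𝔤] [IsKilling ℂ 𝔤]
  {H : LieSubalgebra ℂ 𝔤} [H.IsCartanSubalgebra]

namespace RootVectors

variable (E : RootVectors H)

/-- The span of the root vectors of a set of roots. -/
def rootSpan (Φ : Set H.root) : Submodule ℂ 𝔤 := Submodule.span ℂ (E.e '' Φ)

/-- The elements whose components outside a set of roots vanish. -/
def rootSub (Φ : Set H.root) : Submodule ℂ 𝔤 := ⨅ α ∈ Φᶜ, LinearMap.ker (E.coef α)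

lemma mem_rootSub {Φ : Set H.root} {x : 𝔤} : x ∈ E.rootSub Φ ↔ ∀ α ∉ Φ, E.coef α x = 0 := by
  simp [rootSub]

lemma mem_rootSpan {Φ : Set H.root} {x : 𝔤} :
    x ∈ E.rootSpan Φ ↔ E.hpart x = 0 ∧ ∀ α ∉ Φ, E.coef α x = 0 := by
  constructor
  · intro hx
    refine Submodule.span_induction ?_ (by simp) ?_ ?_ hx
    · rintro _ ⟨β, hβ, rfl⟩
      exact ⟨E.hpart_e β, fun α hα ↦ E.coef_e_of_ne fun h ↦ hα (h ▸ hβ)⟩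
    · rintro x y - - ⟨h1, h2⟩ ⟨h3, h4⟩
      exact ⟨by rw [map_add, h1, h3, add_zero],
        fun α hα ↦ by rw [map_add, h2 α hα, h4 α hα, add_zero]⟩
    · rintro c x - ⟨h1, h2⟩
      exact ⟨by rw [map_smul, h1, smul_zero], fun α hα ↦ by rw [map_smul, h2 α hα, smul_zero]⟩
  · rintro ⟨h1, h2⟩
    rw [← E.hpart_add_sum x, h1, zero_add]
    refine Submodule.sum_mem _ fun α _ ↦ ?_
    by_cases hα : α ∈ Φ
    · exact Submodule.smul_mem _ _ (Submodule.subset_span ⟨α, hα, rfl⟩)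
    · rw [h2 α hα, zero_smul]; exact Submodule.zero_mem _

lemma rootSub_le {Φ : Set H.root} {W : Submodule ℂ 𝔤} (hH : ∀ h ∈ H, h ∈ W)
    (he : ∀ α ∈ Φ, E.e α ∈ W) : E.rootSub Φ ≤ W := by
  intro x hx
  rw [← E.hpart_add_sum x]
  refine W.add_mem (hH _ (E.hpart_mem x)) (Submodule.sum_mem _ fun α _ ↦ ?_)
  by_cases hα : α ∈ Φ
  · exact W.smul_mem _ (he α hα)
  · rw [E.mem_rootSub.1 hx α hα, zero_smul]; exact W.zero_mem

lemma rootSpan_le {Φ : Set H.root} {W : Submodule ℂ 𝔤} (he : ∀ α ∈ Φ, E.e α ∈ W) :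
    E.rootSpan Φ ≤ W := by
  rw [rootSpan, Submodule.span_le]
  rintro _ ⟨α, hα, rfl⟩
  exact he α hα

lemma e_mem_rootSub {Φ : Set H.root} {α : H.root} : E.e α ∈ E.rootSub Φ ↔ α ∈ Φ := by
  rw [mem_rootSub]
  refine ⟨fun h ↦ ?_, fun h β hβ ↦ E.coef_e_of_ne fun h' ↦ hβ (h' ▸ h)⟩
  by_contra hα
  simpa [E.coef_e_self] using h α hα

lemma e_mem_rootSpan {Φ : Set H.root} {α : H.root} : E.e α ∈ E.rootSpan Φ ↔ α ∈ Φ := by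
  refine ⟨fun h ↦ ?_, fun h ↦ Submodule.subset_span ⟨α, h, rfl⟩⟩
  by_contra hα
  simpa [E.coef_e_self] using (E.mem_rootSpan.1 h).2 α hα

lemma mem_rootSub_of_mem {Φ : Set H.root} {h : 𝔤} (hh : h ∈ H) : h ∈ E.rootSub Φ :=
  E.mem_rootSub.2 fun _ _ ↦ E.coef_of_mem _ hh

lemma rootSpan_le_rootSub (Φ : Set H.root) : E.rootSpan Φ ≤ E.rootSub Φ :=
  E.rootSpan_le fun _ h ↦ E.e_mem_rootSub.2 h

/-- A set of roots is closed when it contains every root that is a sum of two of its elements. -/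
def _root_.Seaweed.IsClosedRoots (Φ Ψ Θ : Set H.root) : Prop :=
  ∀ α ∈ Φ, ∀ β ∈ Ψ, ∀ γ : H.root, (∀ x : H, γ.1 x = α.1 x + β.1 x) → γ ∈ Θ

lemma lie_e_e_mem_rootSpan {Φ Ψ Θ : Set H.root} (h : IsClosedRoots Φ Ψ Θ) {α β : H.root}
    (hα : α ∈ Φ) (hβ : β ∈ Ψ) (hne : β ≠ negRoot α) : ⁅E.e α, E.e β⁆ ∈ E.rootSpan Θ := by
  by_cases hγ : ∃ γ : H.root, ∀ x : H, γ.1 x = α.1 x + β.1 x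
  · obtain ⟨γ, hγ⟩ := hγ
    obtain ⟨c, -, hc⟩ := E.exists_lie_e_e hγ
    rw [hc]
    exact Submodule.smul_mem _ _ (E.e_mem_rootSpan.2 (h α hα β hβ γ hγ))
  · rw [E.lie_e_e_eq_zero hne (not_exists.1 hγ)]
    exact Submodule.zero_mem _

lemma lie_e_e_mem_rootSub {Φ Ψ Θ : Set H.root} (h : IsClosedRoots Φ Ψ Θ) {α β : H.root}
    (hα : α ∈ Φ) (hβ : β ∈ Ψ) : ⁅E.e α, E.e β⁆ ∈ E.rootSub Θ := by
  by_cases hne : β = negRoot α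
  · rw [hne]
    exact E.mem_rootSub_of_mem (E.lie_e_e_negRoot_mem α)
  · exact E.rootSpan_le_rootSub _ (E.lie_e_e_mem_rootSpan h hα hβ hne)

lemma lie_mem_rootSub {Φ : Set H.root} (h : IsClosedRoots Φ Φ Φ) {x y : 𝔤}
    (hx : x ∈ E.rootSub Φ) (hy : y ∈ E.rootSub Φ) : ⁅x, y⁆ ∈ E.rootSub Φ := by
  have h1 : ∀ u ∈ H, ∀ w ∈ E.rootSub Φ, ⁅u, w⁆ ∈ E.rootSub Φ := fun u hu w hw ↦
    E.mem_rootSub.2 fun α hα ↦ by rw [E.coef_lie hu, E.mem_rootSub.1 hw α hα, mul_zero]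
  have h2 : ∀ α ∈ Φ, ∀ w ∈ E.rootSub Φ, ⁅E.e α, w⁆ ∈ E.rootSub Φ := fun α hα ↦ by
    refine E.rootSub_le (W := (E.rootSub Φ).comap (LieAlgebra.ad ℂ 𝔤 (E.e α) : 𝔤 →ₗ[ℂ] 𝔤))
      (fun u hu ↦ ?_) (fun β hβ ↦ E.lie_e_e_mem_rootSub h hα hβ)
    change ⁅E.e α, u⁆ ∈ E.rootSub Φ
    rw [← lie_skew]
    exact Submodule.neg_mem _ (h1 u hu _ (E.e_mem_rootSub.2 hα))
  have h3 := E.rootSub_le (Φ := Φ)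
    (W := (E.rootSub Φ).comap (LieAlgebra.ad ℂ 𝔤 y : 𝔤 →ₗ[ℂ] 𝔤))
    (fun u hu ↦ by
      change ⁅y, u⁆ ∈ E.rootSub Φ
      rw [← lie_skew]
      exact Submodule.neg_mem _ (h1 u hu _ hy))
    (fun α hα ↦ by
      change ⁅y, E.e α⁆ ∈ E.rootSub Φ
      rw [← lie_skew]
      exact Submodule.neg_mem _ (h2 α hα _ hy)) hx
  change ⁅y, x⁆ ∈ E.rootSub Φ at h3
  rw [← lie_skew]
  exact Submodule.neg_mem _ h3

lemma lie_mem_rootSpan {Φ Ψ Θ : Set H.root} (h : IsClosedRoots Φ Ψ Θ)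
    (hne : ∀ α ∈ Φ, negRoot α ∉ Ψ) {x y : 𝔤}
    (hx : x ∈ E.rootSpan Φ) (hy : y ∈ E.rootSpan Ψ) : ⁅x, y⁆ ∈ E.rootSpan Θ := by
  have h2 : ∀ α ∈ Φ, ∀ w ∈ E.rootSpan Ψ, ⁅E.e α, w⁆ ∈ E.rootSpan Θ := fun α hα ↦
    E.rootSpan_le (W := (E.rootSpan Θ).comap (LieAlgebra.ad ℂ 𝔤 (E.e α) : 𝔤 →ₗ[ℂ] 𝔤))
      fun β hβ ↦ E.lie_e_e_mem_rootSpan h hα hβ fun h' ↦ hne α hα (h' ▸ hβ)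
  have h3 := E.rootSpan_le (Φ := Φ)
    (W := (E.rootSpan Θ).comap (LieAlgebra.ad ℂ 𝔤 y : 𝔤 →ₗ[ℂ] 𝔤))
    (fun α hα ↦ by
      change ⁅y, E.e α⁆ ∈ E.rootSpan Θ
      rw [← lie_skew]
      exact Submodule.neg_mem _ (h2 α hα _ hy)) hx
  change ⁅y, x⁆ ∈ E.rootSpan Θ at h3
  rw [← lie_skew]
  exact Submodule.neg_mem _ h3

lemma lie_mem_rootSpan_of_mem_rootSub {Φ Ψ : Set H.root} (h : IsClosedRoots Φ Ψ Ψ)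
    (hne : ∀ α ∈ Φ, negRoot α ∉ Ψ) {x y : 𝔤}
    (hx : x ∈ E.rootSub Φ) (hy : y ∈ E.rootSpan Ψ) : ⁅x, y⁆ ∈ E.rootSpan Ψ := by
  have h3 := E.rootSub_le (Φ := Φ)
    (W := (E.rootSpan Ψ).comap (LieAlgebra.ad ℂ 𝔤 y : 𝔤 →ₗ[ℂ] 𝔤))
    (fun u hu ↦ by
      change ⁅y, u⁆ ∈ E.rootSpan Ψ
      rw [← lie_skew, E.mem_rootSpan]
      exact ⟨by rw [map_neg, E.hpart_lie hu, neg_zero], fun α hα ↦ by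
        rw [map_neg, E.coef_lie hu, (E.mem_rootSpan.1 hy).2 α hα, mul_zero, neg_zero]⟩)
    (fun α hα ↦ by
      change ⁅y, E.e α⁆ ∈ E.rootSpan Ψ
      rw [← lie_skew]
      exact Submodule.neg_mem _ (E.lie_mem_rootSpan h hne (E.e_mem_rootSpan.2 hα) hy)) hx
  change ⁅y, x⁆ ∈ E.rootSpan Ψ at h3
  rw [← lie_skew]
  exact Submodule.neg_mem _ h3

end RootVectors

end RootSubspace

/-! ### Root sets of parabolic subalgebras and seaweeds. -/

section Structure

open LieAlgebra LieAlgebra.IsKilling LieModule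

variable {𝔤 : Type*} [LieRing 𝔤] [LieAlgebra ℂ 𝔤] [FiniteDimensional ℂ 𝔤] [IsKilling ℂ 𝔤]
  {H : LieSubalgebra ℂ 𝔤} [H.IsCartanSubalgebra]

lemma root_eq_add_iff {α β γ : H.root} :
    (rootSystem H).root γ = (rootSystem H).root α + (rootSystem H).root β ↔
      ∀ x : H, γ.1 x = α.1 x + β.1 x :=
  ⟨fun h x ↦ congrArg (fun φ ↦ φ x) h, fun h ↦ LinearMap.ext h⟩

variable (b : (rootSystem H).Base)

/-- The roots that are combinations of the simple roots of a set `π`. -/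
def leviRoots (π : Set H.root) : Set H.root :=
  {α | ∀ i ∈ b.support, i ∉ π → rootCoeff b α i = 0}

lemma isPos_of_rootCoeff_pos {α i : H.root} (h : 0 < rootCoeff b α i) : b.IsPos α := by
  rw [isPos_iff_rootCoeff]
  rcases rootCoeff_nonneg_or_nonpos b α with h' | h'
  · exact h'
  · exact absurd (h' i) h.not_ge

/-- Induction on the positive roots that are combinations of the simple roots of a set `π`. -/
lemma isPos_induction {π : Set H.root} {p : H.root → Prop}
    (h₁ : ∀ j ∈ b.support, j ∈ π → p j)
    (h₂ : ∀ α j γ : H.root, (∀ x : H, γ.1 x = α.1 x + j.1 x) → b.IsPos α → α ∈ leviRoots b π →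
      j ∈ b.support → j ∈ π → p α → p γ)
    {α : H.root} (hα : b.IsPos α) (hπ : α ∈ leviRoots b π) : p α := by
  classical
  -- Positivity is carried in the motive: it makes all coefficients nonnegative, so a sum with a
  -- simple root that has zero coefficients outside `π` comes from a root with the same property.
  suffices h : b.IsPos α ∧ (α ∈ leviRoots b π → p α) from h.2 hπ
  refine hα.induction_on_add (p := fun α ↦ b.IsPos α ∧ (α ∈ leviRoots b π → p α))
    (fun j hj ↦ ⟨b.isPos_of_mem_support hj, fun h ↦ h₁ j hj ?_⟩) ?_
  · by_contra hj'
    have := h j hj hj'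
    rw [rootCoeff_support b hj hj, if_pos rfl] at this
    omega
  · rintro β j γ h ⟨h1, h2⟩ hj
    rw [root_eq_add_iff] at h
    have hβ := (isPos_iff_rootCoeff b β).1 h1
    have hk : ∀ i ∈ b.support, rootCoeff b γ i = rootCoeff b β i + if j = i then 1 else 0 :=
      fun i hi ↦ by rw [rootCoeff_add b h hi, rootCoeff_support b hi hj]
    have hkj := hk j hj
    rw [if_pos rfl] at hkj
    have hβj := hβ j
    refine ⟨isPos_of_rootCoeff_pos b (i := j) (by omega), fun hγ' ↦ ?_⟩
    have hβl : β ∈ leviRoots b π := fun i hi hi' ↦ by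
      have := hk i hi
      have := hγ' i hi hi'
      have := hβ i
      split_ifs at * <;> omega
    refine h₂ β j γ h h1 hβl hj ?_ (h2 hβl)
    by_contra hj'
    have := hγ' j hj hj'
    omega

variable (E : RootVectors H)

namespace RootVectors

/-- The subalgebra attached to a closed set of roots. -/
def subalgebra {Φ : Set H.root} (h : IsClosedRoots Φ Φ Φ) : LieSubalgebra ℂ 𝔤 :=
  { E.rootSub Φ with lie_mem' := fun hx hy ↦ E.lie_mem_rootSub h hx hy }

lemma rootSpace_le_rootSub {Φ : Set H.root} {α : H.root} (h : α ∈ Φ) {y : 𝔤}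
    (hy : y ∈ rootSpace H (α : Weight ℂ H 𝔤)) : y ∈ E.rootSub Φ :=
  (E.rootSpace_subset_iff α (E.rootSub Φ)).2 (E.e_mem_rootSub.2 h) y hy

/-- A subalgebra that contains the root vectors of the simple roots of a set `π`, up to a sign,
contains those of all the positive roots that are supported by `π`. -/
lemma e_mem_of_isPos (S : LieSubalgebra ℂ 𝔤) (σ : H.root → H.root)
    (hσ : ∀ α β γ : H.root, (∀ x : H, γ.1 x = α.1 x + β.1 x) →
      ∀ x : H, (σ γ).1 x = (σ α).1 x + (σ β).1 x)
    (π : Set H.root) (hS : ∀ i ∈ π, E.e (σ i) ∈ S) {α : H.root} (hα : b.IsPos α)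
    (hπ : α ∈ leviRoots b π) : E.e (σ α) ∈ S := by
  refine isPos_induction b (p := fun α ↦ E.e (σ α) ∈ S) (fun j _ hj ↦ hS j hj)
    (fun β j γ h _ _ _ hj hβ ↦ ?_) hα hπ
  obtain ⟨c, hc, hc'⟩ := E.exists_lie_e_e (hσ _ _ _ h)
  rw [← inv_smul_smul₀ hc (E.e (σ γ)), ← hc']
  exact S.smul_mem _ (S.lie_mem hβ (hS j hj))

end RootVectors

/-- The roots of the standard parabolic subalgebra. -/
def parabolicRoots (π : Set H.root) : Set H.root :=
  {α | ∀ i ∈ b.support, i ∉ π → 0 ≤ rootCoeff b α i}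

/-- The roots of the opposite parabolic subalgebra. -/
def oppositeRoots (π : Set H.root) : Set H.root :=
  {α | ∀ i ∈ b.support, i ∉ π → rootCoeff b α i ≤ 0}

lemma isClosedRoots_parabolicRoots (π : Set H.root) :
    IsClosedRoots (parabolicRoots b π) (parabolicRoots b π) (parabolicRoots b π) :=
  fun α hα β hβ γ h i hi hi' ↦ by
    rw [rootCoeff_add b h hi]
    exact add_nonneg (hα i hi hi') (hβ i hi hi')

lemma isClosedRoots_oppositeRoots (π : Set H.root) :
    IsClosedRoots (oppositeRoots b π) (oppositeRoots b π) (oppositeRoots b π) :=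
  fun α hα β hβ γ h i hi hi' ↦ by
    rw [rootCoeff_add b h hi]
    exact add_nonpos (hα i hi hi') (hβ i hi hi')

lemma isPos_or_isPos_negRoot (α : H.root) : b.IsPos α ∨ b.IsPos (negRoot α) := by
  rw [RootPairing.Base.isPos_iff', RootPairing.Base.isPos_iff']
  have h1 : b.height α = degree b (fun _ ↦ 1) α := by
    simp [degree]; rfl
  have h2 : b.height (negRoot α) = degree b (fun _ ↦ 1) (negRoot α) := by
    simp [degree]; rfl
  rw [h1, h2, degree_negRoot]
  omega

-- The closed root set defines a subalgebra that contains the generators. Conversely, when `-α` is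
-- positive, the sign condition on `α` forces its coefficients outside `π` to vanish, so `e α` is
-- reached by brackets of negative simple root vectors from `π`.
variable {b} in
lemma mem_parabolic {π : Set H.root} (hπ : π ⊆ b.support) {x : 𝔤} :
    x ∈ parabolic b π ↔ x ∈ E.rootSub (parabolicRoots b π) := by
  classical
  constructor
  · suffices h : parabolic b π ≤ E.subalgebra (isClosedRoots_parabolicRoots b π) from fun hx ↦ h hx
    rw [parabolic, LieSubalgebra.lieSpan_le]
    rintro y ((hy | ⟨β, hβ, hy⟩) | ⟨α, hα, hy⟩)
    · exact E.mem_rootSub_of_mem hy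
    · exact E.rootSpace_le_rootSub (Φ := parabolicRoots b π)
        (fun i _ _ ↦ (isPos_iff_rootCoeff b β).1 hβ i) hy
    · refine E.rootSpace_le_rootSub (Φ := parabolicRoots b π) (α := negRoot α)
        (fun i hi hi' ↦ ?_) hy
      rw [rootCoeff_negRoot b α hi, rootCoeff_support b hi (hπ hα),
        if_neg fun h : α = i ↦ hi' (h ▸ hα), neg_zero]
  · have hpos : ∀ α, b.IsPos α → E.e α ∈ parabolic b π := fun α hα ↦
      LieSubalgebra.subset_lieSpan (Or.inl (Or.inr ⟨α, hα, E.mem α⟩))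
    refine fun hx ↦ E.rootSub_le (W := (parabolic b π).toSubmodule)
      (fun h hh ↦ LieSubalgebra.subset_lieSpan (Or.inl (Or.inl hh))) (fun α hα ↦ ?_) hx
    rcases isPos_or_isPos_negRoot b α with h | h
    · exact hpos α h
    · have := E.e_mem_of_isPos b (parabolic b π) negRoot
        (fun α β γ h x ↦ by simp only [negRoot_apply, h]; ring) π
        (fun i hi ↦ LieSubalgebra.subset_lieSpan (Or.inr ⟨i, hi, E.mem (negRoot i)⟩)) h
        (fun i hi hi' ↦ le_antisymm ?_ ((isPos_iff_rootCoeff b _).1 h i))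
      · rwa [negRoot_negRoot] at this
      · rw [rootCoeff_negRoot b α hi, neg_nonpos]
        exact hα i hi hi'

variable {b} in
lemma mem_oppositeParabolic {π : Set H.root} (hπ : π ⊆ b.support) {x : 𝔤} :
    x ∈ oppositeParabolic b π ↔ x ∈ E.rootSub (oppositeRoots b π) := by
  classical
  constructor
  · suffices h : oppositeParabolic b π ≤ E.subalgebra (isClosedRoots_oppositeRoots b π) from
      fun hx ↦ h hx
    rw [oppositeParabolic, LieSubalgebra.lieSpan_le]
    rintro y ((hy | ⟨β, hβ, hy⟩) | ⟨α, hα, hy⟩)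
    · exact E.mem_rootSub_of_mem hy
    · refine E.rootSpace_le_rootSub (Φ := oppositeRoots b π) (α := negRoot β)
        (fun i hi _ ↦ ?_) hy
      rw [rootCoeff_negRoot b β hi, neg_nonpos]
      exact (isPos_iff_rootCoeff b β).1 hβ i
    · refine E.rootSpace_le_rootSub (Φ := oppositeRoots b π) (α := α)
        (fun i hi hi' ↦ ?_) hy
      rw [rootCoeff_support b hi (hπ hα), if_neg fun h : α = i ↦ hi' (h ▸ hα)]
  · have hpos : ∀ α, b.IsPos α → E.e (negRoot α) ∈ oppositeParabolic b π := fun α hα ↦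
      LieSubalgebra.subset_lieSpan (Or.inl (Or.inr ⟨α, hα, E.mem (negRoot α)⟩))
    refine fun hx ↦ E.rootSub_le (W := (oppositeParabolic b π).toSubmodule)
      (fun h hh ↦ LieSubalgebra.subset_lieSpan (Or.inl (Or.inl hh))) (fun α hα ↦ ?_) hx
    rcases isPos_or_isPos_negRoot b α with h | h
    · exact E.e_mem_of_isPos b (oppositeParabolic b π) id
        (fun α β γ h ↦ h) π
        (fun i hi ↦ LieSubalgebra.subset_lieSpan (Or.inr ⟨i, hi, E.mem i⟩)) h
        (fun i hi hi' ↦ le_antisymm (hα i hi hi') ((isPos_iff_rootCoeff b _).1 h i))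
    · have := hpos _ h
      rwa [negRoot_negRoot] at this

/-- The roots of a seaweed subalgebra. -/
def seaweedRoots (π₁ π₂ : Set H.root) : Set H.root := parabolicRoots b π₁ ∩ oppositeRoots b π₂

/-- The roots of the reductive part of a seaweed subalgebra. -/
def reductiveRoots (π₁ π₂ : Set H.root) : Set H.root :=
  {α | α ∈ seaweedRoots b π₁ π₂ ∧ negRoot α ∈ seaweedRoots b π₁ π₂}

/-- The roots of the nilpotent part of a seaweed subalgebra. -/
def nilpotentRoots (π₁ π₂ : Set H.root) : Set H.root :=
  {α | α ∈ seaweedRoots b π₁ π₂ ∧ negRoot α ∉ seaweedRoots b π₁ π₂}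

variable {b} in
lemma mem_seaweed {π₁ π₂ : Set H.root} (h₁ : π₁ ⊆ b.support) (h₂ : π₂ ⊆ b.support) {x : 𝔤} :
    x ∈ seaweed b π₁ π₂ ↔ x ∈ E.rootSub (seaweedRoots b π₁ π₂) := by
  rw [seaweed, LieSubalgebra.mem_inf, mem_parabolic E h₁, mem_oppositeParabolic E h₂]
  simp only [RootVectors.mem_rootSub, seaweedRoots, Set.mem_inter_iff, not_and_or, or_imp,
    forall_and]

lemma isClosedRoots_seaweedRoots (π₁ π₂ : Set H.root) :
    IsClosedRoots (seaweedRoots b π₁ π₂) (seaweedRoots b π₁ π₂) (seaweedRoots b π₁ π₂) :=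
  fun α hα β hβ γ h ↦ ⟨isClosedRoots_parabolicRoots b π₁ α hα.1 β hβ.1 γ h,
    isClosedRoots_oppositeRoots b π₂ α hα.2 β hβ.2 γ h⟩

lemma negRoot_add {α β γ : H.root} (h : ∀ x : H, γ.1 x = α.1 x + β.1 x) (x : H) :
    (negRoot γ).1 x = (negRoot α).1 x + (negRoot β).1 x := by
  simp only [negRoot_apply, h]; ring

lemma isClosedRoots_reductiveRoots (π₁ π₂ : Set H.root) :
    IsClosedRoots (reductiveRoots b π₁ π₂) (reductiveRoots b π₁ π₂) (reductiveRoots b π₁ π₂) :=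
  fun α hα β hβ γ h ↦ ⟨isClosedRoots_seaweedRoots b π₁ π₂ α hα.1 β hβ.1 γ h,
    isClosedRoots_seaweedRoots b π₁ π₂ _ hα.2 _ hβ.2 _ (negRoot_add h)⟩

lemma isClosedRoots_leviRoots (π : Set H.root) :
    IsClosedRoots (leviRoots b π) (leviRoots b π) (leviRoots b π) :=
  fun α hα β hβ γ h i hi hi' ↦ by rw [rootCoeff_add b h hi, hα i hi hi', hβ i hi hi', add_zero]

lemma negRoot_mem_leviRoots {π : Set H.root} {α : H.root} (hα : α ∈ leviRoots b π) :
    negRoot α ∈ leviRoots b π :=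
  fun i hi hi' ↦ by rw [rootCoeff_negRoot b α hi, hα i hi hi', neg_zero]

open Classical in
/-- The degree that counts the simple roots of `π₂` that are not in `π₁`. -/
def relDegree (π₁ π₂ : Set H.root) : H.root → ℤ :=
  degree b fun i ↦ if i ∈ π₂ ∧ i ∉ π₁ then 1 else 0

variable {b}

lemma relDegree_pos {π₁ π₂ : Set H.root} {α i : H.root}
    (h : ∀ j ∈ b.support, j ∈ π₂ → j ∉ π₁ → 0 ≤ rootCoeff b α j)
    (hi : i ∈ b.support) (h2 : i ∈ π₂) (h1 : i ∉ π₁) (hk : rootCoeff b α i ≠ 0) :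
    0 < relDegree b π₁ π₂ α := by
  classical
  refine Finset.sum_pos' (fun j hj ↦ ?_) ⟨i, hi, ?_⟩
  · beta_reduce
    split_ifs with h'
    · simpa using h j hj h'.1 h'.2
    · simp
  · beta_reduce
    rw [if_pos ⟨h2, h1⟩, mul_one]
    exact lt_of_le_of_ne (h i hi h2 h1) hk.symm

lemma exists_of_relDegree_pos {π₁ π₂ : Set H.root} {α : H.root}
    (h : 0 < relDegree b π₁ π₂ α) :
    ∃ i ∈ b.support, i ∈ π₂ ∧ i ∉ π₁ ∧ 0 < rootCoeff b α i := by
  classical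
  by_contra! h'
  refine h.not_ge (Finset.sum_nonpos fun i hi ↦ ?_)
  beta_reduce
  split_ifs with hi'
  · simpa using h' i hi hi'.1 hi'.2
  · simp

lemma relDegree_nonneg {π₁ π₂ : Set H.root} {α : H.root}
    (h : ∀ j ∈ b.support, j ∈ π₂ → j ∉ π₁ → 0 ≤ rootCoeff b α j) :
    0 ≤ relDegree b π₁ π₂ α := by
  classical
  refine Finset.sum_nonneg fun j hj ↦ ?_
  beta_reduce
  split_ifs with h'
  · simpa using h j hj h'.1 h'.2
  · simp

variable {π₁ π₂ : Set H.root} {α β γ : H.root}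

lemma nonneg_of_rootCoeff_pos {i : H.root} (h : 0 < rootCoeff b α i) (j : H.root) :
    0 ≤ rootCoeff b α j := by
  rcases rootCoeff_nonneg_or_nonpos b α with h' | h'
  · exact h' j
  · exact absurd (h' i) h.not_ge

/-- The roots of positive degree of the Levi subalgebra of `π₂`. -/
def posRoots (b : (rootSystem H).Base) (π₁ π₂ : Set H.root) : Set H.root :=
  {α | α ∈ leviRoots b π₂ ∧ 0 < relDegree b π₁ π₂ α}

/-- A positive degree forces one positive coefficient, hence all coefficients are nonnegative; the
condition of the opposite parabolic outside `π₂` then becomes vanishing. -/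
lemma mem_posRoots_iff :
    α ∈ posRoots b π₁ π₂ ↔ α ∈ seaweedRoots b π₁ π₂ ∧ 0 < relDegree b π₁ π₂ α := by
  constructor
  · rintro ⟨h, h'⟩
    obtain ⟨i, hi, -, -, hk⟩ := exists_of_relDegree_pos h'
    exact ⟨⟨fun j _ _ ↦ nonneg_of_rootCoeff_pos hk j, fun j hj hj' ↦ (h j hj hj').le⟩, h'⟩
  · rintro ⟨h, h'⟩
    obtain ⟨i, hi, -, -, hk⟩ := exists_of_relDegree_pos h'
    exact ⟨fun j hj hj' ↦ le_antisymm (h.2 j hj hj') (nonneg_of_rootCoeff_pos hk j), h'⟩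

/-- Negation exchanges the two parabolic conditions. Through it, statements about the negative half
follow from those about the positive half of the swapped seaweed. -/
lemma negRoot_mem_seaweedRoots_iff :
    negRoot α ∈ seaweedRoots b π₁ π₂ ↔ α ∈ seaweedRoots b π₂ π₁ := by
  simp only [seaweedRoots, parabolicRoots, oppositeRoots, Set.mem_inter_iff, Set.mem_ofPred_eq]
  rw [and_comm]
  refine and_congr ?_ ?_ <;>
  · refine forall₂_congr fun i hi ↦ ?_
    rw [rootCoeff_negRoot b α hi]
    simp

lemma mem_reductiveRoots_iff :
    α ∈ reductiveRoots b π₁ π₂ ↔ α ∈ leviRoots b (π₁ ∩ π₂) := by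
  rw [reductiveRoots, Set.mem_ofPred_eq, negRoot_mem_seaweedRoots_iff]
  constructor
  · rintro ⟨h, h'⟩ i hi hi'
    by_cases h1 : i ∈ π₁
    · have h2 : i ∉ π₂ := fun h2 ↦ hi' ⟨h1, h2⟩
      exact le_antisymm (h.2 i hi h2) (h'.1 i hi h2)
    · exact le_antisymm (h'.2 i hi h1) (h.1 i hi h1)
  · intro h
    exact ⟨⟨fun i hi hi' ↦ (h i hi fun h ↦ hi' h.1).ge, fun i hi hi' ↦ (h i hi fun h ↦ hi' h.2).le⟩,
      fun i hi hi' ↦ (h i hi fun h ↦ hi' h.2).ge, fun i hi hi' ↦ (h i hi fun h ↦ hi' h.1).le⟩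

lemma relDegree_nonneg_of_mem (h : α ∈ seaweedRoots b π₁ π₂) : 0 ≤ relDegree b π₁ π₂ α :=
  relDegree_nonneg fun j hj _ h1 ↦ h.1 j hj h1

lemma relDegree_negRoot : relDegree b π₁ π₂ (negRoot α) = - relDegree b π₁ π₂ α :=
  degree_negRoot b _ α

lemma relDegree_add (h : ∀ x : H, γ.1 x = α.1 x + β.1 x) :
    relDegree b π₁ π₂ γ = relDegree b π₁ π₂ α + relDegree b π₁ π₂ β := degree_add b _ h

/-- The degree of `α` and the swapped degree of `-α` are both nonnegative. They cannot both be
positive, since the coefficients of a root do not have opposite signs. If both vanish, the sign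
conditions remove every coefficient outside `π₁ ∩ π₂`. -/
lemma seaweedRoots_trichotomy (h : α ∈ seaweedRoots b π₁ π₂) :
    α ∈ reductiveRoots b π₁ π₂ ∧ relDegree b π₁ π₂ α = 0 ∧ relDegree b π₂ π₁ α = 0 ∨
    α ∈ posRoots b π₁ π₂ ∧ relDegree b π₂ π₁ α = 0 ∨
    negRoot α ∈ posRoots b π₂ π₁ ∧ relDegree b π₁ π₂ α = 0 := by
  have hn : 0 ≤ relDegree b π₂ π₁ (negRoot α) :=
    relDegree_nonneg_of_mem (negRoot_mem_seaweedRoots_iff.2 h)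
  rcases (relDegree_nonneg_of_mem h).lt_or_eq with h1 | h1
  · refine Or.inr (Or.inl ⟨mem_posRoots_iff.2 ⟨h, h1⟩, ?_⟩)
    rcases hn.lt_or_eq with h2 | h2
    · obtain ⟨i, hi, -, -, hk⟩ := exists_of_relDegree_pos h1
      obtain ⟨j, hj, -, -, hk'⟩ := exists_of_relDegree_pos h2
      rw [rootCoeff_negRoot b α hj] at hk'
      have := nonneg_of_rootCoeff_pos hk j
      omega
    · rw [relDegree_negRoot] at h2; omega
  · rcases hn.lt_or_eq with h2 | h2
    · exact Or.inr (Or.inr ⟨mem_posRoots_iff.2 ⟨negRoot_mem_seaweedRoots_iff.2 h, h2⟩, h1.symm⟩)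
    · refine Or.inl ⟨mem_reductiveRoots_iff.2 fun i hi hi' ↦ ?_, h1.symm, ?_⟩
      · by_contra hk
        by_cases h1' : i ∈ π₁
        · have h2' : i ∉ π₂ := fun h2' ↦ hi' ⟨h1', h2'⟩
          refine h2.not_lt (relDegree_pos (i := i) (fun j hj hj1 hj2 ↦ ?_) hi h1' h2' ?_)
          · rw [rootCoeff_negRoot b α hj]
            have := h.2 j hj hj2
            omega
          · rw [rootCoeff_negRoot b α hi]; omega
        · by_cases h2' : i ∈ π₂
          · exact h1.not_lt (relDegree_pos (fun j hj _ hj2 ↦ h.1 j hj hj2) hi h2' h1' hk)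
          · exact hk (le_antisymm (h.2 i hi h2') (h.1 i hi h1'))
      · rw [relDegree_negRoot] at h2; omega

lemma relDegree_eq_zero_of_mem_reductiveRoots (h : α ∈ reductiveRoots b π₁ π₂) :
    relDegree b π₁ π₂ α = 0 := by
  rcases (relDegree_nonneg_of_mem h.1).lt_or_eq with h1 | h1
  · have := relDegree_nonneg_of_mem h.2
    rw [relDegree_negRoot] at this
    omega
  · exact h1.symm

lemma mem_nilpotentRoots_iff :
    α ∈ nilpotentRoots b π₁ π₂ ↔ α ∈ posRoots b π₁ π₂ ∨ negRoot α ∈ posRoots b π₂ π₁ := by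
  constructor
  · rintro ⟨h, h'⟩
    rcases seaweedRoots_trichotomy h with h | h | h
    · exact absurd h.1.2 h'
    · exact Or.inl h.1
    · exact Or.inr h.1
  · rintro (h | h)
    · rw [mem_posRoots_iff] at h
      refine ⟨h.1, fun h' ↦ h.2.ne' (relDegree_eq_zero_of_mem_reductiveRoots ⟨h.1, h'⟩)⟩
    · rw [mem_posRoots_iff, negRoot_mem_seaweedRoots_iff] at h
      refine ⟨h.1, fun h' ↦ h.2.ne' ?_⟩
      rw [negRoot_mem_seaweedRoots_iff] at h'
      exact relDegree_eq_zero_of_mem_reductiveRoots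
        ⟨negRoot_mem_seaweedRoots_iff.2 h.1, by rwa [negRoot_negRoot]⟩

end Structure

/-! ### The decomposition of a seaweed and its nilradical. -/

section NilpotentIdeals

open LieAlgebra

variable {K L : Type*} [Field K] [LieRing L] [LieAlgebra K L]

lemma eq_zero_of_lie_eq_smul_of_isNilpotent (I : LieIdeal K L) (hI : LieRing.IsNilpotent I)
    {h e : L} (hh : h ∈ I) (he : e ∈ I) {c : K} (hc : ⁅h, e⁆ = c • e) (hc₀ : c ≠ 0) : e = 0 := by
  obtain ⟨k, hk⟩ := LieModule.isNilpotent_toEnd_of_isNilpotent K I I ⟨h, hh⟩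
  have key : ∀ n, (LieModule.toEnd K I I ⟨h, hh⟩ ^ n) ⟨e, he⟩ = c ^ n • (⟨e, he⟩ : I) := by
    intro n
    induction n with
    | zero => simp
    | succ n ih =>
      rw [pow_succ', Module.End.mul_apply, ih, map_smul, pow_succ, mul_smul]
      congr 1
      exact Subtype.ext hc
  have h1 := key k
  rw [hk, LinearMap.zero_apply] at h1
  exact (smul_eq_zero.1 (congrArg Subtype.val h1).symm).resolve_left (pow_ne_zero k hc₀)

end NilpotentIdeals

section Parts

open LieAlgebra LieAlgebra.IsKilling LieModule

variable {𝔤 : Type*} [LieRing 𝔤] [LieAlgebra ℂ 𝔤] [FiniteDimensional ℂ 𝔤] [IsKilling ℂ 𝔤]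
  {H : LieSubalgebra ℂ 𝔤} [H.IsCartanSubalgebra]
  (E : RootVectors H) {b : (rootSystem H).Base} {π₁ π₂ : Set H.root} {𝔰 : LieSubalgebra ℂ 𝔤}

lemma isClosedRoots_nilpotentRoots :
    IsClosedRoots (seaweedRoots b π₁ π₂) (nilpotentRoots b π₁ π₂) (nilpotentRoots b π₁ π₂) :=
  fun α hα β hβ γ h ↦ ⟨isClosedRoots_seaweedRoots b π₁ π₂ α hα β hβ.1 γ h, fun h' ↦ hβ.2
    (isClosedRoots_seaweedRoots b π₁ π₂ α hα _ h' _ fun x ↦ by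
      simp only [negRoot_apply, h]; ring)⟩

lemma negRoot_not_mem_nilpotentRoots {α : H.root} (hα : α ∈ seaweedRoots b π₁ π₂) :
    negRoot α ∉ nilpotentRoots b π₁ π₂ := fun h ↦ h.2 (by rwa [negRoot_negRoot])

lemma rootSpace_subset_iff_of_mem (h𝔰 : ∀ x, x ∈ 𝔰 ↔ x ∈ E.rootSub (seaweedRoots b π₁ π₂))
    (α : H.root) : (∀ y ∈ rootSpace H (α : Weight ℂ H 𝔤), y ∈ 𝔰) ↔ α ∈ seaweedRoots b π₁ π₂ := by
  rw [← E.e_mem_rootSub, ← h𝔰]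
  exact E.rootSpace_subset_iff α 𝔰.toSubmodule

lemma mem_reductivePart (h𝔰 : ∀ x, x ∈ 𝔰 ↔ x ∈ E.rootSub (seaweedRoots b π₁ π₂)) (x : 𝔰) :
    x ∈ reductivePart H 𝔰 ↔ (x : 𝔤) ∈ E.rootSub (reductiveRoots b π₁ π₂) := by
  constructor
  · suffices h : reductivePart H 𝔰 ≤
        (E.subalgebra (isClosedRoots_reductiveRoots b π₁ π₂)).comap 𝔰.incl from fun hx ↦ h hx
    rw [reductivePart, LieSubalgebra.lieSpan_le]
    rintro y (hy | ⟨α, h1, h2, hy⟩)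
    · exact E.mem_rootSub_of_mem hy
    · exact E.rootSpace_le_rootSub (Φ := reductiveRoots b π₁ π₂)
        ⟨(rootSpace_subset_iff_of_mem E h𝔰 α).1 h1,
          (rootSpace_subset_iff_of_mem E h𝔰 (negRoot α)).1 h2⟩ hy
  · intro hx
    have : (x : 𝔤) ∈ (reductivePart H 𝔰).toSubmodule.map 𝔰.toSubmodule.subtype := by
      refine E.rootSub_le (fun h hh ↦ ?_) (fun α hα ↦ ?_) hx
      · have : (⟨h, (h𝔰 h).2 (E.mem_rootSub_of_mem hh)⟩ : 𝔰) ∈ reductivePart H 𝔰 :=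
          LieSubalgebra.subset_lieSpan (Or.inl hh)
        exact ⟨_, this, rfl⟩
      · have : (⟨E.e α, (h𝔰 _).2 (E.e_mem_rootSub.2 hα.1)⟩ : 𝔰) ∈ reductivePart H 𝔰 :=
          LieSubalgebra.subset_lieSpan (Or.inr ⟨α, (rootSpace_subset_iff_of_mem E h𝔰 α).2 hα.1,
            (rootSpace_subset_iff_of_mem E h𝔰 (negRoot α)).2 hα.2, E.mem α⟩)
        exact ⟨_, this, rfl⟩
    obtain ⟨y, hy, hyx⟩ := this
    rwa [← Subtype.ext hyx]

lemma mem_nilpotentPart (h𝔰 : ∀ x, x ∈ 𝔰 ↔ x ∈ E.rootSub (seaweedRoots b π₁ π₂)) (x : 𝔰) :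
    x ∈ nilpotentPart H 𝔰 ↔ (x : 𝔤) ∈ E.rootSpan (nilpotentRoots b π₁ π₂) := by
  constructor
  · let J : LieIdeal ℂ 𝔰 :=
      { (E.rootSpan (nilpotentRoots b π₁ π₂)).comap 𝔰.toSubmodule.subtype with
        lie_mem := fun {y z} hz ↦ E.lie_mem_rootSpan_of_mem_rootSub isClosedRoots_nilpotentRoots
          (fun α hα ↦ negRoot_not_mem_nilpotentRoots hα) ((h𝔰 y).1 y.2) hz }
    suffices h : nilpotentPart H 𝔰 ≤ J from fun hx ↦ h hx
    rw [nilpotentPart, LieSubmodule.lieSpan_le]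
    rintro y ⟨α, h1, h2, hy⟩
    obtain ⟨c, hc⟩ := E.exists_eq_smul hy
    change (y : 𝔤) ∈ E.rootSpan _
    rw [hc]
    exact Submodule.smul_mem _ _ (E.e_mem_rootSpan.2
      ⟨(rootSpace_subset_iff_of_mem E h𝔰 α).1 h1,
        fun h ↦ h2 ((rootSpace_subset_iff_of_mem E h𝔰 (negRoot α)).2 h)⟩)
  · intro hx
    have : (x : 𝔤) ∈ (nilpotentPart H 𝔰).toSubmodule.map 𝔰.toSubmodule.subtype := by
      refine E.rootSpan_le (fun α hα ↦ ?_) hx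
      exact ⟨⟨E.e α, (h𝔰 _).2 (E.e_mem_rootSub.2 hα.1)⟩,
        LieSubmodule.subset_lieSpan ⟨α, (rootSpace_subset_iff_of_mem E h𝔰 α).2 hα.1,
          fun h ↦ hα.2 ((rootSpace_subset_iff_of_mem E h𝔰 (negRoot α)).1 h), E.mem α⟩, rfl⟩
    obtain ⟨y, hy, hyx⟩ := this
    rwa [← Subtype.ext hyx]

lemma isCompl_parts (h𝔰 : ∀ x, x ∈ 𝔰 ↔ x ∈ E.rootSub (seaweedRoots b π₁ π₂)) :
    IsCompl (reductivePart H 𝔰).toSubmodule (nilpotentPart H 𝔰).toSubmodule := by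
  constructor
  · rw [Submodule.disjoint_def]
    intro x hr hn
    have hr := E.mem_rootSub.1 ((mem_reductivePart E h𝔰 x).1 hr)
    have hn := E.mem_rootSpan.1 ((mem_nilpotentPart E h𝔰 x).1 hn)
    refine Subtype.ext (E.ext (by simpa using hn.1) fun α ↦ ?_)
    by_cases hα : α ∈ nilpotentRoots b π₁ π₂
    · simpa using hr α fun h ↦ hα.2 h.2
    · simpa using hn.2 α hα
  · rw [codisjoint_iff_le_sup]
    rintro x -
    have : (x : 𝔤) ∈ ((reductivePart H 𝔰).toSubmodule ⊔ (nilpotentPart H 𝔰).toSubmodule).map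
        𝔰.toSubmodule.subtype := by
      refine E.rootSub_le (fun h hh ↦ ?_) (fun α hα ↦ ?_) ((h𝔰 x).1 x.2)
      · exact ⟨⟨h, (h𝔰 h).2 (E.mem_rootSub_of_mem hh)⟩, Submodule.mem_sup_left
          ((mem_reductivePart E h𝔰 _).2 (E.mem_rootSub_of_mem hh)), rfl⟩
      · by_cases hα' : negRoot α ∈ seaweedRoots b π₁ π₂
        · exact ⟨⟨E.e α, (h𝔰 _).2 (E.e_mem_rootSub.2 hα)⟩, Submodule.mem_sup_left
            ((mem_reductivePart E h𝔰 _).2 (E.e_mem_rootSub.2 ⟨hα, hα'⟩)), rfl⟩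
        · exact ⟨⟨E.e α, (h𝔰 _).2 (E.e_mem_rootSub.2 hα)⟩, Submodule.mem_sup_right
            ((mem_nilpotentPart E h𝔰 _).2 (E.e_mem_rootSpan.2 ⟨hα, hα'⟩)), rfl⟩
    obtain ⟨y, hy, hyx⟩ := this
    rwa [← Subtype.ext hyx]

/-- The difference `d` of the two relative degrees is additive and at least one on the roots of `𝔫`,
so each `ad x` raises the filtration by `d`. As `d` is bounded, every `ad x` is nilpotent, and
Engel's theorem applies. -/
lemma isNilpotent_nilpotentPart (h𝔰 : ∀ x, x ∈ 𝔰 ↔ x ∈ E.rootSub (seaweedRoots b π₁ π₂)) :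
    LieRing.IsNilpotent (nilpotentPart H 𝔰) := by
  let d : H.root → ℤ := fun α ↦ relDegree b π₁ π₂ α - relDegree b π₂ π₁ α
  have hd : ∀ α ∈ nilpotentRoots b π₁ π₂, 1 ≤ d α := by
    intro α hα
    have h1 := relDegree_nonneg_of_mem hα.1
    have h2 := relDegree_nonneg_of_mem (negRoot_mem_seaweedRoots_iff.2 hα.1)
    have h3 := relDegree_negRoot (b := b) (π₁ := π₂) (π₂ := π₁) (α := α)
    change 1 ≤ relDegree b π₁ π₂ α - relDegree b π₂ π₁ α
    rcases mem_nilpotentRoots_iff.1 hα with h | h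
    · have := h.2; omega
    · have := h.2; omega
  let F : ℕ → Set H.root := fun k ↦ {α | α ∈ nilpotentRoots b π₁ π₂ ∧ (k : ℤ) < d α}
  have hF : ∀ k, ∀ x ∈ E.rootSpan (nilpotentRoots b π₁ π₂), ∀ y ∈ E.rootSpan (F k),
      ⁅x, y⁆ ∈ E.rootSpan (F (k + 1)) := fun k x hx y hy ↦
    E.lie_mem_rootSpan (Θ := F (k + 1)) (fun α hα β hβ γ h ↦ ⟨isClosedRoots_nilpotentRoots α hα.1 β hβ.1 γ h, by
        have h1 := hd α hα
        have h2 := hβ.2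
        have h3 : d γ = d α + d β := by
          simp only [d, relDegree_add h]; ring
        push_cast; omega⟩)
      (fun α hα h ↦ negRoot_not_mem_nilpotentRoots hα.1 h.1) hx hy
  obtain ⟨k, hk⟩ : ∃ k : ℕ, ∀ α, d α ≤ k := by
    obtain ⟨m, hm⟩ := (Set.finite_range d).bddAbove
    exact ⟨m.toNat, fun α ↦ (hm ⟨α, rfl⟩).trans (Int.self_le_toNat m)⟩
  rw [LieAlgebra.isNilpotent_iff_forall (R := ℂ)]
  refine fun x ↦ ⟨k, LinearMap.ext fun y ↦ ?_⟩
  have key : ∀ n, (((LieAlgebra.ad ℂ (nilpotentPart H 𝔰) x ^ n) y : 𝔰) : 𝔤) ∈ E.rootSpan (F n) := by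
    intro n
    induction n with
    | zero =>
      have := (mem_nilpotentPart E h𝔰 _).1 y.2
      have h0 : F 0 = nilpotentRoots b π₁ π₂ :=
        Set.ext fun α ↦ ⟨fun h ↦ h.1, fun h ↦ ⟨h, by have := hd α h; push_cast; omega⟩⟩
      rwa [h0, pow_zero]
    | succ n ih =>
      rw [pow_succ', Module.End.mul_apply]
      exact hF n _ ((mem_nilpotentPart E h𝔰 _).1 x.2) _ ih
  have hk' : F k = ∅ := Set.eq_empty_of_forall_notMem fun α hα ↦ (hk α).not_gt hα.2
  have := key k
  rw [hk', RootVectors.rootSpan, Set.image_empty, Submodule.span_empty, Submodule.mem_bot] at this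
  exact Subtype.ext (Subtype.ext this)

lemma RootVectors.exists_lie_e_e_negRoot (α : H.root) :
    ∃ t : H, ⁅E.e α, E.e (negRoot α)⁆ = t ∧ α.1 t ≠ 0 := by
  refine ⟨(cartanEquivDual H).symm α.1.toLinear, ?_, ?_⟩
  · have := lie_eq_killingForm_smul_of_mem_rootSpace_of_mem_rootSpace_neg (E.mem α)
      (E.mem (negRoot α))
    rwa [E.killing, one_smul] at this
  · exact root_apply_cartanEquivDual_symm_ne_zero (LieSubalgebra.isNonZero_coe_root α)

lemma RootVectors.eq_zero_of_forall_root (E : RootVectors H) (b : (rootSystem H).Base) {h : H}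
    (hh : ∀ i ∈ b.support, i.1 h = 0) : h = 0 := by
  have h0 : ∀ α : H.root, α.1 h = 0 := fun α ↦ by
    rw [root_apply_eq_sum b]
    exact Finset.sum_eq_zero fun i hi ↦ by rw [hh i hi, mul_zero]
  have hc : (h : 𝔤) ∈ LieAlgebra.center ℂ 𝔤 := by
    intro x
    refine E.induction (p := fun x ↦ ⁅x, (h : 𝔤)⁆ = 0) (fun h' hh' ↦ cartan_lie_eq_zero hh' h.2)
      (fun α c ↦ ?_) (fun x y hx hy ↦ by rw [add_lie, hx, hy, add_zero]) x
    rw [smul_lie, ← lie_skew, E.lie_e h.2, Subtype.coe_eta, h0, zero_smul, neg_zero, smul_zero]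
  rw [LieAlgebra.center_eq_bot] at hc
  exact Subtype.ext hc

lemma le_nilpotentPart (h𝔰 : ∀ x, x ∈ 𝔰 ↔ x ∈ E.rootSub (seaweedRoots b π₁ π₂))
    (hind : IsIndecomposable b π₁ π₂) (I : LieIdeal ℂ 𝔰) (hI : LieRing.IsNilpotent I) :
    I ≤ nilpotentPart H 𝔰 := by
  classical
  let W : Submodule ℂ 𝔤 := I.toSubmodule.map 𝔰.toSubmodule.subtype
  have hW : ∀ {y : 𝔰}, (y : 𝔤) ∈ W → y ∈ I := by
    rintro y ⟨z, hz, hzy⟩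
    rwa [← Subtype.ext hzy]
  have hWl : ∀ x ∈ 𝔰, ∀ y ∈ W, ⁅x, y⁆ ∈ W := by
    rintro x hx _ ⟨z, hz, rfl⟩
    exact ⟨(⁅(⟨x, hx⟩ : 𝔰), z⁆ : 𝔰), I.lie_mem hz, rfl⟩
  have hWr : ∀ x ∈ 𝔰, ∀ y ∈ W, ⁅y, x⁆ ∈ W := fun x hx y hy ↦ by
    rw [← lie_skew]; exact W.neg_mem (hWl x hx y hy)
  have hH : ∀ h ∈ H, h ∈ 𝔰 := fun h hh ↦ (h𝔰 h).2 (E.mem_rootSub_of_mem hh)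
  have he : ∀ α ∈ seaweedRoots b π₁ π₂, E.e α ∈ 𝔰 := fun α hα ↦
    (h𝔰 _).2 (E.e_mem_rootSub.2 hα)
  -- If `α t ≠ 0`, then `e α` is a multiple of `⁅t, e α⁆` and lies in the ideal, where `ad t` would
  -- have a nonzero eigenvalue.
  have hcon : ∀ α ∈ seaweedRoots b π₁ π₂, ∀ t : H, (t : 𝔤) ∈ W → α.1 t = 0 := by
    intro α hα t ht
    by_contra hne
    have h1 : ⁅(t : 𝔤), E.e α⁆ = α.1 t • E.e α := E.lie_e t.2 α
    have hW' : E.e α ∈ W := by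
      rw [← inv_smul_smul₀ hne (E.e α), ← h1]
      exact W.smul_mem _ (hWr _ (he α hα) _ ht)
    have := eq_zero_of_lie_eq_smul_of_isNilpotent I hI (h := ⟨t, hH t t.2⟩)
      (e := ⟨E.e α, he α hα⟩) (hW ht) (hW hW') (c := α.1 t) (Subtype.ext h1) hne
    exact E.e_ne_zero α (congrArg Subtype.val this)
  intro y hy
  rw [mem_nilpotentPart E h𝔰]
  have hyW : (y : 𝔤) ∈ W := ⟨y, hy, rfl⟩
  have hcoef := E.coef_smul_e_mem W (fun h hh x hx ↦ hWl h (hH h hh) x hx) hyW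
  have hys := E.mem_rootSub.1 ((h𝔰 y).1 y.2)
  refine E.mem_rootSpan.2 ⟨?_, fun α hα ↦ ?_⟩
  · have hhW : E.hpart y ∈ W := by
      rw [eq_sub_of_add_eq (E.hpart_add_sum (y : 𝔤))]
      exact W.sub_mem hyW (W.sum_mem fun α _ ↦ hcoef α)
    have : (⟨E.hpart y, E.hpart_mem y⟩ : H) = 0 := by
      refine E.eq_zero_of_forall_root b fun i hi ↦ ?_
      -- This is where indecomposability enters: `-i` is a root of the seaweed for `i ∈ π₁`, and `i`
      -- is one for `i ∈ π₂`, so all simple roots vanish on the Cartan component.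
      have hi' : i ∈ π₁ ∪ π₂ := by
        rw [show π₁ ∪ π₂ = (b.support : Set H.root) from hind]; exact hi
      have hpos : ∀ j, 0 ≤ rootCoeff b i j :=
        (isPos_iff_rootCoeff b i).1 (b.isPos_of_mem_support hi)
      have hz : ∀ (π : Set H.root), i ∈ π → ∀ j ∈ b.support, j ∉ π → rootCoeff b i j = 0 :=
        fun π hπ j hj hj' ↦ by
          rw [rootCoeff_support b hj hi, if_neg fun h : i = j ↦ hj' (h ▸ hπ)]
      rcases hi' with h1 | h2
      · have := hcon (negRoot i) (negRoot_mem_seaweedRoots_iff.2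
          ⟨fun j _ _ ↦ hpos j, fun j hj hj' ↦ (hz π₁ h1 j hj hj').le⟩) ⟨_, E.hpart_mem y⟩ hhW
        rwa [negRoot_apply, neg_eq_zero] at this
      · exact hcon i ⟨fun j _ _ ↦ hpos j, fun j hj hj' ↦ (hz π₂ h2 j hj hj').le⟩
          ⟨_, E.hpart_mem y⟩ hhW
    exact congrArg Subtype.val this
  · by_cases hαs : α ∈ seaweedRoots b π₁ π₂
    · have hα' : negRoot α ∈ seaweedRoots b π₁ π₂ := by
        by_contra h; exact hα ⟨hαs, h⟩
      by_contra hne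
      have hW' : E.e α ∈ W := by
        rw [← inv_smul_smul₀ hne (E.e α)]
        exact W.smul_mem _ (hcoef α)
      -- Bracketing `e α` with `e (-α)` produces an element of the ideal in the Cartan subalgebra on
      -- which `α` is nonzero, against `hcon`.
      obtain ⟨t, ht, ht'⟩ := E.exists_lie_e_e_negRoot α
      exact ht' (hcon α hαs t (ht ▸ hWr _ (he _ hα') _ hW'))
    · exact hys α hαs

lemma isGreatest_nilpotentPart (h𝔰 : ∀ x, x ∈ 𝔰 ↔ x ∈ E.rootSub (seaweedRoots b π₁ π₂))
    (hind : IsIndecomposable b π₁ π₂) :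
    IsGreatest {I : LieIdeal ℂ 𝔰 | LieRing.IsNilpotent I} (nilpotentPart H 𝔰) :=
  ⟨isNilpotent_nilpotentPart E h𝔰, fun I hI ↦ le_nilpotentPart E h𝔰 hind I hI⟩

end Parts

/-! ### Transport of cochains along maps of arguments and values. -/

section Pull

open AlternatingMap

variable {K N N' V V' : Type*} [Field K] [AddCommGroup N] [Module K N] [AddCommGroup N']
  [Module K N'] [AddCommGroup V] [Module K V] [AddCommGroup V'] [Module K V'] {q : ℕ}

/-- The image of a cochain under maps of the spaces of values and of arguments. -/
def pull (τ : V →ₗ[K] V') (ψ : N' →ₗ[K] N) (f : N [⋀^Fin q]→ₗ[K] V) : N' [⋀^Fin q]→ₗ[K] V' :=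
  (τ.compAlternatingMap f).compLinearMap ψ

@[simp] lemma pull_apply (τ : V →ₗ[K] V') (ψ : N' →ₗ[K] N) (f : N [⋀^Fin q]→ₗ[K] V)
    (v : Fin q → N') : pull τ ψ f v = τ (f (ψ ∘ v)) := rfl

lemma contract_pull (τ : V →ₗ[K] V') (ψ : N' →ₗ[K] N) (f : N [⋀^Fin (q + 1)]→ₗ[K] V) (x : N') :
    contract x (pull τ ψ f) = pull τ ψ (contract (ψ x) f) := by
  ext v
  simp only [contract_apply, pull_apply]
  congr 2
  funext i
  refine Fin.cases ?_ (fun i ↦ ?_) i <;> simp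

end Pull

section Naturality

variable {K N N' V V' : Type*} [Field K] [CharZero K] [LieRing N] [LieAlgebra K N] [LieRing N']
  [LieAlgebra K N'] [AddCommGroup V] [Module K V] [AddCommGroup V'] [Module K V'] {q : ℕ}

lemma lieDer_pull (τ : V →ₗ[K] V') (ψ : N' →ₗ[K] N) {T : Module.End K V} {T' : Module.End K V'}
    {A : Module.End K N} {A' : Module.End K N'} (hT : ∀ w, τ (T w) = T' (τ w))
    (hA : ∀ x, ψ (A' x) = A (ψ x)) (f : N [⋀^Fin q]→ₗ[K] V) :
    lieDer T' A' (pull τ ψ f) = pull τ ψ (lieDer T A f) := by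
  ext v
  simp only [lieDer_apply, AlternatingMap.sub_apply, post_apply, der_apply, pull_apply, map_sub,
    map_sum, hT]
  congr 1
  refine Finset.sum_congr rfl fun j _ ↦ ?_
  rw [Function.comp_update, hA]; rfl

lemma diff_pull (τ : V →ₗ[K] V') (ψ : N' →ₗ[K] N) {a : N →ₗ[K] Module.End K V}
    {a' : N' →ₗ[K] Module.End K V'} (ha : ∀ x w, τ (a (ψ x) w) = a' x (τ w))
    (hψ : ∀ x y, ψ ⁅x, y⁆ = ⁅ψ x, ψ y⁆) (f : N [⋀^Fin q]→ₗ[K] V) :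
    diff a' (pull τ ψ f) = pull τ ψ (diff a f) := by
  have hL : ∀ (x : N') (k : ℕ) (g : N [⋀^Fin k]→ₗ[K] V),
      lieAlong a' x (pull τ ψ g) = pull τ ψ (lieAlong a (ψ x) g) := fun x k g ↦
    lieDer_pull τ ψ (fun w ↦ ha x w) (fun y ↦ hψ x y) g
  induction q with
  | zero =>
    refine ext_contract fun x ↦ ?_
    rw [contract_pull, contract_diff_zero, contract_diff_zero, hL]
  | succ q ih =>
    refine ext_contract fun x ↦ ?_
    rw [contract_pull, contract_diff, contract_diff, hL, contract_pull, ih]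
    ext v
    simp

end Naturality

/-! ### Weights of cochains. -/

section Weights

variable {K N V U ι κ : Type*} [Field K] [LieRing N] [LieAlgebra K N] [AddCommGroup V]
  [Module K V] [AddCommGroup U] [Module K U] {q : ℕ}

/-- Alternating maps that agree on tuples of elements of a spanning family are equal. -/
lemma ext_of_span [Fintype ι] {e : ι → N} {c : ι → N → K} (he : ∀ n, ∑ i, c i n • e i = n)
    {f g : N [⋀^Fin q]→ₗ[K] V} (h : ∀ v : Fin q → ι, f (e ∘ v) = g (e ∘ v)) : f = g := by
  classical
  ext v
  rw [show v = fun j ↦ ∑ i, c i (v j) • e i from funext fun j ↦ (he (v j)).symm]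
  have key : ∀ f : N [⋀^Fin q]→ₗ[K] V, f (fun j ↦ ∑ i, c i (v j) • e i) =
      ∑ r : Fin q → ι, (∏ j, c (r j) (v j)) • f (e ∘ r) := fun f ↦ by
    rw [show f (fun j ↦ ∑ i, c i (v j) • e i) =
      f.toMultilinearMap (fun j ↦ ∑ i, c i (v j) • e i) from rfl, MultilinearMap.map_sum]
    exact Finset.sum_congr rfl fun r _ ↦ MultilinearMap.map_smul_univ _ _ _
  rw [key, key]
  exact Finset.sum_congr rfl fun r _ ↦ by rw [h]

/-- On eigenvectors, the weight of a matrix entry of a cochain is the weight of the component of the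
value minus the sum of the weights of the arguments. -/
lemma apply_lieDer_of_eigen {ℓ : V →ₗ[K] U} {T : Module.End K V} {A : Module.End K N} {t : K}
    {a : ι → K} {e : ι → N} (hℓ : ∀ w, ℓ (T w) = t • ℓ w) (he : ∀ i, A (e i) = a i • e i)
    (f : N [⋀^Fin q]→ₗ[K] V) (v : Fin q → ι) :
    ℓ (lieDer T A f (e ∘ v)) = (t - ∑ j, a (v j)) • ℓ (f (e ∘ v)) := by
  simp only [lieDer_apply, AlternatingMap.sub_apply, post_apply, der_apply, map_sub, map_sum, hℓ,
    sub_smul, Finset.sum_smul]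
  congr 1
  refine Finset.sum_congr rfl fun j _ ↦ ?_
  rw [Function.comp_apply, he, AlternatingMap.map_update_smul, map_smul,
    ← Function.comp_apply (f := e) (g := v), Function.update_eq_self]

/-- A diagonalizable derivation of the space of cochains is semisimple at zero. -/
lemma lieDer_eq_zero_of_sq [Fintype ι] {e : ι → N} {c : ι → N → K} {a : ι → K}
    {ℓ : κ → V →ₗ[K] U} {t : κ → K} {T : Module.End K V} {A : Module.End K N}
    (hc : ∀ n, ∑ i, c i n • e i = n) (he : ∀ i, A (e i) = a i • e i)
    (hℓ : ∀ k w, ℓ k (T w) = t k • ℓ k w) (hinj : ∀ w, (∀ k, ℓ k w = 0) → w = 0)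
    (f : N [⋀^Fin q]→ₗ[K] V) (hf : lieDer T A (lieDer T A f) = 0) : lieDer T A f = 0 := by
  refine ext_of_span hc fun v ↦ hinj _ fun k ↦ ?_
  have h := congrArg (fun F ↦ ℓ k (F (e ∘ v))) hf
  simp only [AlternatingMap.zero_apply, map_zero, apply_lieDer_of_eigen (hℓ k) he] at h
  rw [apply_lieDer_of_eigen (hℓ k) he]
  rcases smul_eq_zero.1 h with h | h
  · rw [h, zero_smul]
  · exact h

end Weights

section FiniteDimensional

variable {K N V : Type*} [Field K] [AddCommGroup N] [Module K N] [AddCommGroup V]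
  [Module K V] [FiniteDimensional K N] [FiniteDimensional K V] {q : ℕ}

instance finiteDimensional_alternatingMap : FiniteDimensional K (N [⋀^Fin q]→ₗ[K] V) :=
  Module.Finite.of_injective (AlternatingMap.toMultilinearMapLM (R := K) (S := K))
    AlternatingMap.coe_multilinearMap_injective

end FiniteDimensional

/-! ### The Casimir operator commutes with the reductive algebra. -/

section Casimir

variable {K L N V I J : Type*} [Field K] [LieRing L] [LieAlgebra K L] [LieRing N]
  [LieAlgebra K N] [AddCommGroup V] [Module K V] [LieRingModule L V] [LieModule K L V]
  [Fintype I] [Fintype J]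
  {κ : LinearMap.BilinForm K L} {M : LieSubalgebra K L} {φ : N →ₗ⁅K⁆ L}

/-- Invariance of the Casimir tensor. -/
lemma sum_lie_add_sum_lie_eq_zero {W A : Type*} [AddCommGroup W] [Module K W] [Fintype A]
    (symm : ∀ u w, κ u w = κ w u) (inv : ∀ u v w, κ ⁅u, v⁆ w = κ u ⁅v, w⁆) {y y' : A → L}
    (hy : ∀ a, y a ∈ M) (hy' : ∀ a, y' a ∈ M) (h : ∀ u ∈ M, ∑ a, κ (y' a) u • y a = u)
    (h' : ∀ u ∈ M, ∑ a, κ (y a) u • y' a = u) (B : L →ₗ[K] L →ₗ[K] W) {u : L} (hu : u ∈ M) :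
    ∑ a, B ⁅u, y a⁆ (y' a) + ∑ a, B (y a) ⁅u, y' a⁆ = 0 := by
  have h1 : ∀ a, B ⁅u, y a⁆ (y' a) = ∑ c, κ (y' c) ⁅u, y a⁆ • B (y c) (y' a) := fun a ↦ by
    conv_lhs => rw [← h _ (M.lie_mem hu (hy a))]
    simp
  have h2 : ∀ a, B (y a) ⁅u, y' a⁆ = ∑ c, κ (y c) ⁅u, y' a⁆ • B (y a) (y' c) := fun a ↦ by
    conv_lhs => rw [← h' _ (M.lie_mem hu (hy' a))]
    simp
  simp only [h1, h2]
  rw [Finset.sum_comm, ← Finset.sum_add_distrib]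
  refine Finset.sum_eq_zero fun a _ ↦ ?_
  rw [← Finset.sum_add_distrib]
  refine Finset.sum_eq_zero fun c _ ↦ ?_
  rw [← add_smul, ← inv, symm ⁅y' a, u⁆, ← lie_skew, map_neg, neg_add_cancel, zero_smul]

namespace ParabolicData

variable (D : ParabolicData κ M φ I J)

lemma casimir_apply (w : V) : D.casimir V w = ∑ k, ⁅D.x k, ⁅D.x' k, w⁆⁆ +
    ∑ i, ⁅φ (D.e i), ⁅D.f i, w⁆⁆ + ∑ i, ⁅D.f i, ⁅φ (D.e i), w⁆⁆ := by
  simp only [casimir, tr, LinearMap.add_apply, LinearMap.sum_apply, Module.End.mul_apply,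
    LieModule.toEnd_apply_apply, map_sum, lie_lie, Finset.sum_sub_distrib,
    two_smul]
  abel

/-- The Casimir operator commutes with the action of `M`. -/
lemma casimir_lie (hx' : ∀ k, D.x' k ∈ M) {u : L} (hu : u ∈ M) (w : V) :
    D.casimir V ⁅u, w⁆ = ⁅u, D.casimir V w⁆ := by
  -- The families `y` and `y'` are dual for the form on `M`. Duality in the reverse order `h'`
  -- exchanges the roles of `e` and `f` and uses `swap` for the Levi factor.
  let y : I ⊕ (I ⊕ J) → L := Sum.elim (fun i ↦ φ (D.e i)) (Sum.elim D.f D.x)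
  let y' : I ⊕ (I ⊕ J) → L := Sum.elim D.f (Sum.elim (fun i ↦ φ (D.e i)) D.x')
  have hy : ∀ a, y a ∈ M := by
    rintro (i | i | k)
    exacts [D.mem_φ _, D.mem_f i, D.mem_x k]
  have hy' : ∀ a, y' a ∈ M := by
    rintro (i | i | k)
    exacts [D.mem_f i, D.mem_φ _, hx' k]
  have h : ∀ u ∈ M, ∑ a, κ (y' a) u • y a = u := fun u hu ↦ by
    conv_rhs => rw [D.expand u hu]
    simp [y, y', Fintype.sum_sum_type, add_assoc]
  have h' : ∀ u ∈ M, ∑ a, κ (y a) u • y' a = u := fun u hu ↦ by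
    conv_rhs => rw [D.expand u hu]
    have := D.swap_apply (W := L) (LinearMap.mk₂ K (fun p r ↦ κ p u • r)
      (by simp [add_smul]) (by simp [mul_smul]) (by simp) (fun c p r ↦ by simp [smul_comm c]))
    simp only [LinearMap.mk₂_apply] at this
    simp [y, y', Fintype.sum_sum_type, this]
    abel
  have key := sum_lie_add_sum_lie_eq_zero D.symm D.inv hy hy' h h'
    (LinearMap.mk₂ K (fun p r ↦ ⁅p, ⁅r, w⁆⁆) (by simp) (by simp) (by simp) (by simp)) hu
  have hc : ∀ w : V, D.casimir V w = ∑ a, ⁅y a, ⁅y' a, w⁆⁆ := fun w ↦ by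
    rw [casimir_apply]
    simp [y, y', Fintype.sum_sum_type]
    abel
  simp only [LinearMap.mk₂_apply] at key
  rw [hc, hc, lie_sum, ← sub_eq_zero, ← Finset.sum_sub_distrib, ← neg_eq_zero, ← key,
    ← Finset.sum_add_distrib, ← Finset.sum_neg_distrib]
  refine Finset.sum_congr rfl fun a _ ↦ ?_
  simp only [lie_lie, lie_sub]
  abel

end ParabolicData

end Casimir

/-! ### Parabolic data from a graded closed symmetric set of roots. -/

section GradedRoots

open LieAlgebra LieAlgebra.IsKilling LieModule
open scoped TensorProduct

variable {𝔤 : Type*} [LieRing 𝔤] [LieAlgebra ℂ 𝔤] [FiniteDimensional ℂ 𝔤] [IsKilling ℂ 𝔤]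
  {H : LieSubalgebra ℂ 𝔤} [H.IsCartanSubalgebra]

variable (H) in
/-- A closed symmetric set of roots with a grading. -/
structure GradedRoots where
  /-- the roots -/
  roots : Set H.root
  closed : IsClosedRoots roots roots roots
  neg_mem : ∀ α ∈ roots, negRoot α ∈ roots
  /-- the grading element -/
  x : H
  /-- the degree of a root -/
  d : H.root → ℤ
  apply_x : ∀ α : H.root, α.1 x = d α

lemma sum_subtype_eq_ite {W ι : Type*} [AddCommMonoid W] [Fintype ι] (p : ι → Prop)
    [DecidablePred p] [Fintype {i // p i}] (F : ι → W) : ∑ i : {i // p i}, F i = ∑ i, if p i then F i else 0 := by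
  rw [← Finset.sum_filter]
  exact (Finset.sum_subtype _ (by simp) F).symm

namespace GradedRoots

variable (G : GradedRoots H) (E : RootVectors H)

lemma d_add {α β γ : H.root} (h : ∀ x : H, γ.1 x = α.1 x + β.1 x) : G.d γ = G.d α + G.d β := by
  have := h G.x
  simp only [G.apply_x] at this
  exact_mod_cast this

lemma d_negRoot (α : H.root) : G.d (negRoot α) = - G.d α := by
  have := negRoot_apply α G.x
  simp only [G.apply_x] at this
  exact_mod_cast this

/-- The roots of positive degree. -/
def pos : Set H.root := {α | α ∈ G.roots ∧ 0 < G.d α}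

/-- The roots of degree zero. -/
def zero : Set H.root := {α | α ∈ G.roots ∧ G.d α = 0}

instance : Fintype {α // α ∈ G.pos} := Fintype.ofFinite _

instance : Fintype {α // α ∈ G.zero} := Fintype.ofFinite _

/-- The reductive subalgebra spanned by the Cartan subalgebra and by the root spaces. -/
abbrev levi : LieSubalgebra ℂ 𝔤 := E.subalgebra G.closed

/-- The subalgebra spanned by the root spaces of positive degree. -/
def nil : LieSubalgebra ℂ 𝔤 :=
  { E.rootSpan G.pos with
    lie_mem' := fun hx hy ↦ E.lie_mem_rootSpan (Θ := G.pos)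
      (fun α hα β hβ γ h ↦ ⟨G.closed α hα.1 β hβ.1 γ h, by
        rw [G.d_add h]; exact add_pos hα.2 hβ.2⟩)
      (fun α hα h ↦ by
        have h1 := hα.2
        have h2 := h.2
        rw [G.d_negRoot] at h2
        omega) hx hy }

lemma e_mem_nil {α : H.root} (hα : α ∈ G.pos) : E.e α ∈ G.nil E := E.e_mem_rootSpan.2 hα

-- An orthogonal basis has a dual basis made of multiples of its own members, which makes the
-- Casimir tensor visibly symmetric.
variable (H) in
lemma exists_dual_basis_cartan : ∃ v v' : Fin (Module.finrank ℂ H) → H,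
    (∑ k, (v k : 𝔤) ⊗ₜ[ℂ] (v' k : 𝔤) = ∑ k, (v' k : 𝔤) ⊗ₜ[ℂ] (v k : 𝔤)) ∧
    ∀ h : H, ∑ k, killingForm ℂ 𝔤 (v' k) h • v k = h := by
  obtain ⟨v, hv⟩ := LinearMap.BilinForm.exists_orthogonal_basis
    (LieModule.traceForm_isSymm ℂ H 𝔤)
  have hne := fun k ↦ hv.not_isOrtho_basis_self_of_separatingLeft
    (traceForm_cartan_nondegenerate ℂ 𝔤 H).1 k
  have ht : ∀ x y : H, killingForm ℂ 𝔤 (x : 𝔤) y = LieModule.traceForm ℂ H 𝔤 x y := fun x y ↦ rfl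
  refine ⟨v, fun k ↦ (LieModule.traceForm ℂ H 𝔤 (v k) (v k))⁻¹ • v k, ?_, fun h ↦ ?_⟩
  · refine Finset.sum_congr rfl fun k _ ↦ ?_
    exact (TensorProduct.smul_tmul _ _ _).symm
  · have key : ∀ k, killingForm ℂ 𝔤
        (((LieModule.traceForm ℂ H 𝔤 (v k) (v k))⁻¹ • v k : H) : 𝔤) h = v.repr h k := fun k ↦ by
      rw [ht]
      conv_lhs => rw [← v.sum_repr h]
      rw [map_sum, Finset.sum_eq_single k]
      · rw [map_smul, map_smul, LinearMap.smul_apply, smul_eq_mul, smul_eq_mul,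
          inv_mul_cancel₀ (hne k), mul_one]
      · intro j _ hj
        rw [map_smul, map_smul, LinearMap.smul_apply,
          show LieModule.traceForm ℂ H 𝔤 (v k) (v j) = 0 from hv hj.symm, smul_zero, smul_zero]
      · simp
    simp only [key]
    exact v.sum_repr h

variable (H) in
/-- A basis of the Cartan subalgebra. -/
def cartanBasis (k : Fin (Module.finrank ℂ H)) : H := (exists_dual_basis_cartan H).choose k

variable (H) in
/-- The dual basis of the Cartan subalgebra with respect to the Killing form. -/
def cartanDualBasis (k : Fin (Module.finrank ℂ H)) : H :=
  (exists_dual_basis_cartan H).choose_spec.choose k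

lemma cartanBasis_swap : ∑ k, (cartanBasis H k : 𝔤) ⊗ₜ[ℂ] (cartanDualBasis H k : 𝔤) =
    ∑ k, (cartanDualBasis H k : 𝔤) ⊗ₜ[ℂ] (cartanBasis H k : 𝔤) :=
  (exists_dual_basis_cartan H).choose_spec.choose_spec.1

lemma cartanBasis_expand (h : H) :
    ∑ k, killingForm ℂ 𝔤 (cartanDualBasis H k) h • (cartanBasis H k : 𝔤) = h := by
  have := congrArg Subtype.val ((exists_dual_basis_cartan H).choose_spec.choose_spec.2 h)
  rw [AddSubmonoidClass.coe_finsetSum] at this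
  exact this

lemma killing_hpart {h : 𝔤} (hh : h ∈ H) (u : 𝔤) :
    killingForm ℂ 𝔤 h (E.hpart u) = killingForm ℂ 𝔤 h u := by
  have h0 : ∀ α, killingForm ℂ 𝔤 h (E.e α) = 0 := fun α ↦ by
    rw [LieModule.traceForm_comm]
    have := E.coef_of_mem (negRoot α) hh
    rwa [RootVectors.coef, negRoot_negRoot] at this
  conv_rhs => rw [← E.hpart_add_sum u]
  simp [h0]

/-- The involution of the roots. -/
def negEquiv : Equiv.Perm H.root := Function.Involutive.toPerm negRoot negRoot_negRoot

lemma expand {u : 𝔤} (hu : u ∈ G.levi E) :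
    u = ∑ j : {α // α ∈ G.pos}, E.coef j u • E.e j +
      ∑ j : {α // α ∈ G.pos}, E.coef (negRoot j) u • E.e (negRoot j) +
      (∑ k, killingForm ℂ 𝔤 (cartanDualBasis H k) u • (cartanBasis H k : 𝔤) +
        ∑ j : {α // α ∈ G.zero}, E.coef j u • E.e j) := by
  classical
  have h1 : ∑ k, killingForm ℂ 𝔤 (cartanDualBasis H k) u • (cartanBasis H k : 𝔤) = E.hpart u := by
    refine Eq.trans ?_ (cartanBasis_expand ⟨E.hpart u, E.hpart_mem u⟩)
    exact Finset.sum_congr rfl fun k _ ↦ by rw [killing_hpart E (cartanDualBasis H k).2]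
  rw [h1, sum_subtype_eq_ite (· ∈ G.pos) fun j ↦ E.coef j u • E.e j,
    sum_subtype_eq_ite (· ∈ G.pos) fun j ↦ E.coef (negRoot j) u • E.e (negRoot j),
    sum_subtype_eq_ite (· ∈ G.zero) fun j ↦ E.coef j u • E.e j,
    ← Equiv.sum_comp negEquiv fun j ↦ if j ∈ G.pos then E.coef (negRoot j) u • E.e (negRoot j) else 0]
  conv_lhs => rw [← E.hpart_add_sum u]
  rw [add_left_comm, ← Finset.sum_add_distrib, ← Finset.sum_add_distrib]
  congr 1
  refine Finset.sum_congr rfl fun α _ ↦ ?_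
  change _ = _ + (if negRoot α ∈ G.pos then
    E.coef (negRoot (negRoot α)) u • E.e (negRoot (negRoot α)) else 0) + _
  rw [negRoot_negRoot]
  by_cases hα : α ∈ G.roots
  · have hα' := G.neg_mem α hα
    simp only [pos, zero, Set.mem_ofPred_eq, hα, hα', true_and, d_negRoot]
    rcases lt_trichotomy (G.d α) 0 with h | h | h
    · rw [if_neg (by omega), if_pos (by omega), if_neg (by omega)]; simp
    · rw [if_neg (by omega), if_neg (by omega), if_pos h]; simp
    · rw [if_pos h, if_neg (by omega), if_neg (by omega)]; simp
  · rw [E.mem_rootSub.1 hu α hα]; simp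

lemma expand_nil (n : G.nil E) :
    ∑ j : {α // α ∈ G.pos}, E.coef j (n : 𝔤) • (⟨E.e j, G.e_mem_nil E j.2⟩ : G.nil E) = n := by
  classical
  have hn := E.mem_rootSpan.1 n.2
  refine Subtype.ext ?_
  rw [AddSubmonoidClass.coe_finsetSum]
  change ∑ j : {α // α ∈ G.pos}, E.coef j (n : 𝔤) • E.e j = _
  rw [sum_subtype_eq_ite (· ∈ G.pos) fun j ↦ E.coef j (n : 𝔤) • E.e j]
  conv_rhs => rw [← E.hpart_add_sum (n : 𝔤), hn.1, zero_add]
  refine Finset.sum_congr rfl fun α _ ↦ ?_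
  split_ifs with h
  · rfl
  · rw [hn.2 α h, zero_smul]

lemma sum_zero_swap : ∑ α : {α // α ∈ G.zero}, E.e α ⊗ₜ[ℂ] E.e (negRoot α) =
    ∑ α : {α // α ∈ G.zero}, E.e (negRoot α) ⊗ₜ[ℂ] E.e α := by
  classical
  rw [sum_subtype_eq_ite (· ∈ G.zero) fun α ↦ E.e α ⊗ₜ[ℂ] E.e (negRoot α),
    sum_subtype_eq_ite (· ∈ G.zero) fun α ↦ E.e (negRoot α) ⊗ₜ[ℂ] E.e α,
    ← Equiv.sum_comp negEquiv]
  refine Finset.sum_congr rfl fun α _ ↦ ?_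
  change (if negRoot α ∈ G.zero then E.e (negRoot α) ⊗ₜ[ℂ] E.e (negRoot (negRoot α)) else 0) = _
  rw [negRoot_negRoot]
  refine if_congr ⟨fun h ↦ ⟨?_, ?_⟩, fun h ↦ ⟨G.neg_mem α h.1, ?_⟩⟩ rfl rfl
  · have := G.neg_mem _ h.1; rwa [negRoot_negRoot] at this
  · have := h.2; rw [d_negRoot] at this; omega
  · rw [d_negRoot, h.2, neg_zero]

/-- The parabolic decomposition of a graded set of roots. -/
def parabolicData : ParabolicData (killingForm ℂ 𝔤) (G.levi E) (G.nil E).incl {α // α ∈ G.pos}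
    (Fin (Module.finrank ℂ H) ⊕ {α // α ∈ G.zero}) where
  e i := ⟨E.e i, G.e_mem_nil E i.2⟩
  f i := E.e (negRoot i)
  x := Sum.elim (fun k ↦ cartanBasis H k) (fun α ↦ E.e α)
  x' := Sum.elim (fun k ↦ cartanDualBasis H k) (fun α ↦ E.e (negRoot α))
  symm u w := LieModule.traceForm_comm ℂ 𝔤 𝔤 u w
  inv u v w := LieModule.traceForm_apply_lie_apply ℂ 𝔤 𝔤 u v w
  mem_φ n := E.rootSpan_le (W := (G.levi E).toSubmodule)
    (fun α hα ↦ E.e_mem_rootSub.2 hα.1) n.2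
  mem_f i := E.e_mem_rootSub.2 (G.neg_mem i i.2.1)
  mem_x := by
    rintro (k | α)
    · exact E.mem_rootSub_of_mem (Subtype.property _)
    · exact E.e_mem_rootSub.2 α.2.1
  expand u hu := by
    have hc' : ∀ α : H.root, killingForm ℂ 𝔤 (E.e α) u = E.coef (negRoot α) u := fun α ↦ by
      rw [RootVectors.coef, negRoot_negRoot]
    rw [Fintype.sum_sum_type]
    have h := G.expand E hu
    simp only [← hc'] at h
    exact h
  expand_φ n := G.expand_nil E n
  swap := by
    simp only [Fintype.sum_sum_type, Sum.elim_inl, Sum.elim_inr, cartanBasis_swap,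
      G.sum_zero_swap E]
  lie_e_f i j := by
    refine E.coef_of_mem j ?_
    rw [LieSubalgebra.coe_incl, ← lie_skew]
    exact H.neg_mem (E.lie_e_e_negRoot_mem i)

end GradedRoots

end GradedRoots

/-! ### Equivariant projections and eigenvalues of the Casimir operator. -/

section Components

open LieAlgebra LieAlgebra.IsKilling LieModule

variable {𝔤 : Type*} [LieRing 𝔤] [LieAlgebra ℂ 𝔤] [FiniteDimensional ℂ 𝔤] [IsKilling ℂ 𝔤]
  {H : LieSubalgebra ℂ 𝔤} [H.IsCartanSubalgebra]

lemma exists_root_apply_ne_zero (γ : H.root) : ∃ h : H, γ.1 h ≠ 0 := by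
  by_contra! h0
  exact LieSubalgebra.isNonZero_coe_root γ (funext h0)

namespace RootVectors

variable (E : RootVectors H)

/-- The components of an element in the Cartan subalgebra and in the root spaces. -/
def component : Option H.root → 𝔤 →ₗ[ℂ] 𝔤
  | none => E.hpart
  | some α => (E.coef α).smulRight (E.e α)

/-- The weights of the components. -/
def _root_.Seaweed.weightAt (h : H) : Option H.root → ℂ
  | none => 0
  | some α => α.1 h

lemma component_lie (k : Option H.root) (h : H) (x : 𝔤) :
    E.component k ⁅(h : 𝔤), x⁆ = weightAt h k • E.component k x := by
  cases k with
  | none => simp [component, weightAt, E.hpart_lie h.2]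
  | some α => simp [component, weightAt, E.coef_lie h.2, mul_smul]

lemma eq_zero_of_component {x : 𝔤} (h : ∀ k, E.component k x = 0) : x = 0 := by
  rw [← E.hpart_add_sum x, show E.hpart x = 0 from h none, zero_add]
  exact Finset.sum_eq_zero fun α _ ↦ h (some α)

lemma coef_eq_zero_of_component {x : 𝔤} {α : H.root} (h : E.component (some α) x = 0) :
    E.coef α x = 0 :=
  (smul_eq_zero.1 h).resolve_right (E.e_ne_zero α)

lemma eq_smul_of_lie {γ : H.root} {x : 𝔤} (h : ∀ t : H, ⁅(t : 𝔤), x⁆ = γ.1 t • x) :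
    x = E.coef γ x • E.e γ := by
  have key : ∀ k (t : H), weightAt t k • E.component k x = γ.1 t • E.component k x :=
    fun k t ↦ by rw [← component_lie, h, map_smul]
  refine E.ext ?_ fun α ↦ ?_
  · obtain ⟨t, ht⟩ := exists_root_apply_ne_zero γ
    have := key none t
    rw [weightAt, zero_smul, eq_comm] at this
    rw [map_smul, E.hpart_e, smul_zero]
    exact (smul_eq_zero.1 this).resolve_left ht
  · by_cases hα : α = γ
    · rw [hα, map_smul, E.coef_e_self, smul_eq_mul, mul_one]
    · rw [map_smul, E.coef_e_of_ne (Ne.symm hα), smul_zero]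
      obtain ⟨t, ht⟩ : ∃ t : H, α.1 t ≠ γ.1 t := by
        by_contra! h0
        exact hα (root_ext h0)
      have := key (some α) t
      rw [weightAt, ← sub_eq_zero, ← sub_smul] at this
      exact E.coef_eq_zero_of_component
        ((smul_eq_zero.1 this).resolve_left (sub_ne_zero.2 ht))

/-- The projection onto the subspace attached to a set of roots. -/
def rootProj (Φ : Set H.root) : 𝔤 →ₗ[ℂ] 𝔤 := by
  classical
  exact LinearMap.id - ∑ α, if α ∈ Φ then 0 else (E.coef α).smulRight (E.e α)

lemma rootProj_of_mem {Φ : Set H.root} {x : 𝔤} (hx : x ∈ E.rootSub Φ) : E.rootProj Φ x = x := by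
  classical
  rw [rootProj, LinearMap.sub_apply, LinearMap.sum_apply, Finset.sum_eq_zero, sub_zero,
    LinearMap.id_apply]
  intro α _
  split_ifs with h
  · rfl
  · rw [LinearMap.smulRight_apply, E.mem_rootSub.1 hx α h, zero_smul]

lemma sub_rootProj_mem (Φ : Set H.root) (x : 𝔤) : x - E.rootProj Φ x ∈ E.rootSpan Φᶜ := by
  classical
  rw [rootProj, LinearMap.sub_apply, LinearMap.id_apply, sub_sub_cancel, LinearMap.sum_apply]
  refine Submodule.sum_mem _ fun α _ ↦ ?_
  split_ifs with h
  · exact Submodule.zero_mem _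
  · exact Submodule.smul_mem _ _ (E.e_mem_rootSpan.2 h)

lemma rootProj_mem (Φ : Set H.root) (x : 𝔤) : E.rootProj Φ x ∈ E.rootSub Φ := by
  classical
  refine E.mem_rootSub.2 fun α hα ↦ ?_
  rw [rootProj, LinearMap.sub_apply, LinearMap.id_apply, LinearMap.sum_apply, map_sub, map_sum,
    Finset.sum_eq_single α, if_neg hα, LinearMap.smulRight_apply, map_smul, E.coef_e_self,
    smul_eq_mul, mul_one, sub_self]
  · intro β _ hβ
    split_ifs with h
    · simp
    · rw [LinearMap.smulRight_apply, map_smul, E.coef_e_of_ne hβ, smul_zero]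
  · simp

lemma rootProj_of_mem_rootSpan_compl {Φ : Set H.root} {x : 𝔤} (hx : x ∈ E.rootSpan Φᶜ) :
    E.rootProj Φ x = 0 := by
  have h1 := Submodule.sub_mem _ hx (E.sub_rootProj_mem Φ x)
  rw [sub_sub_cancel, E.mem_rootSpan] at h1
  have h2 := E.mem_rootSub.1 (E.rootProj_mem Φ x)
  refine E.ext (by rw [h1.1, map_zero]) fun α ↦ ?_
  rw [map_zero]
  by_cases hα : α ∈ Φ
  · exact h1.2 α (not_not.2 hα)
  · exact h2 α hα

end RootVectors

namespace GradedRoots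

variable (G : GradedRoots H) (E : RootVectors H)

/-- As `G.roots` is closed and symmetric, adding one of its roots to a root outside never leads
inside. The complementary root spaces therefore form a submodule. -/
lemma rootProj_lie {u : 𝔤} (hu : u ∈ G.levi E) (x : 𝔤) :
    E.rootProj G.roots ⁅u, x⁆ = ⁅u, E.rootProj G.roots x⁆ := by
  have h1 : ⁅u, E.rootProj G.roots x⁆ ∈ E.rootSub G.roots :=
    E.lie_mem_rootSub G.closed hu (E.rootProj_mem _ _)
  have h2 : ⁅u, x - E.rootProj G.roots x⁆ ∈ E.rootSpan G.rootsᶜ :=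
    E.lie_mem_rootSpan_of_mem_rootSub (Φ := G.roots) (Ψ := G.rootsᶜ) (fun α hα β hβ γ h hγ ↦ hβ
        (G.closed γ hγ (negRoot α) (G.neg_mem α hα) β fun x ↦ by
          rw [negRoot_apply, h]; ring))
      (fun α hα h ↦ h (G.neg_mem α hα)) hu (E.sub_rootProj_mem _ _)
  have h3 := E.rootProj_of_mem_rootSpan_compl h2
  rw [lie_sub, map_sub, E.rootProj_of_mem h1, sub_eq_zero] at h3
  exact h3

/-- The element `⁅e α, e (-α)⁆` is a multiple of the coroot. -/
lemma _root_.Seaweed.RootVectors.exists_coroot_eq_smul (γ : H.root) :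
    ∃ s : ℂ, (coroot γ.1 : 𝔤) = s • ⁅E.e γ, E.e (negRoot γ)⁆ := by
  have := lie_eq_killingForm_smul_of_mem_rootSpace_of_mem_rootSpace_neg (E.mem γ)
    (E.mem (negRoot γ))
  rw [E.killing, one_smul] at this
  refine ⟨(2 : ℂ) * (γ.1 ((cartanEquivDual H).symm γ.1.toLinear))⁻¹, ?_⟩
  rw [this, coroot, mul_smul, two_smul, two_smul]
  rfl

lemma x'_mem (k) : (G.parabolicData E).x' k ∈ E.rootSub G.zero := by
  rcases k with k | α
  · exact E.mem_rootSub_of_mem (Subtype.property _)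
  · exact E.e_mem_rootSub.2 ⟨G.neg_mem _ α.2.1, by rw [d_negRoot, α.2.2, neg_zero]⟩

lemma x_mem (k) : (G.parabolicData E).x k ∈ E.rootSub G.zero := by
  rcases k with k | α
  · exact E.mem_rootSub_of_mem (Subtype.property _)
  · exact E.e_mem_rootSub.2 α.2

lemma tr_mem : (G.parabolicData E).tr ∈ H :=
  H.toSubmodule.sum_mem fun i _ ↦ E.lie_e_e_negRoot_mem i

lemma rootSub_zero_le {u : 𝔤} (hu : u ∈ E.rootSub G.zero) : u ∈ G.levi E :=
  E.mem_rootSub.2 fun α hα ↦ E.mem_rootSub.1 hu α fun h ↦ hα h.1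

lemma casimir_lie {u : 𝔤} (hu : u ∈ G.levi E) (x : 𝔤) :
    (G.parabolicData E).casimir 𝔤 ⁅u, x⁆ = ⁅u, (G.parabolicData E).casimir 𝔤 x⁆ :=
  (G.parabolicData E).casimir_lie (fun k ↦ G.rootSub_zero_le E (G.x'_mem E k)) hu x

lemma killing_lie_lie_e (h : H) (α : H.root) :
    killingForm ℂ 𝔤 ⁅E.e α, ⁅E.e (negRoot α), (h : 𝔤)⁆⁆ h = α.1 h ^ 2 := by
  have h1 : ⁅E.e (negRoot α), (h : 𝔤)⁆ = α.1 h • E.e (negRoot α) := by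
    rw [← lie_skew, E.lie_e h.2, Subtype.coe_eta, negRoot_apply, neg_smul, neg_neg]
  have h2 : ⁅E.e α, (h : 𝔤)⁆ = -(α.1 h • E.e α) := by
    rw [← lie_skew, E.lie_e h.2, Subtype.coe_eta]
  have h3 : killingForm ℂ 𝔤 (E.e (negRoot α)) (E.e α) = 1 := E.coef_e_self α
  rw [← lie_skew, map_neg, LinearMap.neg_apply, LieModule.traceForm_apply_lie_apply, h1, h2,
    map_neg, neg_neg, map_smul, map_smul, LinearMap.smul_apply, h3]
  simp [sq]

/-- For `h` in the Cartan subalgebra, pairing the Casimir image of `h` with `h` gives the sum of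
`α(h)²` over the roots of `G`. At the coroot of `γ` these are squares of integers, and the term of
`γ` is `4`. -/
lemma casimir_cartan_ne_zero {γ : H.root} (hγ : γ ∈ G.pos) :
    (G.parabolicData E).casimir 𝔤 (coroot γ.1 : 𝔤) ≠ 0 := by
  classical
  intro h0
  have h1 := congrArg (fun x ↦ killingForm ℂ 𝔤 x (coroot γ.1 : 𝔤)) h0
  have hk : ∀ α : H.root, ∃ m : ℤ, α.1 (coroot γ.1) = m := fun α ↦
    ⟨_, apply_coroot_eq_cast' γ.1 α.1⟩
  choose m hm using hk
  have h2 : ∀ k, killingForm ℂ 𝔤 ⁅((cartanBasis H k : H) : 𝔤),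
      ⁅((cartanDualBasis H k : H) : 𝔤), (coroot γ.1 : 𝔤)⁆⁆ (coroot γ.1) = 0 := fun k ↦ by
    rw [cartan_lie_eq_zero (cartanDualBasis H k).2 (coroot γ.1).2, lie_zero, map_zero,
      LinearMap.zero_apply]
  have h3 : ∀ α : H.root, killingForm ℂ 𝔤 ⁅E.e (negRoot α), ⁅E.e α, (coroot γ.1 : 𝔤)⁆⁆
      (coroot γ.1) = (m α : ℂ) ^ 2 := fun α ↦ by
    have := killing_lie_lie_e E (coroot γ.1) (negRoot α)
    rw [negRoot_negRoot, negRoot_apply, neg_sq, hm] at this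
    exact this
  rw [ParabolicData.casimir_apply] at h1
  simp only [parabolicData, Fintype.sum_sum_type, Sum.elim_inl, Sum.elim_inr, map_add, map_sum,
    LinearMap.add_apply, LinearMap.sum_apply, map_zero, LinearMap.zero_apply, h2,
    LieSubalgebra.coe_incl, killing_lie_lie_e E, h3, hm, Finset.sum_const_zero, zero_add] at h1
  have h4 : ∑ α : {α // α ∈ G.zero}, m α ^ 2 + ∑ α : {α // α ∈ G.pos}, m α ^ 2 +
      ∑ α : {α // α ∈ G.pos}, m α ^ 2 = 0 := by exact_mod_cast h1
  have h5 : 0 < ∑ α : {α // α ∈ G.pos}, m α ^ 2 := by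
    refine Finset.sum_pos' (fun α _ ↦ sq_nonneg _) ⟨⟨γ, hγ⟩, Finset.mem_univ _, ?_⟩
    have : m γ = 2 := by
      have h := hm γ
      rw [root_apply_coroot (LieSubalgebra.isNonZero_coe_root γ)] at h
      exact_mod_cast h.symm
    simp [this]
  have h6 : 0 ≤ ∑ α : {α // α ∈ G.zero}, m α ^ 2 := Finset.sum_nonneg fun α _ ↦ sq_nonneg _
  omega

/-- Commuting with `H` makes `e γ` an eigenvector. If the eigenvalue were zero, commuting with `e
(-γ)` would annihilate the coroot, a multiple of `⁅e γ, e (-γ)⁆`. -/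
lemma exists_casimir_e {γ : H.root} (hγ : γ ∈ G.pos) :
    ∃ c : ℂ, c ≠ 0 ∧ (G.parabolicData E).casimir 𝔤 (E.e γ) = c • E.e γ := by
  have h1 := E.eq_smul_of_lie (γ := γ) (x := (G.parabolicData E).casimir 𝔤 (E.e γ)) fun t ↦ by
    rw [← G.casimir_lie E (E.mem_rootSub_of_mem t.2), E.lie_e t.2, map_smul]
  refine ⟨_, fun h0 ↦ ?_, h1⟩
  rw [h0, zero_smul] at h1
  refine G.casimir_cartan_ne_zero E hγ ?_
  obtain ⟨s, hs⟩ := E.exists_coroot_eq_smul γ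
  rw [hs, ← lie_skew, map_smul, map_neg,
    G.casimir_lie E (E.e_mem_rootSub.2 (G.neg_mem γ hγ.1)), h1, lie_zero, neg_zero, smul_zero]

end GradedRoots

end Components

/-! ### Cocycles of degree at least two on the nilradical of a parabolic. -/

section Vanishing

open LieAlgebra LieAlgebra.IsKilling LieModule

variable {𝔤 : Type*} [LieRing 𝔤] [LieAlgebra ℂ 𝔤] [FiniteDimensional ℂ 𝔤] [IsKilling ℂ 𝔤]
  {H : LieSubalgebra ℂ 𝔤} [H.IsCartanSubalgebra]

namespace GradedRoots

variable (G : GradedRoots H) (E : RootVectors H) {q : ℕ}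

lemma lie_mem_nil {y : 𝔤} (hy : y ∈ E.rootSub G.zero) {x : 𝔤} (hx : x ∈ E.rootSpan G.pos) :
    ⁅y, x⁆ ∈ E.rootSpan G.pos :=
  E.lie_mem_rootSpan_of_mem_rootSub (Φ := G.zero) (Ψ := G.pos)
    (fun α hα β hβ γ h ↦ ⟨G.closed α hα.1 β hβ.1 γ h, by
      rw [G.d_add h, hα.2, zero_add]; exact hβ.2⟩)
    (fun α hα h ↦ by
      have := h.2
      rw [d_negRoot, hα.2] at this
      omega) hy hx

lemma coe_proj_of_mem {x : 𝔤} (hx : x ∈ E.rootSpan G.pos) :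
    ((G.parabolicData E).proj x : 𝔤) = x :=
  congrArg Subtype.val ((G.parabolicData E).proj_φ ⟨x, hx⟩)

lemma coe_pad {y : 𝔤} (hy : y ∈ E.rootSub G.zero) (n : G.nil E) :
    ((G.parabolicData E).pad y n : 𝔤) = ⁅y, (n : 𝔤)⁆ :=
  G.coe_proj_of_mem E (G.lie_mem_nil E hy n.2)

/-- The action of the nilpotent subalgebra on the ambient Lie algebra. -/
abbrev nilAct : G.nil E →ₗ[ℂ] Module.End ℂ 𝔤 := ParabolicData.act 𝔤 (G.nil E).incl

lemma lieD_diff {y : 𝔤} (hy : y ∈ E.rootSub G.zero) (f : G.nil E [⋀^Fin q]→ₗ[ℂ] 𝔤) :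
    (G.parabolicData E).lieD y (diff (G.nilAct E) f) =
      diff (G.nilAct E) ((G.parabolicData E).lieD y f) := by
  refine lieDer_diff_comm _ _ _ (fun n ↦ ?_) (fun m n ↦ ?_) f
  · ext x
    change ⁅y, ⁅(n : 𝔤), x⁆⁆ - ⁅(n : 𝔤), ⁅y, x⁆⁆ = ⁅((G.parabolicData E).pad y n : 𝔤), x⁆
    rw [G.coe_pad E hy, lie_lie]
  · refine Subtype.ext ?_
    change ((G.parabolicData E).pad y ⁅m, n⁆ : 𝔤) = ⁅((G.parabolicData E).pad y m : 𝔤), (n : 𝔤)⁆ +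
      ⁅(m : 𝔤), ((G.parabolicData E).pad y n : 𝔤)⁆
    rw [G.coe_pad E hy, G.coe_pad E hy, G.coe_pad E hy]
    exact leibniz_lie y (m : 𝔤) (n : 𝔤)

lemma x_mem_zero : (G.x : 𝔤) ∈ E.rootSub G.zero := E.mem_rootSub_of_mem G.x.2

lemma pad_x_e (i : {α // α ∈ G.pos}) :
    (G.parabolicData E).pad G.x ((G.parabolicData E).e i) =
      (G.d i : ℂ) • (G.parabolicData E).e i := by
  refine Subtype.ext ?_
  rw [G.coe_pad E (G.x_mem_zero E)]
  change ⁅(G.x : 𝔤), E.e i⁆ = (G.d i : ℂ) • E.e i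
  rw [E.lie_e G.x.2, Subtype.coe_eta, G.apply_x]

lemma lieD_x_eq_zero_of_sq (f : G.nil E [⋀^Fin q]→ₗ[ℂ] 𝔤)
    (hf : (G.parabolicData E).lieD G.x ((G.parabolicData E).lieD G.x f) = 0) :
    (G.parabolicData E).lieD G.x f = 0 :=
  lieDer_eq_zero_of_sq (G.expand_nil E) (G.pad_x_e E)
    (fun k w ↦ E.component_lie k G.x w) (fun _ ↦ E.eq_zero_of_component) f hf

/-- An invariant cocycle becomes a coboundary after composition with the Casimir operator. -/
lemma exists_diff_eq_casimir (f : G.nil E [⋀^Fin (q + 1)]→ₗ[ℂ] 𝔤)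
    (hf : diff (G.nilAct E) f = 0)
    (hy : ∀ y ∈ E.rootSub G.zero, ∃ g, diff (G.nilAct E) g = (G.parabolicData E).lieD y f) :
    ∃ g, diff (G.nilAct E) g = post ((G.parabolicData E).casimir 𝔤) f := by
  have h := (G.parabolicData E).diff_codiff_add_codiff_diff (V := 𝔤) f
  rw [show diff (ParabolicData.act 𝔤 (G.nil E).incl) f = 0 from hf, map_zero, add_zero,
    ParabolicData.laplace_apply, sub_sub, eq_sub_iff_add_eq] at h
  suffices h' : post ((G.parabolicData E).casimir 𝔤) f ∈ LinearMap.range (diff (G.nilAct E)) from h'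
  rw [← h]
  refine Submodule.add_mem _ ⟨_, map_smul _ _ _⟩ (Submodule.add_mem _ (Submodule.sum_mem _
    fun k _ ↦ ?_) (hy _ (E.mem_rootSub_of_mem (G.tr_mem E))))
  obtain ⟨g, hg⟩ := hy _ (G.x'_mem E k)
  exact ⟨_, by rw [← hg, G.lieD_diff E (G.x_mem E k)]⟩

lemma mem_of_apply_e_mem {W : Submodule ℂ 𝔤} {f : G.nil E [⋀^Fin q]→ₗ[ℂ] 𝔤}
    (h : ∀ v : Fin q → {α // α ∈ G.pos}, f ((G.parabolicData E).e ∘ v) ∈ W) (v) : f v ∈ W := by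
  have := ext_of_span (G.expand_nil E) (f := W.mkQ.compAlternatingMap f) (g := 0)
    fun v ↦ (Submodule.Quotient.mk_eq_zero W).2 (h v)
  exact (Submodule.Quotient.mk_eq_zero W).1 (congrArg (fun F ↦ F v) this)

/-- With at least one argument the total degree of the arguments is positive, and a cochain of
weight zero preserves it; after projection to the roots of `G`, only roots of positive degree
remain. In degree zero this fails, which excludes `1`-cocycles from `exists_diff_eq`. -/
lemma rootProj_mem_of_lieD_eq_zero (f : G.nil E [⋀^Fin (q + 1)]→ₗ[ℂ] 𝔤)
    (hf : (G.parabolicData E).lieD G.x f = 0) (v) :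
    E.rootProj G.roots (f v) ∈ E.rootSpan G.pos := by
  refine G.mem_of_apply_e_mem E (f := (E.rootProj G.roots).compAlternatingMap f) (fun v ↦ ?_) v
  change E.rootProj G.roots (f _) ∈ _
  have key : ∀ k, (weightAt G.x k - ∑ j, (G.d (v j) : ℂ)) •
      E.component k (f ((G.parabolicData E).e ∘ v)) = 0 := fun k ↦ by
    rw [← apply_lieDer_of_eigen (T := LieModule.toEnd ℂ 𝔤 𝔤 (G.x : 𝔤)) (fun w ↦ E.component_lie k G.x w) (G.pad_x_e E) f v]
    have : lieDer (LieModule.toEnd ℂ 𝔤 𝔤 (G.x : 𝔤)) ((G.parabolicData E).pad G.x) f = 0 := hf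
    rw [this, AlternatingMap.zero_apply, map_zero]
  have hpos : 0 < ∑ j, G.d (v j) :=
    Finset.sum_pos (fun j _ ↦ (v j).2.2) Finset.univ_nonempty
  have h0 := E.sub_rootProj_mem G.roots (f ((G.parabolicData E).e ∘ v))
  have h1 := E.mem_rootSub.1 (E.rootProj_mem G.roots (f ((G.parabolicData E).e ∘ v)))
  rw [E.mem_rootSpan] at h0 ⊢
  refine ⟨?_, fun α hα ↦ ?_⟩
  · have h2 := (smul_eq_zero.1 (key none)).resolve_left (by
      rw [weightAt, zero_sub, neg_eq_zero]
      exact_mod_cast hpos.ne')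
    have h3 := h0.1
    rw [map_sub, show E.hpart _ = 0 from h2, zero_sub, neg_eq_zero] at h3
    exact h3
  · by_cases hα' : α ∈ G.roots
    · have h2 := (smul_eq_zero.1 (key (some α))).resolve_left (by
        rw [weightAt, G.apply_x, sub_eq_zero]
        have : ¬ 0 < G.d α := fun h ↦ hα ⟨hα', h⟩
        have : G.d α ≠ ∑ j, G.d (v j) := by omega
        exact_mod_cast this)
      have h3 := h0.2 α (not_not.2 hα')
      rw [map_sub, E.coef_eq_zero_of_component h2, zero_sub, neg_eq_zero] at h3
      exact h3
    · exact h1 α hα'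

/-- The Casimir operator on the nilpotent subalgebra. -/
def nilCasimir : Module.End ℂ (G.nil E) :=
  (G.parabolicData E).proj ∘ₗ (G.parabolicData E).casimir 𝔤 ∘ₗ (G.nil E).toSubmodule.subtype

lemma casimir_mem {x : 𝔤} (hx : x ∈ E.rootSpan G.pos) :
    (G.parabolicData E).casimir 𝔤 x ∈ E.rootSpan G.pos := by
  refine E.rootSpan_le (W := (E.rootSpan G.pos).comap ((G.parabolicData E).casimir 𝔤))
    (fun α hα ↦ ?_) hx
  obtain ⟨c, -, hc⟩ := G.exists_casimir_e E hα
  rw [Submodule.mem_comap, hc]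
  exact Submodule.smul_mem _ _ (E.e_mem_rootSpan.2 hα)

lemma coe_nilCasimir (n : G.nil E) :
    (G.nilCasimir E n : 𝔤) = (G.parabolicData E).casimir 𝔤 (n : 𝔤) :=
  G.coe_proj_of_mem E (G.casimir_mem E n.2)

lemma mem_levi_of_mem_nil (n : G.nil E) : (n : 𝔤) ∈ G.levi E := (G.parabolicData E).mem_φ n

lemma nilCasimir_lie (m n : G.nil E) : G.nilCasimir E ⁅m, n⁆ = ⁅m, G.nilCasimir E n⁆ := by
  refine Subtype.ext ?_
  rw [coe_nilCasimir, LieSubalgebra.coe_bracket, LieSubalgebra.coe_bracket, coe_nilCasimir,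
    G.casimir_lie E (G.mem_levi_of_mem_nil E m)]

lemma nilCasimir_injective : Function.Injective (G.nilCasimir E) := by
  rw [injective_iff_map_eq_zero]
  intro n hn
  have h0 : (G.parabolicData E).casimir 𝔤 (n : 𝔤) = 0 := by
    rw [← coe_nilCasimir, hn]; rfl
  have hn' := E.mem_rootSpan.1 n.2
  have key : ∀ α, E.coef α ((G.parabolicData E).casimir 𝔤 (n : 𝔤)) = 0 := fun α ↦ by
    rw [h0, map_zero]
  refine Subtype.ext (E.ext (by rw [hn'.1]; exact (map_zero _).symm) fun α ↦ ?_)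
  change _ = E.coef α 0
  rw [map_zero]
  by_cases hα : α ∈ G.pos
  · obtain ⟨c, hc, hc'⟩ := G.exists_casimir_e E hα
    have h := key α
    rw [← E.hpart_add_sum (n : 𝔤), hn'.1, zero_add, map_sum, map_sum,
      Finset.sum_eq_single α, map_smul, map_smul, hc', map_smul, E.coef_e_self] at h
    · simpa [hc] using h
    · intro β _ hβ
      by_cases hβ' : β ∈ G.pos
      · obtain ⟨c', -, hc''⟩ := G.exists_casimir_e E hβ'
        rw [map_smul, map_smul, hc'', map_smul, E.coef_e_of_ne hβ, smul_zero, smul_zero]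
      · rw [hn'.2 β hβ', zero_smul, map_zero, map_zero]
    · simp
  · exact hn'.2 α hα

/-- Cocycles of degree at least two with values in the nilpotent subalgebra are coboundaries when
they are invariant modulo coboundaries. -/
theorem exists_diff_eq (f : G.nil E [⋀^Fin (q + 2)]→ₗ[ℂ] 𝔤)
    (hN : ∀ v, f v ∈ E.rootSpan G.pos) (hf : diff (G.nilAct E) f = 0)
    (hx : (G.parabolicData E).lieD G.x f = 0)
    (hy : ∀ y ∈ E.rootSub G.zero, ∃ g, diff (G.nilAct E) g = (G.parabolicData E).lieD y f) :
    ∃ g, diff (LieAlgebra.ad ℂ (G.nil E) : G.nil E →ₗ[ℂ] Module.End ℂ (G.nil E)) g =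
      pull (G.parabolicData E).proj LinearMap.id f := by
  obtain ⟨g₁, hg₁⟩ := G.exists_diff_eq_casimir E f hf hy
  have hxC : (G.parabolicData E).lieD G.x (post ((G.parabolicData E).casimir 𝔤) f) = 0 := by
    have := lieDer_pull ((G.parabolicData E).casimir 𝔤) LinearMap.id
      (T := LieModule.toEnd ℂ 𝔤 𝔤 (G.x : 𝔤)) (T' := LieModule.toEnd ℂ 𝔤 𝔤 (G.x : 𝔤))
      (A := (G.parabolicData E).pad G.x) (A' := (G.parabolicData E).pad G.x)
      (fun w ↦ G.casimir_lie E (E.mem_rootSub_of_mem G.x.2) w) (fun _ ↦ rfl) f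
    refine this.trans ?_
    rw [show lieDer (LieModule.toEnd ℂ 𝔤 𝔤 (G.x : 𝔤)) ((G.parabolicData E).pad G.x) f = 0 from hx]
    ext v
    simp
  -- The primitive `g₁` is corrected by a cocycle so that the grading element annihilates it. The
  -- stable subspace is the kernel of the differential, which contains `x · g₁` because the Casimir
  -- image of `f` has weight zero.
  obtain ⟨g₂, hg₂, hxg⟩ := exists_sub_mem_and_forall_eq_zero (Finset.univ : Finset Unit)
    (fun _ ↦ ((G.parabolicData E).lieD G.x :
      (G.nil E [⋀^Fin (q + 1)]→ₗ[ℂ] 𝔤) →ₗ[ℂ] G.nil E [⋀^Fin (q + 1)]→ₗ[ℂ] 𝔤))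
    (fun _ w hw ↦ G.lieD_x_eq_zero_of_sq E w hw) (fun _ _ _ ↦ rfl)
    (LinearMap.ker (diff (G.nilAct E)))
    (fun _ w hw ↦ by
      rw [LinearMap.mem_ker] at hw ⊢
      rw [← G.lieD_diff E (G.x_mem_zero E), hw, map_zero]) g₁
    (fun _ _ ↦ by rw [LinearMap.mem_ker, ← G.lieD_diff E (G.x_mem_zero E), hg₁, hxC])
  rw [LinearMap.mem_ker, map_sub, sub_eq_zero] at hg₂
  have hxg := hxg () (Finset.mem_univ _)
  have hval := G.rootProj_mem_of_lieD_eq_zero E g₂ hxg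
  -- The projection is equivariant and fixes the values of the Casimir image of `f`, so `g₃` is
  -- still a primitive; its values now lie in the nilradical.
  let g₃ : G.nil E [⋀^Fin (q + 1)]→ₗ[ℂ] 𝔤 := pull (E.rootProj G.roots) LinearMap.id g₂
  have hg₃ : diff (G.nilAct E) g₃ = post ((G.parabolicData E).casimir 𝔤) f := by
    rw [diff_pull (E.rootProj G.roots) LinearMap.id (a := G.nilAct E)
      (a' := G.nilAct E) (fun n w ↦ G.rootProj_lie E (G.mem_levi_of_mem_nil E n) w) (fun _ _ ↦ rfl), ← hg₂, hg₁]
    ext v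
    exact E.rootProj_of_mem (E.rootSub_le (fun h hh ↦ E.mem_rootSub_of_mem hh)
      (fun α hα ↦ E.e_mem_rootSub.2 hα) (E.mem_rootSub.2 fun α hα ↦
        (E.mem_rootSpan.1 (G.casimir_mem E (hN _))).2 α fun h ↦ hα h.1))
  -- On the nilradical the Casimir operator is invertible and commutes with brackets, so it can be
  -- removed from both sides.
  let C : G.nil E ≃ₗ[ℂ] G.nil E := LinearEquiv.ofInjectiveEndo _ (G.nilCasimir_injective E)
  have hC : ∀ n, C n = G.nilCasimir E n := fun n ↦ rfl
  let g₄ : G.nil E [⋀^Fin (q + 1)]→ₗ[ℂ] G.nil E :=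
    pull (G.parabolicData E).proj LinearMap.id g₃
  have hg₄ : pull (G.nil E).toSubmodule.subtype LinearMap.id g₄ = g₃ := by
    ext v
    exact G.coe_proj_of_mem E (hval _)
  have hd : diff (LieAlgebra.ad ℂ (G.nil E) : G.nil E →ₗ[ℂ] Module.End ℂ (G.nil E)) g₄ =
      pull (G.nilCasimir E) LinearMap.id (pull (G.parabolicData E).proj LinearMap.id f) := by
    ext v
    have h1 := diff_pull (G.nil E).toSubmodule.subtype LinearMap.id
      (a := (LieAlgebra.ad ℂ (G.nil E) : G.nil E →ₗ[ℂ] Module.End ℂ (G.nil E)))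
      (a' := G.nilAct E) (fun n w ↦ rfl) (fun _ _ ↦ rfl) g₄
    rw [hg₄, hg₃] at h1
    have h2 := congrArg (fun F ↦ F v) h1
    rw [pull_apply, pull_apply, coe_nilCasimir]
    refine h2.symm.trans ?_
    exact congrArg ((G.parabolicData E).casimir 𝔤) (G.coe_proj_of_mem E (hN v)).symm
  refine ⟨pull (C.symm : G.nil E →ₗ[ℂ] G.nil E) LinearMap.id g₄, ?_⟩
  rw [diff_pull (C.symm : G.nil E →ₗ[ℂ] G.nil E) LinearMap.id
    (a := (LieAlgebra.ad ℂ (G.nil E) : G.nil E →ₗ[ℂ] Module.End ℂ (G.nil E)))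
    (fun m n ↦ ?_) (fun _ _ ↦ rfl), hd]
  · ext v
    rw [pull_apply, pull_apply]
    exact congrArg Subtype.val (C.symm_apply_apply _)
  · change C.symm ⁅m, n⁆ = ⁅m, C.symm n⁆
    rw [LinearEquiv.symm_apply_eq, hC, nilCasimir_lie, ← hC, LinearEquiv.apply_symm_apply]

end GradedRoots

end Vanishing

/-! ### Representatives annihilated by the Cartan subalgebra. -/

section Normalization

open LieAlgebra LieAlgebra.IsKilling LieModule

variable {𝔤 : Type*} [LieRing 𝔤] [LieAlgebra ℂ 𝔤] [FiniteDimensional ℂ 𝔤] [IsKilling ℂ 𝔤]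
  {H : LieSubalgebra ℂ 𝔤} [H.IsCartanSubalgebra]

/-- The action of `x` on cochains. -/
abbrev cochainAct {K L : Type*} [Field K] [LieRing L] [LieAlgebra K L] (n : LieIdeal K L)
    {M : Type*} [AddCommGroup M] [Module K M] [LieRingModule L M] [LieModule K L M] {q : ℕ}
    (x : L) : Cochain n M q →ₗ[K] Cochain n M q :=
  lieDer (LieModule.toEnd K L M x) (idealAd n x)

lemma cochainAct_lie {K L : Type*} [Field K] [LieRing L] [LieAlgebra K L] (n : LieIdeal K L)
    {M : Type*} [AddCommGroup M] [Module K M] [LieRingModule L M] [LieModule K L M] {q : ℕ}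
    {x y : L} (h : ⁅x, y⁆ = 0) (f : Cochain n M q) :
    cochainAct n x (cochainAct n y f) = cochainAct n y (cochainAct n x f) := by
  rw [← sub_eq_zero, lieDer_lieDer_comm]
  have h1 : LieModule.toEnd K L M x * LieModule.toEnd K L M y -
      LieModule.toEnd K L M y * LieModule.toEnd K L M x = 0 := by
    ext m
    change ⁅x, ⁅y, m⁆⁆ - ⁅y, ⁅x, m⁆⁆ = 0
    rw [← lie_lie, h, zero_lie]
  have h2 : idealAd n x * idealAd n y - idealAd n y * idealAd n x = 0 := by
    refine LinearMap.ext fun m ↦ ?_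
    change ⁅x, ⁅y, m⁆⁆ - ⁅y, ⁅x, m⁆⁆ = 0
    rw [← lie_lie, h, zero_lie]
  rw [h1, h2, lieDer_apply, map_zero, map_zero, LinearMap.zero_apply,
    sub_self]

/-- The subalgebra `𝔰` and its ideal `𝔫` are sums of root spaces. -/
structure IsRootIdeal (E : RootVectors H) (𝔰 : LieSubalgebra ℂ 𝔤) (𝔫 : LieIdeal ℂ 𝔰)
    (S R : Set H.root) : Prop where
  mem_iff : ∀ x, x ∈ 𝔰 ↔ x ∈ E.rootSub S
  mem_ideal_iff : ∀ x : 𝔰, x ∈ 𝔫 ↔ (x : 𝔤) ∈ E.rootSpan R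
  subset : R ⊆ S

namespace IsRootIdeal

variable {E : RootVectors H} {𝔰 : LieSubalgebra ℂ 𝔤} {𝔫 : LieIdeal ℂ 𝔰} {S R : Set H.root}
  (hI : IsRootIdeal E 𝔰 𝔫 S R) {q : ℕ}

/-- The root vectors of the ideal. -/
def vec (i : {α // α ∈ R}) : 𝔫 :=
  ⟨⟨E.e i, (hI.mem_iff _).2 (E.e_mem_rootSub.2 (hI.subset i.2))⟩,
    (hI.mem_ideal_iff _).2 (E.e_mem_rootSpan.2 i.2)⟩

instance fintypeRoots (R : Set H.root) : Fintype {α // α ∈ R} := Fintype.ofFinite _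

/-- An element of the Cartan subalgebra, as an element of `𝔰`. -/
def cartan (h : H) : 𝔰 := ⟨h, (hI.mem_iff _).2 (E.mem_rootSub_of_mem h.2)⟩

lemma sum_vec (n : 𝔫) : ∑ i : {α // α ∈ R}, E.coef i ((n : 𝔰) : 𝔤) • hI.vec i = n := by
  classical
  have hn := E.mem_rootSpan.1 ((hI.mem_ideal_iff _).1 n.2)
  refine Subtype.ext (Subtype.ext ?_)
  rw [AddSubmonoidClass.coe_finsetSum, AddSubmonoidClass.coe_finsetSum]
  change ∑ j : {α // α ∈ R}, E.coef j (n : 𝔤) • E.e j = _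
  rw [sum_subtype_eq_ite (· ∈ R) fun j ↦ E.coef j (n : 𝔤) • E.e j]
  conv_rhs => rw [← E.hpart_add_sum (n : 𝔤), hn.1, zero_add]
  refine Finset.sum_congr rfl fun α _ ↦ ?_
  split_ifs with h
  · rfl
  · rw [hn.2 α h, zero_smul]

lemma idealAd_vec (h : H) (i : {α // α ∈ R}) :
    idealAd 𝔫 (hI.cartan h) (hI.vec i) = i.1.1 h • hI.vec i :=
  Subtype.ext (Subtype.ext (E.lie_e h.2 i))

/-- The components of an element of `𝔰`. -/
def component (_ : IsRootIdeal E 𝔰 𝔫 S R) (k : Option H.root) : 𝔰 →ₗ[ℂ] 𝔤 :=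
  E.component k ∘ₗ 𝔰.toSubmodule.subtype

lemma component_cartan (h : H) (k : Option H.root) (w : 𝔰) :
    hI.component k (LieModule.toEnd ℂ 𝔰 𝔰 (hI.cartan h) w) = weightAt h k • hI.component k w :=
  E.component_lie k h (w : 𝔤)

lemma eq_zero_of_component (w : 𝔰) (h : ∀ k, hI.component k w = 0) : w = 0 :=
  Subtype.ext (E.eq_zero_of_component h)

/-- The Cartan subalgebra acts on cochains by commuting diagonalizable operators that preserve
coboundaries, so an invariant class lifts to an invariant cochain. A basis of `H` suffices, as the
action is linear in `h`. -/
lemma exists_sub_mem_coboundarySpace (f : Cochain 𝔫 𝔰 (q + 1))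
    (hf : ∀ h : H, cochainAct 𝔫 (hI.cartan h) f ∈ coboundarySpace 𝔫 (q + 1)) :
    ∃ g : Cochain 𝔫 𝔰 (q + 1), f - g ∈ coboundarySpace 𝔫 (q + 1) ∧
      ∀ h : H, cochainAct 𝔫 (hI.cartan h) g = 0 := by
  let B := Module.finBasis ℂ H
  obtain ⟨g, hg, hg'⟩ := exists_sub_mem_and_forall_eq_zero Finset.univ
    (fun k ↦ (cochainAct 𝔫 (hI.cartan (B k)) : Cochain 𝔫 𝔰 (q + 1) →ₗ[ℂ] Cochain 𝔫 𝔰 (q + 1)))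
    (fun k w hw ↦ lieDer_eq_zero_of_sq hI.sum_vec (hI.idealAd_vec (B k))
      (fun j w ↦ hI.component_cartan (B k) j w) hI.eq_zero_of_component w hw)
    (fun k l w ↦ cochainAct_lie 𝔫 (Subtype.ext (cartan_lie_eq_zero (B k).2 (B l).2)) w)
    (coboundarySpace 𝔫 (q + 1))
    (by
      rintro k _ ⟨g, rfl⟩
      exact ⟨_, (lieDer_diff 𝔫 _ g).symm⟩) f (fun k _ ↦ hf (B k))
  refine ⟨g, hg, ?_⟩
  let Λ : H →ₗ[ℂ] Cochain 𝔫 𝔰 (q + 1) :=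
    { toFun := fun h ↦ cochainAct 𝔫 (hI.cartan h) g
      map_add' := fun h h' ↦ by
        have h1 : hI.cartan (h + h') = hI.cartan h + hI.cartan h' := rfl
        simp only [lieDer_apply, h1, idealAd, map_add, LinearMap.add_apply]
        abel
      map_smul' := fun c h ↦ by
        have h1 : hI.cartan (c • h) = c • hI.cartan h := rfl
        simp only [lieDer_apply, h1, idealAd, map_smul, LinearMap.smul_apply, smul_sub,
          RingHom.id_apply] }
  have : Λ = 0 := B.ext fun k ↦ hg' k (Finset.mem_univ _)
  exact fun h ↦ congrArg (fun F ↦ F h) this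

lemma component_smul_eq_zero {f : Cochain 𝔫 𝔰 q} {h : H}
    (hf : cochainAct 𝔫 (hI.cartan h) f = 0) (v : Fin q → {α // α ∈ R}) (k : Option H.root) :
    (weightAt h k - ∑ j, (v j).1.1 h) • E.component k (f (hI.vec ∘ v) : 𝔤) = 0 := by
  have := apply_lieDer_of_eigen (T := LieModule.toEnd ℂ 𝔰 𝔰 (hI.cartan h)) (ℓ := hI.component k)
    (fun w ↦ hI.component_cartan h k w) (hI.idealAd_vec h) f v
  refine this.symm.trans ?_
  rw [show lieDer (LieModule.toEnd ℂ 𝔰 𝔰 (hI.cartan h)) (idealAd 𝔫 (hI.cartan h)) f = 0 from hf,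
    AlternatingMap.zero_apply, map_zero]

end IsRootIdeal

end Normalization

/-! ### Splitting cocycles along the two commuting factors. -/

section Sides

open LieAlgebra LieAlgebra.IsKilling LieModule

variable {𝔤 : Type*} [LieRing 𝔤] [LieAlgebra ℂ 𝔤] [FiniteDimensional ℂ 𝔤] [IsKilling ℂ 𝔤]
  {H : LieSubalgebra ℂ 𝔤} [H.IsCartanSubalgebra]

/-- A grading that cuts out a direct factor of the nilpotent part of a seaweed subalgebra. -/
structure IsSide (G : GradedRoots H) (S R : Set H.root) : Prop where
  mem_pos : ∀ α, α ∈ G.pos ↔ α ∈ S ∧ 0 < G.d α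
  nonneg : ∀ α ∈ S, 0 ≤ G.d α
  pos_subset : G.pos ⊆ R
  subset : R ⊆ S
  zero_subset : G.zero ⊆ S
  negRoot_not_mem : ∀ α ∈ S, negRoot α ∉ R
  closed : IsClosedRoots R R R
  not_root : ∀ α ∈ G.pos, ∀ β ∈ R, β ∉ G.pos → ∀ γ : H.root, ¬ ∀ x : H, γ.1 x = α.1 x + β.1 x

namespace IsSide

variable {G : GradedRoots H} {S R : Set H.root} (E : RootVectors H)
  {𝔰 : LieSubalgebra ℂ 𝔤} {𝔫 : LieIdeal ℂ 𝔰} (hI : IsRootIdeal E 𝔰 𝔫 S R) {q : ℕ}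

lemma closed_diff (hG : IsSide G S R) : IsClosedRoots (R \ G.pos) (R \ G.pos) (R \ G.pos) := fun α hα β hβ γ h ↦ by
  have key : ∀ α ∈ R \ G.pos, G.d α = 0 := fun α hα ↦ le_antisymm
    (not_lt.1 fun h ↦ hα.2 ((hG.mem_pos α).2 ⟨hG.subset hα.1, h⟩))
    (hG.nonneg α (hG.subset hα.1))
  refine ⟨hG.closed α hα.1 β hβ.1 γ h, fun hγ ↦ ?_⟩
  have := hγ.2
  rw [G.d_add h, key α hα, key β hβ] at this
  omega

lemma proj_eq_zero {x : 𝔤} (hx : x ∈ E.rootSpan (R \ G.pos)) :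
    (G.parabolicData E).proj x = 0 := by
  rw [ParabolicData.proj_apply]
  exact Finset.sum_eq_zero fun j _ ↦ by
    rw [show killingForm ℂ 𝔤 ((G.parabolicData E).f j) x = 0 from
      (E.mem_rootSpan.1 hx).2 j fun h ↦ h.2 j.2, zero_smul]

lemma sub_proj_mem {x : 𝔤} (hx : x ∈ E.rootSpan R) :
    x - (G.parabolicData E).proj x ∈ E.rootSpan (R \ G.pos) := by
  refine E.rootSpan_le (W := (E.rootSpan (R \ G.pos)).comap
    (LinearMap.id - (G.nil E).toSubmodule.subtype ∘ₗ (G.parabolicData E).proj)) (fun α hα ↦ ?_) hx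
  change E.e α - ((G.parabolicData E).proj (E.e α) : 𝔤) ∈ E.rootSpan (R \ G.pos)
  by_cases hα' : α ∈ G.pos
  · rw [G.coe_proj_of_mem E (E.e_mem_rootSpan.2 hα'), sub_self]
    exact Submodule.zero_mem _
  · have : E.e α ∈ E.rootSpan (R \ G.pos) := E.e_mem_rootSpan.2 ⟨hα, hα'⟩
    rw [proj_eq_zero E this]
    simpa using this

lemma lie_eq_zero (hG : IsSide G S R) {x y : 𝔤} (hx : x ∈ E.rootSpan G.pos) (hy : y ∈ E.rootSpan (R \ G.pos)) :
    ⁅x, y⁆ = 0 := by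
  have := E.lie_mem_rootSpan (Θ := ∅) (fun α hα β hβ γ h ↦ hG.not_root α hα β hβ.1 hβ.2 γ h)
    (fun α hα h ↦ hG.negRoot_not_mem α ((hG.mem_pos α).1 hα).1 h.1) hx hy
  rwa [RootVectors.rootSpan, Set.image_empty, Submodule.span_empty, Submodule.mem_bot] at this

lemma lie_proj (hG : IsSide G S R) {x y : 𝔤} (hx : x ∈ E.rootSpan R) (hy : y ∈ E.rootSpan G.pos) :
    ⁅((G.parabolicData E).proj x : 𝔤), y⁆ = ⁅x, y⁆ := by
  rw [← sub_eq_zero, ← sub_lie, ← neg_eq_zero, ← neg_lie, neg_sub, ← lie_skew,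
    hG.lie_eq_zero E hy (sub_proj_mem E hx), neg_zero]

/-- The span of `R` is a product of two commuting subalgebras, by `not_root` and `closed_diff`, so
the projection to one factor preserves brackets. -/
lemma proj_lie (hG : IsSide G S R) {x y : 𝔤} (hx : x ∈ E.rootSpan R) (hy : y ∈ E.rootSpan R) :
    (G.parabolicData E).proj ⁅x, y⁆ =
      ⁅(G.parabolicData E).proj x, (G.parabolicData E).proj y⁆ := by
  have hx' := ((G.parabolicData E).proj x).2
  have hy' := ((G.parabolicData E).proj y).2
  have h1 : ⁅x, y⁆ = ⁅((G.parabolicData E).proj x : 𝔤), ((G.parabolicData E).proj y : 𝔤)⁆ +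
      ⁅x - (G.parabolicData E).proj x, y - (G.parabolicData E).proj y⁆ := by
    rw [lie_sub, ← lie_skew (x - _) (((G.parabolicData E).proj y : 𝔤)),
      hG.lie_eq_zero E hy' (sub_proj_mem E hx), hG.lie_proj E hx hy', sub_lie]
    have h2 := hG.lie_eq_zero E hx' (sub_proj_mem E hy)
    rw [lie_sub, hG.lie_proj E hx hy'] at h2
    rw [neg_zero, sub_zero, sub_eq_zero.1 h2]
    abel
  have h2 : ⁅x - (G.parabolicData E).proj x, y - (G.parabolicData E).proj y⁆ ∈
      E.rootSpan (R \ G.pos) :=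
    E.lie_mem_rootSpan hG.closed_diff
      (fun α hα h ↦ hG.negRoot_not_mem α (hG.subset hα.1) h.1)
      (sub_proj_mem E hx) (sub_proj_mem E hy)
  rw [h1, map_add, proj_eq_zero E h2, add_zero]
  exact (G.parabolicData E).proj_φ
    ⁅(G.parabolicData E).proj x, (G.parabolicData E).proj y⁆

variable {E} (hG : IsSide G S R)

/-- The inclusion of the direct factor in the ideal. -/
def incl : G.nil E →ₗ[ℂ] 𝔫 where
  toFun n := ⟨⟨n, (hI.mem_iff _).2 (E.rootSub_le (fun _ hh ↦ E.mem_rootSub_of_mem hh)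
      (fun _ hα ↦ E.e_mem_rootSub.2 (hG.subset (hG.pos_subset hα)))
      (E.rootSpan_le_rootSub _ n.2))⟩, (hI.mem_ideal_iff _).2
      (E.rootSpan_le (fun _ hα ↦ E.e_mem_rootSpan.2 (hG.pos_subset hα)) n.2)⟩
  map_add' _ _ := rfl
  map_smul' _ _ := rfl

/-- The projection of the ideal to the direct factor. -/
def fst (_ : IsSide G S R) (_ : IsRootIdeal E 𝔰 𝔫 S R) : 𝔫 →ₗ[ℂ] G.nil E :=
  (G.parabolicData E).proj ∘ₗ 𝔰.toSubmodule.subtype ∘ₗ 𝔫.toSubmodule.subtype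

lemma incl_fst_vec_of_mem (i : {α // α ∈ R}) (h : i.1 ∈ G.pos) :
    hG.incl hI (hG.fst hI (hI.vec i)) = hI.vec i :=
  Subtype.ext (Subtype.ext (G.coe_proj_of_mem E (E.e_mem_rootSpan.2 h)))

lemma fst_vec_of_not_mem (i : {α // α ∈ R}) (h : i.1 ∉ G.pos) : hG.fst hI (hI.vec i) = 0 :=
  proj_eq_zero E (E.e_mem_rootSpan.2 ⟨i.2, h⟩)

/-- The part of a cochain that lives on the direct factor. -/
def part (f : Cochain 𝔫 𝔰 q) : Cochain 𝔫 𝔰 q :=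
  pull (𝔫.toSubmodule.subtype ∘ₗ hG.incl hI) (hG.fst hI)
    (pull ((G.parabolicData E).proj ∘ₗ 𝔰.toSubmodule.subtype) (hG.incl hI) f)

lemma part_apply_of_not_mem (f : Cochain 𝔫 𝔰 q) (v : Fin q → {α // α ∈ R}) {j : Fin q}
    (hj : (v j).1 ∉ G.pos) : hG.part hI f (hI.vec ∘ v) = 0 := by
  rw [part, pull_apply, AlternatingMap.map_coord_zero (i := j), map_zero]
  exact hG.fst_vec_of_not_mem hI _ hj

lemma part_apply_of_mem (f : Cochain 𝔫 𝔰 q) (v : Fin q → {α // α ∈ R})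
    (hv : ∀ j, (v j).1 ∈ G.pos) (hf : ((f (hI.vec ∘ v) : 𝔰) : 𝔤) ∈ E.rootSpan G.pos) :
    hG.part hI f (hI.vec ∘ v) = f (hI.vec ∘ v) := by
  rw [part, pull_apply, pull_apply]
  have : hG.incl hI ∘ hG.fst hI ∘ hI.vec ∘ v = hI.vec ∘ v :=
    funext fun j ↦ hG.incl_fst_vec_of_mem hI _ (hv j)
  rw [this]
  exact Subtype.ext (G.coe_proj_of_mem E hf)

/-- All degrees on `S` are nonnegative, so one argument of positive degree makes the total positive.
A cochain of weight zero then has values of positive degree in `𝔰`, and by `mem_pos` these are in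
the factor. -/
lemma mem_rootSpan_pos (hG : IsSide G S R) {f : Cochain 𝔫 𝔰 (q + 1)}
    (hf : ∀ h : H, cochainAct 𝔫 (hI.cartan h) f = 0) (v : Fin (q + 1) → {α // α ∈ R})
    (hv : ∃ j, (v j).1 ∈ G.pos) : ((f (hI.vec ∘ v) : 𝔰) : 𝔤) ∈ E.rootSpan G.pos := by
  have hpos : 0 < ∑ j, G.d (v j) := by
    obtain ⟨j, hj⟩ := hv
    exact Finset.sum_pos' (fun j _ ↦ hG.nonneg _ (hG.subset (v j).2))
      ⟨j, Finset.mem_univ _, hj.2⟩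
  have key := hI.component_smul_eq_zero (hf G.x) v
  simp only [G.apply_x] at key
  refine E.mem_rootSpan.2 ⟨(smul_eq_zero.1 (key none)).resolve_left ?_, fun α hα ↦ ?_⟩
  · rw [weightAt, zero_sub, neg_eq_zero]
    exact_mod_cast hpos.ne'
  · by_cases hα' : α ∈ S
    · refine E.coef_eq_zero_of_component ((smul_eq_zero.1 (key (some α))).resolve_left ?_)
      rw [weightAt, G.apply_x, sub_eq_zero]
      have : ¬ 0 < G.d α := fun h ↦ hα ((hG.mem_pos α).2 ⟨hα', h⟩)
      have : G.d α ≠ ∑ j, G.d (v j) := by omega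
      exact_mod_cast this
    · exact E.mem_rootSub.1 ((hI.mem_iff _).1 (f (hI.vec ∘ v)).2) α hα'

/-- The restriction of `f` to the factor, viewed with values in `𝔤`, satisfies the hypotheses of
`exists_diff_eq`. The primitive found there is pulled back to `𝔫`; this commutes with the
differentials, because the projection preserves brackets and `𝔫` acts on the factor through it. -/
lemma exists_diff_eq_part {f : Cochain 𝔫 𝔰 (q + 2)} (hf : diff (idealAct 𝔫 𝔰) f = 0)
    (hh : ∀ h : H, cochainAct 𝔫 (hI.cartan h) f = 0)
    (hr : ∀ y : 𝔰, (y : 𝔤) ∈ E.rootSub G.zero →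
      cochainAct 𝔫 y f ∈ coboundarySpace 𝔫 (q + 2)) :
    ∃ g, diff (idealAct 𝔫 𝔰) g = hG.part hI f := by
  let τ : 𝔰 →ₗ[ℂ] 𝔤 := 𝔰.toSubmodule.subtype
  have hd : ∀ (k : ℕ) (g : Cochain 𝔫 𝔰 k), diff (G.nilAct E) (pull τ (hG.incl hI) g) =
      pull τ (hG.incl hI) (diff (idealAct 𝔫 𝔰) g) := fun k g ↦
    diff_pull τ (hG.incl hI) (fun x w ↦ rfl) (fun x y ↦ rfl) g
  have hl : ∀ y : 𝔰, (y : 𝔤) ∈ E.rootSub G.zero →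
      (G.parabolicData E).lieD (y : 𝔤) (pull τ (hG.incl hI) f) =
        pull τ (hG.incl hI) (cochainAct 𝔫 y f) := fun y hy ↦
    lieDer_pull τ (hG.incl hI) (T := LieModule.toEnd ℂ 𝔰 𝔰 y) (A := idealAd 𝔫 y) (fun w ↦ rfl)
      (fun n ↦ Subtype.ext (Subtype.ext (G.coe_pad E hy n))) f
  have hN : ∀ v, pull τ (hG.incl hI) f v ∈ E.rootSpan G.pos := fun v ↦ by
    refine G.mem_of_apply_e_mem E (W := E.rootSpan G.pos) (fun w ↦ ?_) v
    exact hG.mem_rootSpan_pos hI hh (fun j ↦ ⟨(w j).1, hG.pos_subset (w j).2⟩) ⟨0, (w 0).2⟩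
  have h0 : diff (G.nilAct E) (pull τ (hG.incl hI) f) = 0 := by
    rw [hd, hf]
    ext v; rfl
  have hx : (G.parabolicData E).lieD G.x (pull τ (hG.incl hI) f) = 0 := by
    have := hl (hI.cartan G.x) (G.x_mem_zero E)
    rw [hh] at this
    refine this.trans ?_
    ext v; rfl
  obtain ⟨g, hg⟩ := G.exists_diff_eq E (pull τ (hG.incl hI) f) hN h0 hx fun y hy ↦ by
    have hys : y ∈ 𝔰 := (hI.mem_iff _).2 (E.mem_rootSub.2 fun α hα ↦
      E.mem_rootSub.1 hy α fun h ↦ hα (hG.zero_subset h))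
    obtain ⟨g, hg⟩ := hr ⟨y, hys⟩ hy
    exact ⟨pull τ (hG.incl hI) g, by rw [hd, hg]; exact (hl ⟨y, hys⟩ hy).symm⟩
  refine ⟨pull (𝔫.toSubmodule.subtype ∘ₗ hG.incl hI) (hG.fst hI) g, ?_⟩
  have := diff_pull (𝔫.toSubmodule.subtype ∘ₗ hG.incl hI) (hG.fst hI)
    (a := (LieAlgebra.ad ℂ (G.nil E) : G.nil E →ₗ[ℂ] Module.End ℂ (G.nil E)))
    (a' := idealAct 𝔫 𝔰)
    (fun x w ↦ Subtype.ext (hG.lie_proj E ((hI.mem_ideal_iff _).1 x.2) w.2))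
    (fun x y ↦ hG.proj_lie E ((hI.mem_ideal_iff _).1 x.2) ((hI.mem_ideal_iff _).1 y.2)) g
  rw [this, hg]
  rfl

end IsSide

/-- Invariant cocycles of degree at least two are coboundaries. -/
theorem mem_coboundarySpace_of_isSide {G G' : GradedRoots H} {S R : Set H.root}
    (hG : IsSide G S R) (hG' : IsSide G' S R) (hRG : ∀ α ∈ R, α ∈ G.pos ∨ α ∈ G'.pos)
    (hGG' : ∀ α ∈ G.pos, α ∉ G'.pos) {E : RootVectors H}
    {𝔰 : LieSubalgebra ℂ 𝔤} {𝔫 : LieIdeal ℂ 𝔰} (hI : IsRootIdeal E 𝔰 𝔫 S R) {q : ℕ}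
    {f : Cochain 𝔫 𝔰 (q + 2)} (hf : diff (idealAct 𝔫 𝔰) f = 0)
    (hh : ∀ h : H, cochainAct 𝔫 (hI.cartan h) f = 0)
    (hr : ∀ y : 𝔰, ((y : 𝔤) ∈ E.rootSub G.zero ∨ (y : 𝔤) ∈ E.rootSub G'.zero) →
      cochainAct 𝔫 y f ∈ coboundarySpace 𝔫 (q + 2)) :
    f ∈ coboundarySpace 𝔫 (q + 2) := by
  obtain ⟨g, hg⟩ := hG.exists_diff_eq_part hI hf hh fun y hy ↦ hr y (Or.inl hy)
  obtain ⟨g', hg'⟩ := hG'.exists_diff_eq_part hI hf hh fun y hy ↦ hr y (Or.inr hy)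
  refine ⟨g + g', ?_⟩
  rw [map_add, hg, hg']
  refine ext_of_span hI.sum_vec fun v ↦ ?_
  rw [AlternatingMap.add_apply]
  by_cases h1 : ∀ j, (v j).1 ∈ G.pos
  · rw [hG.part_apply_of_mem hI f v h1 (hG.mem_rootSpan_pos hI hh v ⟨0, h1 0⟩),
      hG'.part_apply_of_not_mem hI f v (hGG' _ (h1 0)), add_zero]
  · obtain ⟨i, hi⟩ := not_forall.1 h1
    rw [hG.part_apply_of_not_mem hI f v hi, zero_add]
    have hi' := (hRG _ (v i).2).resolve_left hi
    have hm := hG'.mem_rootSpan_pos hI hh v ⟨i, hi'⟩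
    by_cases h2 : ∀ j, (v j).1 ∈ G'.pos
    · rw [hG'.part_apply_of_mem hI f v h2 hm]
    · obtain ⟨j, hj⟩ := not_forall.1 h2
      rw [hG'.part_apply_of_not_mem hI f v hj]
      -- With arguments from both factors, the value lies in the spans of two disjoint sets of
      -- roots, hence is zero, as are both parts.
      have hm' := hG.mem_rootSpan_pos hI hh v ⟨j, (hRG _ (v j).2).resolve_right hj⟩
      rw [E.mem_rootSpan] at hm hm'
      refine Eq.symm (Subtype.ext (E.ext (hm.1.trans (map_zero _).symm) fun α ↦ ?_))
      refine Eq.trans ?_ (map_zero _).symm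
      by_cases hα : α ∈ G.pos
      · exact hm.2 α (hGG' α hα)
      · exact hm'.2 α hα

end Sides

/-! ### The two gradings of a seaweed. -/

section SeaweedSides

open LieAlgebra LieAlgebra.IsKilling LieModule

variable {𝔤 : Type*} [LieRing 𝔤] [LieAlgebra ℂ 𝔤] [FiniteDimensional ℂ 𝔤] [IsKilling ℂ 𝔤]
  {H : LieSubalgebra ℂ 𝔤} [H.IsCartanSubalgebra] (b : (rootSystem H).Base) (π₁ π₂ : Set H.root)

lemma exists_root_apply_eq_relDegree : ∃ h : H, ∀ α : H.root, α.1 h = relDegree b π₁ π₂ α :=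
  exists_root_apply_eq_degree b _

/-- The grading that cuts out the positive part of the nilradical. -/
def posGrading : GradedRoots H where
  roots := leviRoots b π₂
  closed := isClosedRoots_leviRoots b π₂
  neg_mem _ h := negRoot_mem_leviRoots b h
  x := (exists_root_apply_eq_relDegree b π₁ π₂).choose
  d := relDegree b π₁ π₂
  apply_x := (exists_root_apply_eq_relDegree b π₁ π₂).choose_spec

/-- The grading that cuts out the negative part of the nilradical. -/
def negGrading : GradedRoots H where
  roots := leviRoots b π₁
  closed := isClosedRoots_leviRoots b π₁
  neg_mem _ h := negRoot_mem_leviRoots b h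
  x := - (posGrading b π₂ π₁).x
  d α := - relDegree b π₂ π₁ α
  apply_x α := by
    have h := (posGrading b π₂ π₁).apply_x α
    have h' : α.1 (-(posGrading b π₂ π₁).x) = -α.1 (posGrading b π₂ π₁).x :=
      map_neg (Weight.toLinear ℂ H 𝔤 α.1) _
    rw [h', h]
    push_cast
    rfl

variable {b π₁ π₂} {α β γ : H.root}

lemma mem_negGrading : α ∈ (negGrading b π₁ π₂).pos ↔ negRoot α ∈ posRoots b π₂ π₁ := by
  change α ∈ leviRoots b π₁ ∧ 0 < - relDegree b π₂ π₁ α ↔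
    negRoot α ∈ leviRoots b π₁ ∧ 0 < relDegree b π₂ π₁ (negRoot α)
  rw [relDegree_negRoot]
  refine and_congr_left fun _ ↦ ⟨negRoot_mem_leviRoots b, fun h ↦ ?_⟩
  have := negRoot_mem_leviRoots b h
  rwa [negRoot_negRoot] at this

/-- The degree is a sum of coefficients of one sign, so its vanishing removes each coefficient at
`π₂ ∖ π₁`. The Levi factor of either grading is thus contained in the reductive part. -/
lemma mem_reductiveRoots_of_relDegree_eq_zero (h : α ∈ leviRoots b π₂)
    (h0 : relDegree b π₁ π₂ α = 0) : α ∈ reductiveRoots b π₁ π₂ := by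
  rw [mem_reductiveRoots_iff]
  intro i hi hi'
  by_cases h2 : i ∈ π₂
  · have h1 : i ∉ π₁ := fun h1 ↦ hi' ⟨h1, h2⟩
    by_contra hk
    rcases rootCoeff_nonneg_or_nonpos b α with h' | h'
    · exact h0.not_gt (relDegree_pos (fun j _ _ _ ↦ h' j) hi h2 h1 hk)
    · have : 0 < relDegree b π₁ π₂ (negRoot α) :=
        relDegree_pos (fun j hj _ _ ↦ by rw [rootCoeff_negRoot b α hj, neg_nonneg]; exact h' j)
          hi h2 h1 (by rw [rootCoeff_negRoot b α hi, neg_ne_zero]; exact hk)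
      rw [relDegree_negRoot] at this
      omega
  · exact h i hi h2

lemma mem_reductiveRoots_comm : α ∈ reductiveRoots b π₁ π₂ ↔ α ∈ reductiveRoots b π₂ π₁ := by
  rw [mem_reductiveRoots_iff, mem_reductiveRoots_iff, Set.inter_comm]

/-- The sum would have a positive coefficient at a simple root where `β` has none, and a negative
one at a simple root where `α` has none. -/
lemma not_root_of_mem_posRoots (hα : α ∈ posRoots b π₁ π₂) (hβ : negRoot β ∈ posRoots b π₂ π₁)
    (h : ∀ x : H, γ.1 x = α.1 x + β.1 x) : False := by
  obtain ⟨i, hi, -, hi1, hki⟩ := exists_of_relDegree_pos hα.2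
  obtain ⟨j, hj, -, hj2, hkj⟩ := exists_of_relDegree_pos hβ.2
  have h1 := rootCoeff_add b h hi
  have h2 := rootCoeff_add b h hj
  have h3 := hβ.1 i hi hi1
  have h4 := hα.1 j hj hj2
  rw [rootCoeff_negRoot b β hi] at h3
  rw [rootCoeff_negRoot b β hj] at hkj
  have := nonneg_of_rootCoeff_pos (b := b) (α := γ) (i := i) (by omega) j
  omega

lemma isSide_posGrading :
    IsSide (posGrading b π₁ π₂) (seaweedRoots b π₁ π₂) (nilpotentRoots b π₁ π₂) where
  mem_pos _ := mem_posRoots_iff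
  nonneg _ h := relDegree_nonneg_of_mem h
  pos_subset _ h := mem_nilpotentRoots_iff.2 (Or.inl h)
  subset _ h := h.1
  zero_subset _ h := (mem_reductiveRoots_of_relDegree_eq_zero h.1 h.2).1
  negRoot_not_mem _ h := negRoot_not_mem_nilpotentRoots h
  closed α hα β hβ γ h := isClosedRoots_nilpotentRoots α hα.1 β hβ γ h
  not_root _ hα _ hβ hβ' _ h :=
    not_root_of_mem_posRoots hα ((mem_nilpotentRoots_iff.1 hβ).resolve_left hβ') h

lemma zero_negGrading_subset : (negGrading b π₁ π₂).zero ⊆ reductiveRoots b π₁ π₂ :=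
  fun _ h ↦ mem_reductiveRoots_comm.1
    (mem_reductiveRoots_of_relDegree_eq_zero h.1 (neg_eq_zero.1 h.2))

lemma isSide_negGrading :
    IsSide (negGrading b π₁ π₂) (seaweedRoots b π₁ π₂) (nilpotentRoots b π₁ π₂) where
  mem_pos α := by
    rw [mem_negGrading, mem_posRoots_iff, negRoot_mem_seaweedRoots_iff, relDegree_negRoot]
    rfl
  nonneg α h := by
    have := relDegree_nonneg_of_mem (negRoot_mem_seaweedRoots_iff.2 h)
    rwa [relDegree_negRoot] at this
  pos_subset _ h := mem_nilpotentRoots_iff.2 (Or.inr (mem_negGrading.1 h))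
  subset _ h := h.1
  zero_subset _ h := (zero_negGrading_subset h).1
  negRoot_not_mem _ h := negRoot_not_mem_nilpotentRoots h
  closed α hα β hβ γ h := isClosedRoots_nilpotentRoots α hα.1 β hβ γ h
  not_root _ hα _ hβ hβ' _ h :=
    not_root_of_mem_posRoots
      ((mem_nilpotentRoots_iff.1 hβ).resolve_right fun h' ↦ hβ' (mem_negGrading.2 h'))
      (mem_negGrading.1 hα) (fun x ↦ by rw [h, add_comm])

lemma mem_posGrading_or_mem_negGrading (h : α ∈ nilpotentRoots b π₁ π₂) :
    α ∈ (posGrading b π₁ π₂).pos ∨ α ∈ (negGrading b π₁ π₂).pos := by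
  rw [mem_negGrading]
  exact mem_nilpotentRoots_iff.1 h

lemma not_mem_negGrading (h : α ∈ (posGrading b π₁ π₂).pos) :
    α ∉ (negGrading b π₁ π₂).pos := fun h' ↦ by
  obtain ⟨i, hi, -, hi1, hki⟩ := exists_of_relDegree_pos h.2
  have h3 := (mem_negGrading.1 h').1 i hi hi1
  rw [rootCoeff_negRoot b α hi] at h3
  omega

end SeaweedSides

/-! ### Additive functions on the roots of the nilpotent part. -/

section DegreeOneRoots

open LieAlgebra LieAlgebra.IsKilling LieModule

variable {𝔤 : Type*} [LieRing 𝔤] [LieAlgebra ℂ 𝔤] [FiniteDimensional ℂ 𝔤] [IsKilling ℂ 𝔤]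
  {H : LieSubalgebra ℂ 𝔤} [H.IsCartanSubalgebra] {b : (rootSystem H).Base} {π₁ π₂ : Set H.root}

/-- In the Jacobi identity, the bracket of `⁅e α, e β⁆` with `e γ` is nonzero, so `⁅e β, e γ⁆` and
`⁅e α, e γ⁆` cannot both vanish. -/
lemma RootVectors.root_add_split (E : RootVectors H) {α β γ δ ε : H.root}
    (hδ : ∀ x : H, δ.1 x = α.1 x + β.1 x) (hε : ∀ x : H, ε.1 x = δ.1 x + γ.1 x)
    (hα : γ ≠ negRoot α) (hβ : γ ≠ negRoot β) :
    (∃ ζ : H.root, ∀ x : H, ζ.1 x = β.1 x + γ.1 x) ∨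
      ∃ ζ : H.root, ∀ x : H, ζ.1 x = α.1 x + γ.1 x := by
  by_contra! h
  obtain ⟨c, hc, hc'⟩ := E.exists_lie_e_e hδ
  obtain ⟨d, hd, hd'⟩ := E.exists_lie_e_e hε
  have h1 := E.lie_e_e_eq_zero hβ fun ζ hζ ↦ by
    obtain ⟨x, hx⟩ := h.1 ζ; exact hx (hζ x)
  have h2 := E.lie_e_e_eq_zero hα fun ζ hζ ↦ by
    obtain ⟨x, hx⟩ := h.2 ζ; exact hx (hζ x)
  have h3 := lie_lie (E.e α) (E.e β) (E.e γ)
  rw [h1, h2, lie_zero, lie_zero, sub_zero, hc', smul_lie, hd', smul_smul] at h3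
  exact E.e_ne_zero ε ((smul_eq_zero.1 h3).resolve_left (mul_ne_zero hc hd))

lemma mem_reductiveRoots_of_add {α β γ : H.root} (hα : α ∈ seaweedRoots b π₁ π₂)
    (hβ : β ∈ seaweedRoots b π₁ π₂) (hγ : γ ∈ reductiveRoots b π₁ π₂)
    (h : ∀ x : H, γ.1 x = α.1 x + β.1 x) : α ∈ reductiveRoots b π₁ π₂ := by
  refine ⟨hα, by_contra fun h' ↦ ?_⟩
  exact (isClosedRoots_nilpotentRoots β hβ α ⟨hα, h'⟩ γ fun x ↦ by rw [h, add_comm]).2 hγ.2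

/-- An additive function on the roots of the nilpotent part that is compatible with the roots of
the reductive part comes from an element of the Cartan subalgebra: the inductive step. -/
lemma additive_aux (E : RootVectors H) {c : H.root → ℂ} {G : H}
    (hc : ∀ α ∈ nilpotentRoots b π₁ π₂, ∀ β ∈ nilpotentRoots b π₁ π₂, ∀ γ : H.root,
      (∀ x : H, γ.1 x = α.1 x + β.1 x) → c γ = c α + c β)
    (σ : H.root → H.root)
    (hσ : ∀ α β γ : H.root, (∀ x : H, γ.1 x = α.1 x + β.1 x) →
      ∀ x : H, (σ γ).1 x = (σ α).1 x + (σ β).1 x)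
    {π : Set H.root}
    (hS : ∀ α, b.IsPos α → α ∈ leviRoots b π → σ α ∈ seaweedRoots b π₁ π₂)
    (hsimple : ∀ j ∈ b.support, j ∈ π → j ∈ leviRoots b π)
    (hbase : ∀ j ∈ b.support, j ∈ π → (σ j ∈ nilpotentRoots b π₁ π₂ → c (σ j) = (σ j).1 G) ∧
      (σ j ∈ reductiveRoots b π₁ π₂ → ∀ β ∈ nilpotentRoots b π₁ π₂, ∀ γ : H.root,
        (∀ x : H, γ.1 x = (σ j).1 x + β.1 x) → c γ = c β + (σ j).1 G))
    {α : H.root} (hα : b.IsPos α) (hπ : α ∈ leviRoots b π) :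
    (σ α ∈ nilpotentRoots b π₁ π₂ → c (σ α) = (σ α).1 G) ∧
      (σ α ∈ reductiveRoots b π₁ π₂ → ∀ β ∈ nilpotentRoots b π₁ π₂, ∀ γ : H.root,
        (∀ x : H, γ.1 x = (σ α).1 x + β.1 x) → c γ = c β + (σ α).1 G) := by
  refine isPos_induction b (p := fun α ↦ (σ α ∈ nilpotentRoots b π₁ π₂ → c (σ α) = (σ α).1 G) ∧
      (σ α ∈ reductiveRoots b π₁ π₂ → ∀ β ∈ nilpotentRoots b π₁ π₂, ∀ γ : H.root,
        (∀ x : H, γ.1 x = (σ α).1 x + β.1 x) → c γ = c β + (σ α).1 G))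
    (fun j hj hj' ↦ hbase j hj hj') ?_ hα hπ
  rintro α j γ h hα hαπ hj hjπ ⟨h1, h2⟩
  have h := hσ α j γ h
  have h' : ∀ x : H, (σ γ).1 x = (σ j).1 x + (σ α).1 x := fun x ↦ by rw [h, add_comm]
  have hαS := hS α hα hαπ
  have hjS := hS j (b.isPos_of_mem_support hj) (hsimple j hj hjπ)
  obtain ⟨h3, h4⟩ := hbase j hj hjπ
  constructor
  · intro hγ
    by_cases hα' : negRoot (σ α) ∈ seaweedRoots b π₁ π₂
    · by_cases hj' : negRoot (σ j) ∈ seaweedRoots b π₁ π₂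
      · exact absurd (isClosedRoots_reductiveRoots b π₁ π₂ _ ⟨hαS, hα'⟩ _ ⟨hjS, hj'⟩ _ h).2 hγ.2
      · rw [h2 ⟨hαS, hα'⟩ _ ⟨hjS, hj'⟩ _ h, h3 ⟨hjS, hj'⟩, h, add_comm]
    · by_cases hj' : negRoot (σ j) ∈ seaweedRoots b π₁ π₂
      · rw [h4 ⟨hjS, hj'⟩ _ ⟨hαS, hα'⟩ _ h', h1 ⟨hαS, hα'⟩, h]
      · rw [hc _ ⟨hαS, hα'⟩ _ ⟨hjS, hj'⟩ _ h, h1 ⟨hαS, hα'⟩, h3 ⟨hjS, hj'⟩, h]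
  · intro hγ β hβ δ hδ
    have hαr := mem_reductiveRoots_of_add hαS hjS hγ h
    have hjr := mem_reductiveRoots_of_add hjS hαS hγ h'
    have hne : ∀ ε ∈ reductiveRoots b π₁ π₂, β ≠ negRoot ε := fun ε hε h0 ↦
      negRoot_not_mem_nilpotentRoots hε.1 (h0 ▸ hβ)
    -- The shift by a reductive root is made in two steps; this chooses an order in which the
    -- intermediate sum is again a root.
    rcases E.root_add_split h hδ (hne _ hαr) (hne _ hjr) with ⟨ε, hε⟩ | ⟨ε, hε⟩
    · have hεR := isClosedRoots_nilpotentRoots _ hjS β hβ ε hε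
      rw [h2 hαr ε hεR δ fun x ↦ by rw [hδ, h, hε]; ring, h4 hjr β hβ ε hε, h]
      ring
    · have hεR := isClosedRoots_nilpotentRoots _ hαS β hβ ε hε
      rw [h4 hjr ε hεR δ fun x ↦ by rw [hδ, h, hε]; ring, h2 hαr β hβ ε hε, h]
      ring

lemma mem_leviRoots_of_mem_support {j : H.root} (hj : j ∈ b.support) {π : Set H.root}
    (h : j ∈ π) : j ∈ leviRoots b π := fun i hi hi' ↦ by
  classical
  rw [rootCoeff_support b hi hj, if_neg fun h' : j = i ↦ hi' (h' ▸ h)]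

lemma mem_of_mem_leviRoots {j : H.root} (hj : j ∈ b.support) {π : Set H.root}
    (h : j ∈ leviRoots b π) : j ∈ π := by
  classical
  by_contra h'
  have := h j hj h'
  rw [rootCoeff_support b hj hj, if_pos rfl] at this
  omega

lemma negRoot_mem_reductiveRoots_iff {α : H.root} :
    negRoot α ∈ reductiveRoots b π₁ π₂ ↔ α ∈ reductiveRoots b π₁ π₂ := by
  rw [reductiveRoots, Set.mem_ofPred_eq, Set.mem_ofPred_eq, negRoot_negRoot, and_comm]

/-- An additive function on the roots of the nilpotent part that is compatible with the roots of
the reductive part comes from an element of the Cartan subalgebra. -/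
theorem exists_apply_eq_of_additive (E : RootVectors H) {c c' : H.root → ℂ}
    (hc : ∀ α ∈ nilpotentRoots b π₁ π₂, ∀ β ∈ nilpotentRoots b π₁ π₂, ∀ γ : H.root,
      (∀ x : H, γ.1 x = α.1 x + β.1 x) → c γ = c α + c β)
    (hc' : ∀ α ∈ reductiveRoots b π₁ π₂, ∀ β ∈ nilpotentRoots b π₁ π₂, ∀ γ : H.root,
      (∀ x : H, γ.1 x = α.1 x + β.1 x) → c γ = c β + c' α) :
    ∃ G : H, ∀ β ∈ nilpotentRoots b π₁ π₂, c β = β.1 G := by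
  classical
  -- The values are forced: a simple root in both sets is reductive, one in `π₁` alone has its
  -- negative in `R`, and one in `π₂` alone is itself in `R`. The value at a simple root in neither
  -- set plays no role.
  obtain ⟨G, hG⟩ := exists_root_apply_eq b fun j ↦
    if j ∈ π₁ then if j ∈ π₂ then c' j else - c (negRoot j) else c j
  refine ⟨G, fun β hβ ↦ ?_⟩
  have hpos : ∀ j ∈ b.support, ∀ i, 0 ≤ rootCoeff b j i := fun j hj ↦
    (isPos_iff_rootCoeff b j).1 (b.isPos_of_mem_support hj)
  have hred : ∀ j ∈ b.support, j ∈ reductiveRoots b π₁ π₂ → j ∈ π₁ ∧ j ∈ π₂ := fun j hj h ↦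
    mem_of_mem_leviRoots hj (mem_reductiveRoots_iff.1 h)
  have hred' : ∀ j ∈ b.support, j ∈ π₁ → j ∈ π₂ → j ∈ reductiveRoots b π₁ π₂ :=
    fun j hj h1 h2 ↦ mem_reductiveRoots_iff.2 (mem_leviRoots_of_mem_support hj ⟨h1, h2⟩)
  rcases mem_nilpotentRoots_iff.1 hβ with h | h
  · obtain ⟨i, -, -, -, hi⟩ := exists_of_relDegree_pos h.2
    refine (additive_aux E hc id (fun α β γ h ↦ h) (π := π₂)
      (fun α hα hα' ↦ ⟨fun i _ _ ↦ (isPos_iff_rootCoeff b α).1 hα i,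
        fun i hi hi' ↦ (hα' i hi hi').le⟩)
      (fun j hj hj' ↦ mem_leviRoots_of_mem_support hj hj')
      (fun j hj hj' ↦ ⟨fun h ↦ ?_, fun h β hβ γ hγ ↦ ?_⟩)
      (isPos_of_rootCoeff_pos b hi) h.1).1 hβ
    · have h1 : j ∉ π₁ := fun h1 ↦ h.2 (hred' j hj h1 hj').2
      rw [id, hG j hj, if_neg h1]
    · obtain ⟨h1, h2⟩ := hred j hj h
      rw [hc' j h β hβ γ hγ, id, hG j hj, if_pos h1, if_pos h2]
  · obtain ⟨i, -, -, -, hi⟩ := exists_of_relDegree_pos h.2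
    have := (additive_aux E hc negRoot (fun α β γ h ↦ negRoot_add h) (π := π₁)
      (fun α hα hα' ↦ negRoot_mem_seaweedRoots_iff.2
        ⟨fun i _ _ ↦ (isPos_iff_rootCoeff b α).1 hα i, fun i hi hi' ↦ (hα' i hi hi').le⟩)
      (fun j hj hj' ↦ mem_leviRoots_of_mem_support hj hj')
      (G := G) (fun j hj hj' ↦ ⟨fun h ↦ ?_, fun h β hβ γ hγ ↦ ?_⟩)
      (isPos_of_rootCoeff_pos b hi) h.1).1
    · rw [negRoot_negRoot] at this
      exact this hβ
    · have h2 : j ∉ π₂ := fun h2 ↦ by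
        have := (hred' j hj hj' h2).1
        exact h.2 (by rwa [negRoot_negRoot])
      rw [negRoot_apply, hG j hj, if_pos hj', if_neg h2, neg_neg]
    · have h' := negRoot_mem_reductiveRoots_iff.1 h
      obtain ⟨h1, h2⟩ := hred j hj h'
      -- `G` is normalized by `c'` at `j`, not at `-j`, so the relation `γ = -j + β` is used in the
      -- form `β = j + γ`.
      have hγR := isClosedRoots_nilpotentRoots _ h.1 β hβ γ hγ
      rw [hc' j h' γ hγR β fun x ↦ by rw [hγ, negRoot_apply]; ring, negRoot_apply, hG j hj,
        if_pos h1, if_pos h2]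
      ring

end DegreeOneRoots

/-! ### Degree one, and the vanishing of the invariant cohomology. -/

section LowDegree

variable {K N V : Type*} [Field K] [LieRing N] [LieAlgebra K N]
  [AddCommGroup V] [Module K V]

lemma diff_zero_apply (a : N →ₗ[K] Module.End K V) (g : N [⋀^Fin 0]→ₗ[K] V) (x : N) :
    diff a g ![x] = a x (g ![]) := by
  have := congrArg (fun F ↦ F ![]) (contract_diff_zero a x g)
  simpa [lieDer_apply, der_zero_eq] using this

lemma diff_one_apply [CharZero K] (a : N →ₗ[K] Module.End K V) (f : N [⋀^Fin 1]→ₗ[K] V)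
    (x y : N) :
    diff a f ![x, y] = a x (f ![y]) - f ![⁅x, y⁆] - a y (f ![x]) := by
  have := congrArg (fun F ↦ F ![y]) (contract_diff a x f)
  simp only [AlternatingMap.sub_apply, diff_zero_apply, lieDer_apply, der_apply] at this
  have h1 : Function.update ![y] 0 ⁅x, y⁆ = ![⁅x, y⁆] := by
    funext i; fin_cases i; rfl
  simpa [h1] using this

end LowDegree

section DegreeOne

open LieAlgebra LieAlgebra.IsKilling LieModule

variable {𝔤 : Type*} [LieRing 𝔤] [LieAlgebra ℂ 𝔤] [FiniteDimensional ℂ 𝔤] [IsKilling ℂ 𝔤]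
  {H : LieSubalgebra ℂ 𝔤} [H.IsCartanSubalgebra] {b : (rootSystem H).Base} {π₁ π₂ : Set H.root}

/-- For reasons of weight, only the component of `w` along `α = γ - β` contributes. -/
lemma RootVectors.coef_lie_e (E : RootVectors H) {α β γ : H.root}
    (h : ∀ x : H, γ.1 x = α.1 x + β.1 x) (w : 𝔤) :
    E.coef γ ⁅E.e β, w⁆ = E.coef α w * E.coef γ ⁅E.e β, E.e α⁆ := by
  refine E.induction (p := fun w ↦ E.coef γ ⁅E.e β, w⁆ =
    E.coef α w * E.coef γ ⁅E.e β, E.e α⁆) (fun t ht ↦ ?_) (fun δ c ↦ ?_)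
    (fun x y hx hy ↦ by rw [lie_add, map_add, map_add, hx, hy, add_mul]) w
  · have hne : β ≠ γ := fun h0 ↦ by
      obtain ⟨x, hx⟩ := exists_root_apply_ne_zero α
      have := h x
      rw [h0] at this
      exact hx (by linear_combination -this)
    rw [← lie_skew, E.lie_e ht, map_neg, map_smul, E.coef_e_of_ne hne, E.coef_of_mem α ht,
      smul_zero, neg_zero, zero_mul]
  · rw [lie_smul, map_smul, map_smul, smul_eq_mul, smul_eq_mul, mul_assoc]
    congr 1
    by_cases hδ : δ = α
    · rw [hδ, E.coef_e_self, one_mul]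
    · rw [E.coef_e_of_ne hδ, zero_mul]
      by_cases hn : δ = negRoot β
      · rw [hn]
        exact E.coef_of_mem γ (E.lie_e_e_negRoot_mem β)
      · by_cases hζ : ∃ ζ : H.root, ∀ x : H, ζ.1 x = β.1 x + δ.1 x
        · obtain ⟨ζ, hζ⟩ := hζ
          obtain ⟨c, -, hc⟩ := E.exists_lie_e_e hζ
          have : ζ ≠ γ := fun h0 ↦ hδ (root_ext fun x ↦ by
            have h1 := hζ x
            rw [h0, h] at h1
            linear_combination -h1)
          rw [hc, map_smul, E.coef_e_of_ne this, smul_zero]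
        · rw [E.lie_e_e_eq_zero hn (not_exists.1 hζ), map_zero]

variable {E : RootVectors H} {𝔰 : LieSubalgebra ℂ 𝔤} {𝔫 : LieIdeal ℂ 𝔰}

/-- Invariant cocycles of degree one are coboundaries. -/
theorem mem_coboundarySpace_one
    (hI : IsRootIdeal E 𝔰 𝔫 (seaweedRoots b π₁ π₂) (nilpotentRoots b π₁ π₂))
    {f : Cochain 𝔫 𝔰 1} (hf : diff (idealAct 𝔫 𝔰) f = 0)
    (hh : ∀ h : H, cochainAct 𝔫 (hI.cartan h) f = 0)
    (hr : ∀ y : 𝔰, (y : 𝔤) ∈ E.rootSub (reductiveRoots b π₁ π₂) →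
      cochainAct 𝔫 y f ∈ coboundarySpace 𝔫 1) :
    f ∈ coboundarySpace 𝔫 1 := by
  classical
  let f₁ : 𝔫 →ₗ[ℂ] 𝔰 := (AlternatingMap.ofSubsingleton ℂ 𝔫 𝔰 (0 : Fin 1)).symm f
  have hf₁ : ∀ n, f ![n] = f₁ n := fun n ↦ by
    change _ = f (fun _ ↦ n)
    congr 1
    funext i
    fin_cases i
    rfl
  have hact : ∀ (y : 𝔰) (n : 𝔫), cochainAct 𝔫 y f ![n] = ⁅y, f₁ n⁆ - f₁ ⁅y, n⁆ := fun y n ↦ by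
    rw [← hf₁, ← hf₁]
    have h1 : Function.update ![n] 0 (idealAd 𝔫 y n) = ![⁅y, n⁆] := by
      funext i; fin_cases i; rfl
    simp only [lieDer_apply, AlternatingMap.sub_apply, der_apply]
    simp [h1]
  let c : H.root → ℂ := fun α ↦
    if h : α ∈ nilpotentRoots b π₁ π₂ then E.coef α (f₁ (hI.vec ⟨α, h⟩) : 𝔤) else 0
  -- A `1`-cochain annihilated by `H` preserves weights, so it is diagonal on the root vectors.
  have hc : ∀ α (h : α ∈ nilpotentRoots b π₁ π₂), (f₁ (hI.vec ⟨α, h⟩) : 𝔤) = c α • E.e α := by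
    intro α h
    simp only [c, dif_pos h]
    refine E.eq_smul_of_lie fun t ↦ ?_
    have h1 := hact (hI.cartan t) (hI.vec ⟨α, h⟩)
    rw [hh] at h1
    have h2 : ⁅hI.cartan t, hI.vec ⟨α, h⟩⁆ = α.1 t • hI.vec ⟨α, h⟩ := hI.idealAd_vec t ⟨α, h⟩
    rw [h2, map_smul, AlternatingMap.zero_apply, eq_comm, sub_eq_zero] at h1
    exact congrArg Subtype.val h1
  have hvec : ∀ (α β γ : H.root) (hβ : β ∈ nilpotentRoots b π₁ π₂)
      (hγ : γ ∈ nilpotentRoots b π₁ π₂) (y : 𝔰) (_ : (y : 𝔤) = E.e α) (k : ℂ),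
      ⁅E.e α, E.e β⁆ = k • E.e γ → ⁅y, hI.vec ⟨β, hβ⟩⁆ = k • hI.vec ⟨γ, hγ⟩ := by
    intro α β γ hβ hγ y hy k hk
    refine Subtype.ext (Subtype.ext ?_)
    change ⁅(y : 𝔤), E.e β⁆ = k • E.e γ
    rw [hy, hk]
  -- The action of `e α` on `f` is the coboundary of some `0`-cochain `g`. Evaluated on `e β` and
  -- compared along `e γ`, it shows that `c γ - c β` is the `α`-component of `g`, whatever `β` is.
  have hw : ∀ α : H.root, ∃ c', α ∈ reductiveRoots b π₁ π₂ → ∀ β ∈ nilpotentRoots b π₁ π₂,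
      ∀ γ : H.root, (∀ x : H, γ.1 x = α.1 x + β.1 x) → c γ = c β + c' := by
    intro α
    by_cases hα : α ∈ reductiveRoots b π₁ π₂
    · let y : 𝔰 := ⟨E.e α, (hI.mem_iff _).2 (E.e_mem_rootSub.2 hα.1)⟩
      obtain ⟨g, hg⟩ := hr y (E.e_mem_rootSub.2 hα)
      refine ⟨E.coef α (g ![] : 𝔤), fun _ β hβ γ hγ ↦ ?_⟩
      have hγR := isClosedRoots_nilpotentRoots α hα.1 β hβ γ hγ
      obtain ⟨k, hk, hk'⟩ := E.exists_lie_e_e hγ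
      have h1 := congrArg (fun F ↦ F ![hI.vec ⟨β, hβ⟩]) hg
      beta_reduce at h1
      rw [diff_zero_apply, hact, hvec α β γ hβ hγR y rfl k hk', map_smul] at h1
      have h2 : ⁅E.e β, (g ![] : 𝔤)⁆ = ⁅E.e α, c β • E.e β⁆ - k • c γ • E.e γ := by
        rw [← hc β hβ, ← hc γ hγR]
        exact congrArg Subtype.val h1
      have h3 := E.coef_lie_e hγ (g ![] : 𝔤)
      rw [h2, lie_smul, hk', ← lie_skew, hk'] at h3
      simp only [map_sub, map_neg, map_smul, E.coef_e_self, smul_eq_mul, mul_one] at h3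
      refine mul_left_cancel₀ hk ?_
      linear_combination -h3
    · exact ⟨0, fun h ↦ absurd h hα⟩
  choose c' hc' using hw
  obtain ⟨G, hG⟩ := exists_apply_eq_of_additive E (c := c) (c' := c') (fun α hα β hβ γ hγ ↦ by
      have hγR := isClosedRoots_nilpotentRoots α hα.1 β hβ γ hγ
      obtain ⟨k, hk, hk'⟩ := E.exists_lie_e_e hγ
      have h1 := diff_one_apply (idealAct 𝔫 𝔰) f (hI.vec ⟨α, hα⟩) (hI.vec ⟨β, hβ⟩)
      rw [hf, AlternatingMap.zero_apply, hf₁, hf₁, hf₁,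
        show ⁅hI.vec ⟨α, hα⟩, hI.vec ⟨β, hβ⟩⁆ = k • hI.vec ⟨γ, hγR⟩ from
          hvec α β γ hβ hγR (hI.vec ⟨α, hα⟩) rfl k hk', map_smul] at h1
      have h2 : (0 : 𝔤) = ⁅E.e α, c β • E.e β⁆ - k • c γ • E.e γ - ⁅E.e β, c α • E.e α⁆ := by
        rw [← hc β hβ, ← hc γ hγR, ← hc α hα]
        exact congrArg Subtype.val h1
      rw [lie_smul, lie_smul, hk', ← lie_skew (E.e β), hk'] at h2
      have h3 := congrArg (E.coef γ) h2
      simp only [map_sub, map_neg, map_smul, E.coef_e_self, smul_eq_mul, mul_one, map_zero,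
        smul_neg] at h3
      refine mul_left_cancel₀ hk ?_
      linear_combination h3) hc'
  -- The sign is needed because `⁅e β, -G⁆ = ⁅G, e β⁆ = β(G) • e β`.
  refine ⟨AlternatingMap.constOfIsEmpty ℂ 𝔫 (Fin 0) (-hI.cartan G), ?_⟩
  refine ext_of_span hI.sum_vec fun v ↦ ?_
  have hv : hI.vec ∘ v = ![hI.vec (v 0)] := by
    funext i; fin_cases i; rfl
  rw [hv, diff_zero_apply, hf₁]
  refine Subtype.ext ?_
  rw [hc (v 0).1 (v 0).2, hG _ (v 0).2]
  change ⁅E.e (v 0), -(G : 𝔤)⁆ = _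
  rw [lie_neg, lie_skew, E.lie_e G.2]

/-- The invariants of the cohomology of the nilpotent part of a seaweed subalgebra. -/
theorem invariantCohomology_eq_bot
    (hI : IsRootIdeal E 𝔰 𝔫 (seaweedRoots b π₁ π₂) (nilpotentRoots b π₁ π₂))
    {𝔯 : LieSubalgebra ℂ 𝔰}
    (h𝔯 : ∀ x : 𝔰, x ∈ 𝔯 ↔ (x : 𝔤) ∈ E.rootSub (reductiveRoots b π₁ π₂)) (q : ℕ) :
    invariantCohomology 𝔫 𝔰 𝔯 (q + 1) = ⊥ := by
  rw [invariantCohomology_eq_bot_iff]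
  intro f hf hr
  obtain ⟨g, hg, hgH⟩ := hI.exists_sub_mem_coboundarySpace f fun h ↦
    hr ⟨hI.cartan h, (h𝔯 _).2 (E.mem_rootSub_of_mem h.2)⟩
  have hg0 : diff (idealAct 𝔫 𝔰) g = 0 := by
    obtain ⟨u, hu⟩ := hg
    have h1 := diff_diff (idealAct 𝔫 𝔰) (idealAct_lie 𝔫) u
    rw [hu, map_sub, hf, zero_sub, neg_eq_zero] at h1
    exact h1
  have hgr : ∀ y : 𝔰, (y : 𝔤) ∈ E.rootSub (reductiveRoots b π₁ π₂) →
      cochainAct 𝔫 y g ∈ coboundarySpace 𝔫 (q + 1) := fun y hy ↦ by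
    obtain ⟨u, hu⟩ := hg
    have h1 := hr ⟨y, (h𝔯 y).2 hy⟩
    have h2 : cochainAct 𝔫 y (f - g) ∈ coboundarySpace 𝔫 (q + 1) :=
      ⟨_, by rw [← lieDer_diff, hu]⟩
    have h3 := Submodule.sub_mem _ h1 h2
    rwa [map_sub, sub_sub_cancel] at h3
  suffices h : g ∈ coboundarySpace 𝔫 (q + 1) by
    have := Submodule.add_mem _ hg h
    rwa [sub_add_cancel] at this
  cases q with
  | zero => exact mem_coboundarySpace_one hI hg0 hgH hgr
  | succ q =>
    refine mem_coboundarySpace_of_isSide isSide_posGrading isSide_negGrading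
      (fun α h ↦ mem_posGrading_or_mem_negGrading h) (fun α h ↦ not_mem_negGrading h) hI hg0 hgH
      -- Both Levi factors lie in the reductive part, so its invariance hypothesis covers each of
      -- them.
      fun y hy ↦ hgr y (E.mem_rootSub.2 fun α hα ↦ ?_)
    rcases hy with hy | hy
    · exact E.mem_rootSub.1 hy α fun h ↦ hα (mem_reductiveRoots_of_relDegree_eq_zero h.1 h.2)
    · exact E.mem_rootSub.1 hy α fun h ↦ hα (zero_negGrading_subset h)

end DegreeOne

end Seaweed
end

open LieAlgebra LieAlgebra.IsKilling in
theorem mainTheorem2 {𝔤 : Type*} [LieRing 𝔤] [LieAlgebra ℂ 𝔤] [FiniteDimensional ℂ 𝔤]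
    [IsSimple ℂ 𝔤] (H : LieSubalgebra ℂ 𝔤) [H.IsCartanSubalgebra]
    (b : (rootSystem H).Base) (π₁ π₂ : Set H.root)
    (h₁ : π₁ ⊆ b.support) (h₂ : π₂ ⊆ b.support)
    (𝔰 : LieSubalgebra ℂ 𝔤) (h𝔰 : 𝔰 = Seaweed.seaweed b π₁ π₂)
    (𝔯 : LieSubalgebra ℂ 𝔰) (h𝔯 : 𝔯 = Seaweed.reductivePart H 𝔰)
    (𝔫 : LieIdeal ℂ 𝔰) (h𝔫 : 𝔫 = Seaweed.nilpotentPart H 𝔰) :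
    IsCompl 𝔯.toSubmodule 𝔫.toSubmodule ∧
    (Seaweed.IsIndecomposable b π₁ π₂ →
      IsGreatest {I : LieIdeal ℂ 𝔰 | LieRing.IsNilpotent I} 𝔫) ∧
    ∀ q : ℕ, 1 ≤ q → Seaweed.invariantCohomology 𝔫 𝔰 𝔯 q = ⊥ := by
  subst h𝔰 h𝔯 h𝔫
  obtain ⟨E⟩ := Seaweed.RootVectors.nonempty b
  have hs : ∀ x, x ∈ Seaweed.seaweed b π₁ π₂ ↔ x ∈ E.rootSub (Seaweed.seaweedRoots b π₁ π₂) :=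
    fun x ↦ Seaweed.mem_seaweed E h₁ h₂
  have hI : Seaweed.IsRootIdeal E (Seaweed.seaweed b π₁ π₂) (Seaweed.nilpotentPart H _)
      (Seaweed.seaweedRoots b π₁ π₂) (Seaweed.nilpotentRoots b π₁ π₂) :=
    ⟨hs, Seaweed.mem_nilpotentPart E hs, fun _ h ↦ h.1⟩
  refine ⟨Seaweed.isCompl_parts E hs, Seaweed.isGreatest_nilpotentPart E hs, fun q hq ↦ ?_⟩
  obtain ⟨q, rfl⟩ := Nat.exists_eq_add_of_le' hq
  exact Seaweed.invariantCohomology_eq_bot hI (Seaweed.mem_reductivePart E hs) q
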